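/- **Setting.** Let $n\ge 1$, $T\ge 2$, $H\ge 1$ be integers and $\bar H=H-1$. Let $\mathcal K\subset\mathbb R^n$ be convex, closed and bounded, with non-empty interior and diameter at most $D$. Let $R$ be a $\nu$-self-concordant barrier of $\mathcal K$: $R$ is three times continuously differentiable on $\mathrm{int}(\mathcal K)$, $R(x_k)\to\infty$ whenever $x_k\in\mathrm{int}(\mathcal K)$ converges to a boundary point of $\mathcal K$, and for all $x\in\mathrm{int}(\mathcal K)$, $h\in\mathbb R^n$, $$|\nabla^3R(x)[h,h,h]|\le 2|\nabla^2R(x)[h,h]|^{3/2},\qquad |\langle\nabla R(x),h\rangle|\le\sqrt{\nu}\,|\nabla^2R(x)[h,h]|^{1/2}.$$ **Algorithm EBCO-M** (step size $\eta>0$, parameter $\sigma>0$). Let $u_1,\dots,u_T$ be i.i.d. uniform on the unit sphere $S^{n-1}$. Put $x_t=\arg\min_{\mathcal K}R$ for $1\le t\le H$. For all $t$ put $A_t=(\nabla^2R(x_t)+\eta\sigma tI)^{-1/2}$ and play $y_t=x_t+A_tu_t$. Put $g_t=0$ for $t<H$ and, for $t=H,\dots,T$, $$g_t=nF_t(y_{t-\bar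 H},\dots,y_t)\sum_{i=0}^{\bar H}A_{t-i}^{-1}u_{t-i},\qquad x_{t+1}=\arg\min_{x\in\mathcal K}\ \sum_{s=H}^t\Big(g_{s-\bar H}^\top x+\tfrac\sigma2\|x-x_{s-\bar H}\|_2^2\Big)+\tfrac1\eta R(x).$$ **Losses.** For $H\le t\le T$ the (random) loss $F_t$ satisfies, for every outcome: $F_t(w)=w^\top W_tw+b_t^\top w+c_t$ is quadratic with $W_t\preceq\beta I$; its unary form $f_t(z)=F_t(z,\dots,z)$ satisfies $f_t(z)\ge f_t(z')+\nabla f_t(z')^\top(z-z')+\frac\sigma2\|z-z'\|_2^2$ for $z,z'\in\mathcal K$; and $0\le F_t\le B$ and $\|\nabla F_t\|_2\le L$ on $\mathcal K^H$. Here $\beta,\sigma,B,L>0$. **Adversary.** For $H\le t\le T$, the loss $F_t$, jointly with the earlier noises and losses $u_1,\dots,u_{t-H},F_H,\dots,F_{t-H}$, is independent of the last $H$ noises $(u_{t-\bar H},\dots,u_t)$; it may depend on the earlier noises. **Theorem.** For all $a\in\mathbb R$, $p\in\mathbb N$ and $c_1,c_2>0$ there are $C>0$ and $q\in\mathbb N$,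 depending only on $a,p,c_1,c_2$, such that whenever the above holds with $H\le a(\log T)^p$ and $$\frac{c_1}{nBH(1+\log H)\sqrt T}\le\eta\le\frac{c_2}{nBH(1+\log H)\sqrt T},$$ all plays $y_1,\dots,y_T$ lie in $\mathcal K$, the losses suffered are integrable, and $$\sum_{t=H}^T\mathbb E[F_t(y_{t-\bar H},\dots,y_t)]-\min_{x\in\mathcal K}\sum_{t=H}^T\mathbb E[f_t(x)]\ \le\ C\,(1+B+D+L+\nu)^q(\log T)^q\ \frac{\beta n}{\sigma}\sqrt T .$$ That is, the expected regret is $\tilde{\mathcal O}\big(\frac{\beta n}{\sigma}\sqrt T\big)$, where $\tilde{\mathcal O}$ hides factors polynomial in $B,D,L,\nu$ and in $\log T$. -/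

import Mathlib

open MeasureTheory ProbabilityTheory Filter Topology
open scoped RealInnerProductSpace

noncomputable section

namespace EBCOM

/-- Euclidean space `ℝⁿ`. -/
abbrev E (n : ℕ) := EuclideanSpace ℝ (Fin n)

/-- `(ℝⁿ)^H ≅ ℝ^{nH}` with the Euclidean norm and inner product. -/
abbrev V (n H : ℕ) := PiLp 2 (fun _ : Fin H => E n)

/-- The constant tuple `(z, …, z)`. -/
def diag {n : ℕ} (H : ℕ) (z : E n) : V n H := WithLp.toLp 2 (fun _ => z)

/-- The induced unary form `f(z) = F(z, …, z)`. -/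
def unary {n H : ℕ} (F : V n H → ℝ) (z : E n) : ℝ := F (diag H z)

/-- `K` is convex, closed, bounded, with non-empty interior and diameter at most `D`. -/
structure IsConstraintSet {n : ℕ} (K : Set (E n)) (D : ℝ) : Prop where
  convex : Convex ℝ K
  isClosed : IsClosed K
  isBounded : Bornology.IsBounded K
  interior_nonempty : (interior K).Nonempty
  diam_le : ∀ z ∈ K, ∀ z' ∈ K, ‖z - z'‖ ≤ D

/-- `R` is a `ν`-self-concordant barrier of `K`. Only the values of `R` on the interior of `K`
matter. -/
structure IsSelfConcordantBarrier {n : ℕ} (K : Set (E n)) (R : E n → ℝ) (ν : ℝ) : Prop where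
  contDiffOn : ContDiffOn ℝ 3 R (interior K)
  boundary : ∀ x ∈ frontier K, Tendsto R (𝓝[interior K] x) atTop
  self_concordant : ∀ x ∈ interior K, ∀ h : E n,
    |iteratedFDeriv ℝ 3 R x ![h, h, h]| ≤ 2 * |iteratedFDeriv ℝ 2 R x ![h, h]| ^ (3 / 2 : ℝ)
  barrier : ∀ x ∈ interior K, ∀ h : E n,
    |fderiv ℝ R x h| ≤ √ν * |iteratedFDeriv ℝ 2 R x ![h, h]| ^ (1 / 2 : ℝ)

/-- The regularity and curvature conditions on one loss function. The loss is a quadratic polynomial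
on `(ℝⁿ)^H` (the extension of its restriction to `K^H`); all other conditions are imposed on `K^H`
only. The matrix `W` is given as a linear operator, and `W ⪯ β I` is the inequality of quadratic
forms. -/
structure IsLoss {n H : ℕ} (K : Set (E n)) (β σ B L : ℝ) (F : V n H → ℝ) : Prop where
  quadratic_smooth : ∃ (W : V n H →ₗ[ℝ] V n H) (b : V n H) (c : ℝ),
    (∀ w, F w = ⟪w, W w⟫ + ⟪b, w⟫ + c) ∧ ∀ v, ⟪v, W v⟫ ≤ β * ‖v‖ ^ 2
  strongly_convex : ∀ z ∈ K, ∀ z' ∈ K,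
    unary F z ≥ unary F z' + ⟪gradient (unary F) z', z - z'⟫ + σ / 2 * ‖z - z'‖ ^ 2
  nonneg : ∀ w : V n H, (∀ i, w i ∈ K) → 0 ≤ F w
  bounded : ∀ w : V n H, (∀ i, w i ∈ K) → F w ≤ B
  gradient_bound : ∀ w : V n H, (∀ i, w i ∈ K) → ‖gradient F w‖ ≤ L

/-- The uniform probability distribution on the unit sphere of `ℝⁿ` (for `n ≥ 1`): the normalized
surface measure. -/
def uniformSphere (n : ℕ) : Measure (Metric.sphere (0 : E n) 1) :=
  ((volume : Measure (E n)).toSphere Set.univ)⁻¹ • (volume : Measure (E n)).toSphere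

/-! The algorithm, for a fixed realization `u` of the exploration noises and `F` of the losses. -/

/-- A minimizer of `f` over `S` (an arbitrary point if there is none). -/
def argminOn {n : ℕ} (f : E n → ℝ) (S : Set (E n)) : E n :=
  Classical.epsilon (fun x => x ∈ S ∧ IsMinOn f S x)

/-- The Hessian matrix `∇²R(x)`. -/
def hessian {n : ℕ} (R : E n → ℝ) (x : E n) : Matrix (Fin n) (Fin n) ℝ :=
  Matrix.of fun i j =>
    iteratedFDeriv ℝ 2 R x ![EuclideanSpace.single i 1, EuclideanSpace.single j 1]

/-- A matrix acting on a vector of `ℝⁿ`. -/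
def act {n : ℕ} (M : Matrix (Fin n) (Fin n) ℝ) (v : E n) : E n :=
  WithLp.toLp 2 (M.mulVec (WithLp.ofLp v))

/-- `A_t = (∇²R(x_t) + η σ t I)^{-1/2}`, the power being taken by functional calculus. -/
def ellipsoid {n : ℕ} (R : E n → ℝ) (η σ : ℝ) (x : ℕ → E n) (t : ℕ) :
    Matrix (Fin n) (Fin n) ℝ :=
  cfc (fun r : ℝ => r ^ (-(1 / 2) : ℝ)) (hessian R (x t) + (η * σ * (t : ℝ)) • 1)

/-- `y_t = x_t + A_t u_t`. -/
def play {n : ℕ} (R : E n → ℝ) (η σ : ℝ) (u x : ℕ → E n) (t : ℕ) : E n :=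
  x t + act (ellipsoid R η σ x t) (u t)

/-- The tuple `(y_{t-H+1}, …, y_t)`, used for `t ≥ H`. -/
def window {n : ℕ} (H : ℕ) (y : ℕ → E n) (t : ℕ) : V n H :=
  WithLp.toLp 2 (fun i : Fin H => y (t - (H - 1) + (i : ℕ)))

/-- The gradient estimator: `g_t = 0` for `t < H`, and
`g_t = n F_t(y_{t-H+1}, …, y_t) ∑_{i=0}^{H-1} A_{t-i}⁻¹ u_{t-i}` for `t ≥ H`. -/
def gradEst {n H : ℕ} (R : E n → ℝ) (η σ : ℝ) (u : ℕ → E n) (F : ℕ → V n H → ℝ)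
    (x : ℕ → E n) (t : ℕ) : E n :=
  if t < H then 0 else
    ((n : ℝ) * F t (window H (play R η σ u x) t)) •
      ∑ i ∈ Finset.range H, act (ellipsoid R η σ x (t - i))⁻¹ (u (t - i))

/-- The delayed regularized-follow-the-leader update `x_{t+1}` from `x_1, …, x_t`. The barrier is
`+∞` off the interior of `K`, so that the minimum over `K` is the one over the interior. -/
def nextIterate {n H : ℕ} (K : Set (E n)) (R : E n → ℝ) (η σ : ℝ) (u : ℕ → E n)
    (F : ℕ → V n H → ℝ) (x : ℕ → E n) (t : ℕ) : E n :=
  argminOn (fun z =>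
    ∑ s ∈ Finset.Icc H t,
      (⟪gradEst R η σ u F x (s - (H - 1)), z⟫ + σ / 2 * ‖z - x (s - (H - 1))‖ ^ 2)
      + 1 / η * R z) (interior K)

/-- The iterates computed up to time `t`: `history t s = x_s` for `s ≤ t`. -/
def history {n H : ℕ} (K : Set (E n)) (R : E n → ℝ) (η σ : ℝ) (u : ℕ → E n)
    (F : ℕ → V n H → ℝ) : ℕ → ℕ → E n
  | 0 => fun _ => argminOn R (interior K)
  | t + 1 => Function.update (history K R η σ u F t) (t + 1)
      (if t + 1 ≤ H then argminOn R (interior K)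
        else nextIterate K R η σ u F (history K R η σ u F t) t)

/-- The iterate `x_t`. -/
def iterate {n H : ℕ} (K : Set (E n)) (R : E n → ℝ) (η σ : ℝ) (u : ℕ → E n)
    (F : ℕ → V n H → ℝ) (t : ℕ) : E n :=
  history K R η σ u F t t

/-- The point `y_t` played by the algorithm. -/
def played {n H : ℕ} (K : Set (E n)) (R : E n → ℝ) (η σ : ℝ) (u : ℕ → E n)
    (F : ℕ → V n H → ℝ) (t : ℕ) : E n :=
  play R η σ u (iterate K R η σ u F) t

/-! The probabilistic setting. -/

/-- The point `y_t(ω)` played when the noises are `u_s(ω)` and the losses are `F_s(ω)`. -/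
def playedRV {Ω : Type*} {n H : ℕ} (K : Set (E n)) (R : E n → ℝ) (η σ : ℝ)
    (u : ℕ → Ω → Metric.sphere (0 : E n) 1) (F : ℕ → Ω → V n H → ℝ) (t : ℕ) (ω : Ω) : E n :=
  played K R η σ (fun s => (u s ω : E n)) (fun s => F s ω) t

/-- The loss `F_t(y_{t-H+1}, …, y_t)` suffered at time `t`. -/
def suffered {Ω : Type*} {n H : ℕ} (K : Set (E n)) (R : E n → ℝ) (η σ : ℝ)
    (u : ℕ → Ω → Metric.sphere (0 : E n) 1) (F : ℕ → Ω → V n H → ℝ) (t : ℕ) (ω : Ω) : ℝ :=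
  F t ω (window H (fun s => playedRV K R η σ u F s ω) t)

/-- The exploration noises `u_1, …, u_T` are independent and uniform on the unit sphere. -/
structure IsExplorationNoise {Ω : Type*} [MeasurableSpace Ω] (P : Measure Ω) {n : ℕ} (T : ℕ)
    (u : ℕ → Ω → Metric.sphere (0 : E n) 1) : Prop where
  measurable : ∀ t ∈ Finset.Icc 1 T, Measurable (u t)
  law : ∀ t ∈ Finset.Icc 1 T, P.map (u t) = uniformSphere n
  indep : iIndepFun (fun t : Finset.Icc 1 T => u t) P

/-- The adversary: each loss `F_t` is a random function, and, for `H ≤ t ≤ T`, the loss `F_t` together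
with the past `(u_1, …, u_{t-H}, F_H, …, F_{t-H})` is independent of the last `H` exploration noises
`(u_{t-H+1}, …, u_t)`. Random functions carry the σ-algebra generated by the evaluations. -/
structure IsAdversary {Ω : Type*} [MeasurableSpace Ω] (P : Measure Ω) {n H : ℕ} (T : ℕ)
    (u : ℕ → Ω → Metric.sphere (0 : E n) 1) (F : ℕ → Ω → V n H → ℝ) : Prop where
  measurable : ∀ t ∈ Finset.Icc H T, Measurable (F t)
  indep : ∀ t ∈ Finset.Icc H T,
    Indep
      (⨆ s ∈ Set.Icc (t - (H - 1)) t, MeasurableSpace.comap (u s) inferInstance)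
      (MeasurableSpace.comap (F t) inferInstance ⊔
        (⨆ s ∈ Set.Icc 1 (t - H), MeasurableSpace.comap (u s) inferInstance) ⊔
        (⨆ s ∈ Set.Icc H (t - H), MeasurableSpace.comap (F s) inferInstance)) P

/-- The expected regret
`∑_{t=H}^T 𝔼[F_t(y_{t-H+1}, …, y_t)] - min_{x ∈ K} ∑_{t=H}^T 𝔼[F_t(x, …, x)]`. -/
def expectedRegret {Ω : Type*} [MeasurableSpace Ω] (P : Measure Ω) {n H : ℕ} (T : ℕ)
    (K : Set (E n)) (R : E n → ℝ) (η σ : ℝ)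
    (u : ℕ → Ω → Metric.sphere (0 : E n) 1) (F : ℕ → Ω → V n H → ℝ) : ℝ :=
  ∑ t ∈ Finset.Icc H T, ∫ ω, suffered K R η σ u F t ω ∂P
    - ⨅ x : K, ∑ t ∈ Finset.Icc H T, ∫ ω, unary (F t ω) (x : E n) ∂P

end EBCOM

end

/-! ### Symmetry and polarization of second and third derivatives. -/

section SelfConcordance

/-! ### Third derivatives along lines -/

variable {X : Type*} [NormedAddCommGroup X] [NormedSpace ℝ X]

/-! Unbiasedness. The update is delayed by H rounds, so every iterate that enters round t is a
function of the noises and losses up to time t - H (`measurable_iterate`). Together with F_t these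
iterates are therefore independent of the H noises of the window. For fixed iterates and loss,
F_t(y) is an exact quadratic polynomial in those noises. The odd moments of the sphere vanish and
its covariance is I/n, so multiplying by n ∑ A⁻¹u isolates the linear coefficient. Hence ⟪g_t, e⟫
has the same mean as ⟪∇F_t(x-window), (e, …, e)⟫ for e = x_t - y, with no smoothing bias
(`integral_gradEst`). By the same moments, exploration costs in mean only its second-order term, at
most β ∑ ‖A_s u_s‖² ≤ β ∑ 1/(ησs). Summed over all rounds this is βH(1 + log T)/(ησ), which the
choice of η turns into the leading term.

Deterministic regret. Along one realization the estimated linear losses are handled by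
`be_the_leader` with the barrier as regularizer. The strong convexity of f_t supplies -σ/2 ‖y -
x_t‖², which cancels the quadratic terms paid by the leader. What remains is the cost of the delay
and of replacing the window of iterates by a constant tuple; both reduce to the stability of the
leaders.

Stability. `IsStableRun.step_le` shows by strong induction that consecutive leaders differ by at
most 20ηnBH in a local norm. If the earlier steps are small, self-concordance makes the Hessians at
the iterates of the window comparable with the present one, so g has dual norm O(nBH); then the
strong monotonicity of ∇R bounds the next step. The delay costs O(Tηn²B²H⁴) and the window
O(TηnBLDH³), both of order √T up to the hidden factors.

Avoiding further dependence on β and σ. Since W ⪯ βI is one-sided, gradient differences are not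
estimated by β but by L, exchanging base points and direction in the symmetric Hessian form
(`IsLoss.inner_gradient_sub_comm`). Strong convexity with 0 ≤ F ≤ B gives σ‖z - z'‖² ≤ 8B, and
comparison with W gives σ ≤ 2Hβ; the latter absorbs the lower-order terms into (βn/σ)√T.

A comparator on the boundary, where the barrier is infinite, is pulled inwards by the factor 1 -
1/T, at the price of ν log T in the barrier and LDH in the losses. If √T is at most a constant times
H, stability may fail, but then the trivial bound TB is good enough. -/

/-- The Hessian quadratic form `∇²R(x)[h, h]`. -/
noncomputable def hessForm (R : X → ℝ) (x h : X) : ℝ := fderiv ℝ (fderiv ℝ R) x h h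

theorem iteratedFDeriv_two_diag (R : X → ℝ) (x h : X) :
    iteratedFDeriv ℝ 2 R x ![h, h] = hessForm R x h := by
  simp [iteratedFDeriv_two_apply, hessForm]

theorem hessForm_smul (R : X → ℝ) (x h : X) (c : ℝ) :
    hessForm R x (c • h) = c ^ 2 * hessForm R x h := by
  simp [hessForm]; ring

theorem hessForm_neg (R : X → ℝ) (x h : X) : hessForm R x (-h) = hessForm R x h := by
  simp [hessForm]

theorem hessForm_zero (R : X → ℝ) (x : X) : hessForm R x 0 = 0 := by
  simp [hessForm]

theorem ContDiffAt.fderiv_fderiv_symm {R : X → ℝ} {x : X} (hR : ContDiffAt ℝ 3 R x) (h k : X) :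
    fderiv ℝ (fderiv ℝ R) x h k = fderiv ℝ (fderiv ℝ R) x k h :=
  (hR.of_le (by norm_num : (2 : WithTop ℕ∞) ≤ 3)).isSymmSndFDerivAt (by simp) h k

theorem ContDiffAt.differentiableAt_fderiv_fderiv {R : X → ℝ} {x : X} (hR : ContDiffAt ℝ 3 R x) :
    DifferentiableAt ℝ (fderiv ℝ (fderiv ℝ R)) x := by
  have h1 : ContDiffAt ℝ 2 (fderiv ℝ R) x := hR.fderiv_right (by norm_num)
  have h2 : ContDiffAt ℝ 1 (fderiv ℝ (fderiv ℝ R)) x := h1.fderiv_right (by norm_num)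
  exact h2.differentiableAt (by norm_num)

theorem DifferentiableAt.hasDerivAt_line {Y : Type*} [NormedAddCommGroup Y] [NormedSpace ℝ Y]
    {G : X → Y} {x e : X} {t : ℝ} (hG : DifferentiableAt ℝ G (x + t • e)) :
    HasDerivAt (fun s : ℝ => G (x + s • e)) (fderiv ℝ G (x + t • e) e) t := by
  have hl : HasDerivAt (fun s : ℝ => x + s • e) e t := by
    simpa using ((hasDerivAt_id t).smul_const e).const_add x
  exact hG.hasFDerivAt.comp_hasDerivAt t hl

theorem hasDerivAt_fderiv_fderiv_line {R : X → ℝ} {x e : X} {t : ℝ}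
    (hR : ContDiffAt ℝ 3 R (x + t • e)) (h k : X) :
    HasDerivAt (fun s : ℝ => fderiv ℝ (fderiv ℝ R) (x + s • e) h k)
      (fderiv ℝ (fderiv ℝ (fderiv ℝ R)) (x + t • e) e h k) t := by
  have h1 := DifferentiableAt.hasDerivAt_line (Y := X →L[ℝ] X →L[ℝ] ℝ)
    (G := fderiv ℝ (fderiv ℝ R)) hR.differentiableAt_fderiv_fderiv
  exact (h1.clm_apply (hasDerivAt_const t h)).clm_apply (hasDerivAt_const t k) |>.congr_deriv
    (by simp)

theorem hasDerivAt_fderiv_line {R : X → ℝ} {x e : X} {t : ℝ}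
    (hR : ContDiffAt ℝ 3 R (x + t • e)) (h : X) :
    HasDerivAt (fun s : ℝ => fderiv ℝ R (x + s • e) h)
      (fderiv ℝ (fderiv ℝ R) (x + t • e) e h) t := by
  have h0 : ContDiffAt ℝ 2 (fderiv ℝ R) (x + t • e) := hR.fderiv_right (by norm_num)
  have h1 := (h0.differentiableAt (by norm_num)).hasDerivAt_line
  exact h1.clm_apply (hasDerivAt_const t h) |>.congr_deriv (by simp)

theorem hasDerivAt_line {R : X → ℝ} {x e : X} {t : ℝ} (hR : ContDiffAt ℝ 3 R (x + t • e)) :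
    HasDerivAt (fun s : ℝ => R (x + s • e)) (fderiv ℝ R (x + t • e) e) t :=
  (hR.differentiableAt (by norm_num)).hasDerivAt_line

theorem ContDiffAt.fderiv_fderiv_fderiv_swap {R : X → ℝ} {x : X} (hR : ContDiffAt ℝ 3 R x)
    (e h k : X) : fderiv ℝ (fderiv ℝ (fderiv ℝ R)) x e h k =
      fderiv ℝ (fderiv ℝ (fderiv ℝ R)) x h e k := by
  have h0 : ContDiffAt ℝ 2 (fderiv ℝ R) x := hR.fderiv_right (by norm_num)
  rw [h0.isSymmSndFDerivAt (by simp) e h]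

/-- The symmetry of the second derivative holds in a neighbourhood of x, so it may be differentiated
along the line in direction e. -/
theorem ContDiffAt.fderiv_fderiv_fderiv_swap' {R : X → ℝ} {x : X} (hR : ContDiffAt ℝ 3 R x)
    (e h k : X) : fderiv ℝ (fderiv ℝ (fderiv ℝ R)) x e h k =
      fderiv ℝ (fderiv ℝ (fderiv ℝ R)) x e k h := by
  have hx : ContDiffAt ℝ 3 R (x + (0 : ℝ) • e) := by simpa using hR
  have h1 := hasDerivAt_fderiv_fderiv_line hx h k
  have h2 := hasDerivAt_fderiv_fderiv_line hx k h
  have hev : ∀ᶠ z in 𝓝 (x + (0 : ℝ) • e), ContDiffAt ℝ 3 R z := hx.eventually (by simp)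
  have hc : Tendsto (fun s : ℝ => x + s • e) (𝓝 0) (𝓝 (x + (0 : ℝ) • e)) :=
    (by fun_prop : Continuous fun s : ℝ => x + s • e).tendsto 0
  have h3 : (fun s : ℝ => fderiv ℝ (fderiv ℝ R) (x + s • e) h k) =ᶠ[𝓝 0]
      (fun s : ℝ => fderiv ℝ (fderiv ℝ R) (x + s • e) k h) := by
    filter_upwards [hc.eventually hev] with s hs using hs.fderiv_fderiv_symm h k
  have := (h2.congr_of_eventuallyEq h3).unique h1
  simpa using this.symm

theorem iteratedFDeriv_three_diag {R : X → ℝ} {x : X} (hR : ContDiffAt ℝ 3 R x) (h : X) :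
    iteratedFDeriv ℝ 3 R x ![h, h, h] = fderiv ℝ (fderiv ℝ (fderiv ℝ R)) x h h h := by
  have hx : ContDiffAt ℝ 3 R (x + (0 : ℝ) • h) := by simpa using hR
  have h1 := hasDerivAt_fderiv_fderiv_line hx h h
  have hl : HasDerivAt (fun s : ℝ => x + s • h) h 0 := by
    simpa using ((hasDerivAt_id (0 : ℝ)).smul_const h).const_add x
  have hd : DifferentiableAt ℝ (iteratedFDeriv ℝ 2 R) (x + (0 : ℝ) • h) :=
    hx.differentiableAt_iteratedFDeriv (by norm_num)
  have h2 := hd.hasFDerivAt.comp_hasDerivAt (0 : ℝ) hl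
  have h3 := (ContinuousMultilinearMap.apply ℝ (fun _ : Fin 2 => X) ℝ
    ![h, h]).hasFDerivAt.comp_hasDerivAt (0 : ℝ) h2
  have h4 : (fun s : ℝ => fderiv ℝ (fderiv ℝ R) (x + s • h) h h) =
      (ContinuousMultilinearMap.apply ℝ (fun _ : Fin 2 => X) ℝ ![h, h]) ∘
        (iteratedFDeriv ℝ 2 R ∘ fun s : ℝ => x + s • h) := by
    ext s; simp [iteratedFDeriv_two_apply]
  rw [h4] at h1
  have h5 := h3.unique h1
  rw [iteratedFDeriv_succ_apply_left]
  simpa [Fin.tail_def] using h5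

theorem hessForm_add_add_sub (R : X → ℝ) (x h k : X) :
    hessForm R x (h + k) + hessForm R x (h - k) = 2 * hessForm R x h + 2 * hessForm R x k := by
  simp [hessForm]; ring

/-- A trilinear form bounded by twice the cube of a Hilbertian norm on the diagonal is bounded by
`10 / 3` on pairs of vectors. -/
theorem abs_fderiv_fderiv_fderiv_le {R : X → ℝ} {x : X} (hR : ContDiffAt ℝ 3 R x)
    (hpos : ∀ h, h ≠ 0 → 0 < hessForm R x h)
    (hsc : ∀ h, |fderiv ℝ (fderiv ℝ (fderiv ℝ R)) x h h h| ≤ 2 * √(hessForm R x h) ^ 3)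
    (e h : X) : |fderiv ℝ (fderiv ℝ (fderiv ℝ R)) x e h h| ≤
      10 / 3 * (hessForm R x h * √(hessForm R x e)) := by
  by_cases he : e = 0
  · simp [he, hessForm]
  by_cases hh : h = 0
  · simp [hh, hessForm]
  set T := fderiv ℝ (fderiv ℝ (fderiv ℝ R)) x with hT
  have key : ∀ e h : X, hessForm R x e = 1 → hessForm R x h = 1 → |T e h h| ≤ 10 / 3 := by
    intro e h he hh
    have e1 : T (h + e) (h + e) (h + e) - T (h - e) (h - e) (h - e) =
        6 * T e h h + 2 * T e e e := by
      have a1 : T h e h = T e h h := hR.fderiv_fderiv_fderiv_swap h e h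
      have a2 : T h h e = T h e h := hR.fderiv_fderiv_fderiv_swap' h h e
      simp only [map_add, map_sub, add_apply, sub_apply]
      rw [a2, a1]; ring
    have b1 := hsc (h + e)
    have b2 := hsc (h - e)
    have b3 := hsc e
    rw [he] at b3
    have b4 := hessForm_add_add_sub R x h e
    rw [he, hh] at b4
    have nn : ∀ z, 0 ≤ hessForm R x z := fun z => by
      by_cases hz : z = 0
      · simp [hz, hessForm]
      · exact (hpos z hz).le
    have s1 := Real.sq_sqrt (nn (h + e))
    have s2 := Real.sq_sqrt (nn (h - e))
    set p := √(hessForm R x (h + e))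
    set q := √(hessForm R x (h - e))
    have hp : 0 ≤ p := Real.sqrt_nonneg _
    have hq : 0 ≤ q := Real.sqrt_nonneg _
    have hp2 : p ≤ 2 := by nlinarith
    have hq2 : q ≤ 2 := by nlinarith
    have d1 : 0 ≤ p ^ 2 * (2 - p) := mul_nonneg (sq_nonneg p) (sub_nonneg.2 hp2)
    have d2 : 0 ≤ q ^ 2 * (2 - q) := mul_nonneg (sq_nonneg q) (sub_nonneg.2 hq2)
    -- The parallelogram law gives p² + q² = 4 with p, q ≤ 2, hence p³ + q³ ≤ 2 · 4. Then 6 |T e h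
    -- h| ≤ 2 · 8 + 2 · 2 = 20, the source of 10/3.
    have c1 : p ^ 3 + q ^ 3 ≤ 8 := by nlinarith
    simp only [Real.sqrt_one, one_pow, mul_one] at b3
    obtain ⟨b1l, b1u⟩ := abs_le.1 b1
    obtain ⟨b2l, b2u⟩ := abs_le.1 b2
    obtain ⟨b3l, b3u⟩ := abs_le.1 b3
    rw [abs_le]
    constructor <;> linarith
  have pe := hpos e he
  have ph := hpos h hh
  set a := √(hessForm R x e)
  set b := √(hessForm R x h)
  have ha : 0 < a := Real.sqrt_pos.2 pe
  have hb : 0 < b := Real.sqrt_pos.2 ph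
  have ha2 : a ^ 2 = hessForm R x e := Real.sq_sqrt pe.le
  have hb2 : b ^ 2 = hessForm R x h := Real.sq_sqrt ph.le
  have k1 := key (a⁻¹ • e) (b⁻¹ • h) (by rw [hessForm_smul, ← ha2]; field_simp)
    (by rw [hessForm_smul, ← hb2]; field_simp)
  simp only [map_smul, smul_apply, smul_eq_mul] at k1
  have k2 : T e h h = (a * b ^ 2) * (b⁻¹ * (b⁻¹ * (a⁻¹ * T e h h))) := by field_simp
  have k3 : b⁻¹ * (b⁻¹ * (a⁻¹ * T e h h)) = a⁻¹ * (b⁻¹ * (b⁻¹ * T e h h)) := by ring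
  rw [k2, abs_mul, abs_of_pos (by positivity), ← hb2]
  have k1' : |b⁻¹ * (b⁻¹ * (a⁻¹ * T e h h))| ≤ 10 / 3 := by
    exact le_trans (le_of_eq (by congr 1)) k1
  nlinarith [mul_le_mul_of_nonneg_left k1' (by positivity : 0 ≤ a * b ^ 2)]

end SelfConcordance

/-! ### Scalar differential inequalities. -/

theorem sub_le_sub_of_hasDerivAt_le {f g f' g' : ℝ → ℝ} {a b : ℝ} (hab : a ≤ b)
    (hf : ∀ s ∈ Set.Icc a b, HasDerivAt f (f' s) s) (hg : ∀ s ∈ Set.Icc a b, HasDerivAt g (g' s) s)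
    (h : ∀ s ∈ Set.Icc a b, f' s ≤ g' s) : f b - f a ≤ g b - g a := by
  have hd : ∀ s ∈ Set.Icc a b, HasDerivAt (fun s => g s - f s) (g' s - f' s) s :=
    fun s hs => (hg s hs).sub (hf s hs)
  have hm : MonotoneOn (fun s => g s - f s) (Set.Icc a b) := by
    refine monotoneOn_of_deriv_nonneg (convex_Icc a b)
      (fun s hs => (hd s hs).continuousAt.continuousWithinAt)
      (fun s hs => (hd s (interior_subset hs)).differentiableAt.differentiableWithinAt) ?_
    intro s hs
    rw [(hd s (interior_subset hs)).deriv]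
    linarith [h s (interior_subset hs)]
  have := hm (Set.left_mem_Icc.2 hab) (Set.right_mem_Icc.2 hab) hab
  simp only at this
  linarith

/-- A differential inequality `ψ' ≤ 2 |ψ| ^ (3 / 2)` preserves nonpositivity. -/
theorem nonpos_of_deriv_le {f f' : ℝ → ℝ} {b : ℝ}
    (hf : ∀ s ∈ Set.Icc 0 b, HasDerivAt f (f' s) s)
    (h : ∀ s ∈ Set.Icc 0 b, f' s ≤ 2 * √|f s| ^ 3) (h0 : f 0 ≤ 0) (hb : 0 ≤ b) : f b ≤ 0 := by
  have hc : ContinuousOn f (Set.Icc 0 b) := fun s hs => (hf s hs).continuousAt.continuousWithinAt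
  obtain ⟨M, hM⟩ := isCompact_Icc.exists_bound_of_continuousOn hc
  -- Since |f| ≤ M, wherever f > 0 the hypothesis gives f' ≤ 2f√M = cf. So f cannot cross the curve
  -- ε exp((c + 1)t), whose relative growth rate is larger; then ε tends to 0.
  set c := 2 * √M with hcdef
  have hc0 : 0 ≤ c := by positivity
  have key : ∀ ε > 0, f b ≤ ε * Real.exp ((c + 1) * b) := by
    intro ε hε
    refine image_le_of_deriv_right_lt_deriv_boundary (f' := f')
      (B := fun t => ε * Real.exp ((c + 1) * t))
      (B' := fun t => ε * (Real.exp ((c + 1) * t) * (c + 1))) hc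
      (fun x hx => (hf x (Set.Ico_subset_Icc_self hx)).hasDerivWithinAt) ?_ ?_ ?_
      (Set.right_mem_Icc.2 hb)
    · simp; linarith
    · intro x
      exact (((hasDerivAt_id x).const_mul (c + 1)).exp.const_mul ε).congr_deriv (by simp)
    · intro x hx hfx
      have hx' := Set.Ico_subset_Icc_self hx
      have hpos : 0 < f x := by rw [hfx]; positivity
      have h1 := h x hx'
      have h2 : f x ≤ M := by simpa [abs_of_pos hpos] using hM x hx'
      rw [abs_of_pos hpos] at h1
      have h3 : √(f x) ^ 3 = f x * √(f x) := by
        rw [pow_succ, Real.sq_sqrt hpos.le]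
      have h4 : √(f x) ≤ √M := Real.sqrt_le_sqrt h2
      have h5 : f x * √(f x) ≤ f x * √M := by gcongr
      have : ε * (Real.exp ((c + 1) * x) * (c + 1)) = f x * (c + 1) := by rw [hfx]; ring
      rw [this, hcdef]
      rw [h3] at h1
      nlinarith
  refine le_of_forall_pos_le_add fun δ hδ => ?_
  have := key (δ / Real.exp ((c + 1) * b)) (by positivity)
  rw [div_mul_cancel₀ _ (Real.exp_ne_zero _)] at this
  linarith

/-- The derivative of f^(-1/2) is -f' / (2 f^(3/2)), of absolute value at most 1. Applied to the
Hessian form along a line, this is the integrated form of self-concordance. -/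
theorem abs_inv_sqrt_sub_le {f f' : ℝ → ℝ} {b : ℝ} (hb : 0 ≤ b)
    (hf : ∀ s ∈ Set.Icc 0 b, HasDerivAt f (f' s) s) (hpos : ∀ s ∈ Set.Icc 0 b, 0 < f s)
    (h : ∀ s ∈ Set.Icc 0 b, |f' s| ≤ 2 * √(f s) ^ 3) : |(√(f b))⁻¹ - (√(f 0))⁻¹| ≤ b := by
  have hd : ∀ s ∈ Set.Icc 0 b,
      HasDerivAt (fun s => (√(f s))⁻¹) (-(f' s / (2 * √(f s))) / √(f s) ^ 2) s := fun s hs =>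
    ((hf s hs).sqrt (hpos s hs).ne').fun_inv (Real.sqrt_pos.2 (hpos s hs)).ne'
  have := Convex.norm_image_sub_le_of_norm_hasDerivWithin_le (C := 1)
    (fun s hs => (hd s hs).hasDerivWithinAt) ?_ (convex_Icc 0 b) (Set.left_mem_Icc.2 hb)
    (Set.right_mem_Icc.2 hb)
  · simpa [abs_of_nonneg hb] using this
  · intro s hs
    have p := Real.sqrt_pos.2 (hpos s hs)
    have h1 := h s hs
    rw [Real.norm_eq_abs, abs_div, abs_neg, abs_div, abs_of_pos (by positivity : 0 < 2 * √(f s)),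
      abs_of_pos (by positivity : 0 < √(f s) ^ 2), div_div, div_le_one (by positivity)]
    nlinarith

namespace EBCOM

/-! ### Local norms and the Dikin ellipsoid. -/

section Barrier

variable {n : ℕ} {K : Set (E n)} {R : E n → ℝ} {ν D : ℝ}

theorem IsSelfConcordantBarrier.contDiffAt (hR : IsSelfConcordantBarrier K R ν) {x : E n}
    (hx : x ∈ interior K) : ContDiffAt ℝ 3 R x :=
  hR.contDiffOn.contDiffAt (isOpen_interior.mem_nhds hx)

theorem IsSelfConcordantBarrier.abs_third_le (hR : IsSelfConcordantBarrier K R ν) {x : E n}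
    (hx : x ∈ interior K) (h : E n) :
    |fderiv ℝ (fderiv ℝ (fderiv ℝ R)) x h h h| ≤ 2 * √|hessForm R x h| ^ 3 := by
  have := hR.self_concordant x hx h
  rw [iteratedFDeriv_three_diag (hR.contDiffAt hx), iteratedFDeriv_two_diag] at this
  refine this.trans (le_of_eq ?_)
  rw [Real.sqrt_eq_rpow, ← Real.rpow_natCast, ← Real.rpow_mul (abs_nonneg _)]
  norm_num

theorem IsSelfConcordantBarrier.abs_fderiv_le (hR : IsSelfConcordantBarrier K R ν) {x : E n}
    (hx : x ∈ interior K) (h : E n) : |fderiv ℝ R x h| ≤ √ν * √|hessForm R x h| := by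
  have := hR.barrier x hx h
  rwa [iteratedFDeriv_two_diag, ← Real.sqrt_eq_rpow] at this

/-- The barrier is unbounded on the part inside `K` of a segment that leaves the interior. -/
theorem exists_lt_of_add_notMem (hK : IsConstraintSet K D) (hR : IsSelfConcordantBarrier K R ν)
    {x h : E n} (hx : x ∈ interior K) (hy : x + h ∉ interior K) (C : ℝ) :
    ∃ t ∈ Set.Icc (0 : ℝ) 1, (∀ s ∈ Set.Icc 0 t, x + s • h ∈ interior K) ∧ C < R (x + t • h) := by
  have hcont : Continuous fun s : ℝ => x + s • h := by fun_prop
  set S := {s : ℝ | s ∈ Set.Icc 0 1 ∧ x + s • h ∉ interior K} with hS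
  have hScl : IsClosed S :=
    isClosed_Icc.inter (isOpen_interior.isClosed_compl.preimage hcont)
  have hSne : S.Nonempty := ⟨1, by simp, by simpa using hy⟩
  have hSb : BddBelow S := ⟨0, fun s hs => hs.1.1⟩
  have hT := hScl.csInf_mem hSne hSb
  -- The first exit time. The exit point is a limit of interior points, hence lies in K and so on
  -- its frontier, where R blows up.
  set T := sInf S
  have hlt : ∀ s, 0 ≤ s → s < T → x + s • h ∈ interior K := by
    intro s hs hsT
    by_contra hc
    exact absurd (csInf_le hSb ⟨⟨hs, hsT.le.trans hT.1.2⟩, hc⟩) (not_le.2 hsT)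
  have hT0 : 0 < T := by
    refine lt_of_le_of_ne hT.1.1 fun h0 => hT.2 ?_
    rw [← h0]; simpa using hx
  have hev : ∀ᶠ s in 𝓝[<] T, x + s • h ∈ interior K := by
    filter_upwards [Ioo_mem_nhdsLT hT0] with s hs using hlt s hs.1.le hs.2
  have htend : Tendsto (fun s : ℝ => x + s • h) (𝓝[<] T) (𝓝 (x + T • h)) :=
    (hcont.tendsto T).mono_left nhdsWithin_le_nhds
  have hfr : x + T • h ∈ frontier K := by
    rw [hK.isClosed.frontier_eq]
    exact ⟨hK.isClosed.mem_of_tendsto htend (hev.mono fun s hs => interior_subset hs), hT.2⟩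
  have h1 := (hR.boundary _ hfr).comp (tendsto_nhdsWithin_iff.2 ⟨htend, hev⟩)
  obtain ⟨t, ht1, ht2⟩ := ((h1.eventually_gt_atTop C).and (Ioo_mem_nhdsLT hT0)).exists
  exact ⟨t, ⟨ht2.1.le, ht2.2.le.trans hT.1.2⟩,
    fun s hs => hlt s hs.1 (hs.2.trans_lt ht2.2), ht1⟩

theorem IsConstraintSet.exists_smul_notMem (hK : IsConstraintSet K D) (x : E n) {h : E n}
    (hh : h ≠ 0) : ∃ c : ℝ, 0 < c ∧ x + c • h ∉ K := by
  have hp : 0 < ‖h‖ := norm_pos_iff.2 hh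
  obtain ⟨r, hr⟩ := hK.isBounded.exists_norm_le
  refine ⟨(|r| + ‖x‖ + 1) / ‖h‖, by positivity, fun hc => ?_⟩
  have h1 := hr _ hc
  have h2 : ‖((|r| + ‖x‖ + 1) / ‖h‖) • h‖ = |r| + ‖x‖ + 1 := by
    rw [norm_smul, Real.norm_of_nonneg (by positivity)]; field_simp
  have h3 := norm_sub_le (x + ((|r| + ‖x‖ + 1) / ‖h‖) • h) x
  rw [add_sub_cancel_left, h2] at h3
  linarith [le_abs_self r]

theorem IsSelfConcordantBarrier.hessForm_nonpos_line (hR : IsSelfConcordantBarrier K R ν)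
    {x h : E n} {t : ℝ} (ht : 0 ≤ t) (hseg : ∀ s ∈ Set.Icc 0 t, x + s • h ∈ interior K)
    (h0 : hessForm R x h ≤ 0) : hessForm R (x + t • h) h ≤ 0 :=
  nonpos_of_deriv_le (f := fun s => hessForm R (x + s • h) h)
    (fun s hs => hasDerivAt_fderiv_fderiv_line (hR.contDiffAt (hseg s hs)) h h)
    (fun s hs => (le_abs_self _).trans (hR.abs_third_le (hseg s hs) h)) (by simpa using h0) ht

/-- Convexity of R is not assumed; it follows from the boundary behaviour. If the Hessian form in
direction h were nonpositive at x, self-concordance would keep it so along the ray, and R would stay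
below its tangent there. But K is bounded, so the ray leaves the interior and R must be unbounded
above on it. -/
theorem hessForm_pos (hK : IsConstraintSet K D) (hR : IsSelfConcordantBarrier K R ν) {x : E n}
    (hx : x ∈ interior K) {h : E n} (hh : h ≠ 0) : 0 < hessForm R x h := by
  by_contra hneg
  obtain ⟨c, hc, hcK⟩ := hK.exists_smul_notMem x hh
  set e := c • h
  have he : hessForm R x e ≤ 0 := by
    rw [hessForm_smul]; nlinarith [sq_nonneg c]
  obtain ⟨t, ht, hseg, hlt⟩ := exists_lt_of_add_notMem hK hR hx
    (fun hc => hcK (interior_subset hc)) (R x + |fderiv ℝ R x e|)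
  have hcd := fun s hs => hR.contDiffAt (hseg s hs)
  have h1 : ∀ s ∈ Set.Icc 0 t, fderiv ℝ R (x + s • e) e ≤ fderiv ℝ R x e := by
    intro s hs
    have hsub : Set.Icc 0 s ⊆ Set.Icc 0 t := Set.Icc_subset_Icc_right hs.2
    have := sub_le_sub_of_hasDerivAt_le (g := fun _ => 0) (g' := fun _ => 0) hs.1
      (fun r hr => hasDerivAt_fderiv_line (hcd r (hsub hr)) e)
      (fun r _ => hasDerivAt_const r (0 : ℝ))
      (fun r hr => hR.hessForm_nonpos_line hr.1
        (fun q hq => hseg q ⟨hq.1, hq.2.trans (hsub hr).2⟩) he)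
    simpa using this
  have h2 := sub_le_sub_of_hasDerivAt_le (g := fun s => fderiv ℝ R x e * s)
    (g' := fun _ => fderiv ℝ R x e) ht.1 (fun s hs => hasDerivAt_line (hcd s hs))
    (fun s _ => by simpa using (hasDerivAt_id s).const_mul (fderiv ℝ R x e)) h1
  simp only [zero_smul, add_zero, mul_zero, sub_zero] at h2
  have h3 : fderiv ℝ R x e * t ≤ |fderiv ℝ R x e| := by
    have := le_abs_self (fderiv ℝ R x e)
    have := abs_nonneg (fderiv ℝ R x e)
    nlinarith [ht.1, ht.2]
  linarith

theorem hessForm_nonneg (hK : IsConstraintSet K D) (hR : IsSelfConcordantBarrier K R ν) {x : E n}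
    (hx : x ∈ interior K) (h : E n) : 0 ≤ hessForm R x h := by
  by_cases hh : h = 0
  · simp [hh, hessForm_zero]
  · exact (hessForm_pos hK hR hx hh).le

/-- The local norm at `x`. -/
noncomputable def localNorm (R : E n → ℝ) (x h : E n) : ℝ := √(hessForm R x h)

theorem localNorm_nonneg (R : E n → ℝ) (x h : E n) : 0 ≤ localNorm R x h := Real.sqrt_nonneg _

theorem localNorm_sq (hK : IsConstraintSet K D) (hR : IsSelfConcordantBarrier K R ν) {x : E n}
    (hx : x ∈ interior K) (h : E n) : localNorm R x h ^ 2 = hessForm R x h :=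
  Real.sq_sqrt (hessForm_nonneg hK hR hx h)

theorem localNorm_pos (hK : IsConstraintSet K D) (hR : IsSelfConcordantBarrier K R ν) {x : E n}
    (hx : x ∈ interior K) {h : E n} (hh : h ≠ 0) : 0 < localNorm R x h :=
  Real.sqrt_pos.2 (hessForm_pos hK hR hx hh)

theorem abs_third_le (hK : IsConstraintSet K D) (hR : IsSelfConcordantBarrier K R ν) {x : E n}
    (hx : x ∈ interior K) (h : E n) :
    |fderiv ℝ (fderiv ℝ (fderiv ℝ R)) x h h h| ≤ 2 * √(hessForm R x h) ^ 3 := by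
  have := hR.abs_third_le hx h
  rwa [abs_of_nonneg (hessForm_nonneg hK hR hx h)] at this

theorem abs_inv_localNorm_sub_le (hK : IsConstraintSet K D) (hR : IsSelfConcordantBarrier K R ν)
    {x h : E n} (hh : h ≠ 0) {t : ℝ} (ht : 0 ≤ t)
    (hseg : ∀ s ∈ Set.Icc 0 t, x + s • h ∈ interior K) :
    |(localNorm R (x + t • h) h)⁻¹ - (localNorm R x h)⁻¹| ≤ t := by
  have := abs_inv_sqrt_sub_le (f := fun s => hessForm R (x + s • h) h) ht
    (fun s hs => hasDerivAt_fderiv_fderiv_line (hR.contDiffAt (hseg s hs)) h h)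
    (fun s hs => hessForm_pos hK hR (hseg s hs) hh)
    (fun s hs => abs_third_le hK hR (hseg s hs) h)
  simpa [localNorm] using this

theorem le_localNorm_line (hK : IsConstraintSet K D) (hR : IsSelfConcordantBarrier K R ν)
    {x h : E n} {t : ℝ} (ht : 0 ≤ t) (hseg : ∀ s ∈ Set.Icc 0 t, x + s • h ∈ interior K) :
    localNorm R x h / (1 + t * localNorm R x h) ≤ localNorm R (x + t • h) h := by
  by_cases hh : h = 0
  · simp [hh, localNorm, hessForm_zero]
  have h1 := (abs_le.1 (abs_inv_localNorm_sub_le hK hR hh ht hseg)).2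
  have hx : x ∈ interior K := by simpa using hseg 0 ⟨le_rfl, ht⟩
  have p0 := localNorm_pos hK hR hx hh
  have p1 := localNorm_pos hK hR (hseg t ⟨ht, le_rfl⟩) hh
  set a := localNorm R x h
  set b := localNorm R (x + t • h) h
  rw [div_le_iff₀ (by positivity)]
  have h2 : b⁻¹ ≤ a⁻¹ + t := by linarith
  have h3 : a * b * b⁻¹ ≤ a * b * (a⁻¹ + t) := by gcongr
  have h4 : a * b * b⁻¹ = a := by field_simp
  have h5 : a * b * (a⁻¹ + t) = b * (1 + t * a) := by field_simp
  rwa [h4, h5] at h3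

theorem localNorm_line_le (hK : IsConstraintSet K D) (hR : IsSelfConcordantBarrier K R ν)
    {x h : E n} {t : ℝ} (ht : 0 ≤ t) (hseg : ∀ s ∈ Set.Icc 0 t, x + s • h ∈ interior K)
    (htr : t * localNorm R x h < 1) :
    localNorm R (x + t • h) h ≤ localNorm R x h / (1 - t * localNorm R x h) := by
  by_cases hh : h = 0
  · simp [hh, localNorm, hessForm_zero]
  have h1 := (abs_le.1 (abs_inv_localNorm_sub_le hK hR hh ht hseg)).1
  have hx : x ∈ interior K := by simpa using hseg 0 ⟨le_rfl, ht⟩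
  have p0 := localNorm_pos hK hR hx hh
  have p1 := localNorm_pos hK hR (hseg t ⟨ht, le_rfl⟩) hh
  set a := localNorm R x h
  set b := localNorm R (x + t • h) h
  rw [le_div_iff₀ (by linarith)]
  have h2 : a⁻¹ - t ≤ b⁻¹ := by linarith
  have h3 : a * b * (a⁻¹ - t) ≤ a * b * b⁻¹ := by gcongr
  have h4 : a * b * b⁻¹ = a := by field_simp
  have h5 : a * b * (a⁻¹ - t) = b * (1 - t * a) := by field_simp
  rwa [h4, h5] at h3

/-- The open Dikin ellipsoid lies in the interior of `K`. -/
theorem add_mem_interior_of_localNorm_lt_one (hK : IsConstraintSet K D)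
    (hR : IsSelfConcordantBarrier K R ν) {x h : E n} (hx : x ∈ interior K)
    (hh : localNorm R x h < 1) : x + h ∈ interior K := by
  by_contra hy
  set r := localNorm R x h
  have hr0 : 0 ≤ r := localNorm_nonneg R x h
  -- An upper bound of the second derivative of R along the whole segment; integrating it twice
  -- bounds R, contrary to the blow-up at the exit point.
  set M := (r / (1 - r)) ^ 2
  have hM : 0 ≤ M := sq_nonneg _
  obtain ⟨t, ht, hseg, hlt⟩ := exists_lt_of_add_notMem hK hR hx hy
    (R x + (|fderiv ℝ R x h| + M))
  have hcd := fun s hs => hR.contDiffAt (hseg s hs)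
  have h0 : ∀ s ∈ Set.Icc 0 t, hessForm R (x + s • h) h ≤ M := by
    intro s hs
    have hs1 : s ≤ 1 := hs.2.trans ht.2
    have hsr : s * r ≤ r := mul_le_of_le_one_left hr0 hs1
    have h1 := localNorm_line_le hK hR hs.1 (fun q hq => hseg q ⟨hq.1, hq.2.trans hs.2⟩)
      (hsr.trans_lt hh)
    rw [← localNorm_sq hK hR (hseg s hs)]
    refine pow_le_pow_left₀ (localNorm_nonneg _ _ _) (h1.trans ?_) 2
    exact div_le_div_of_nonneg_left hr0 (by linarith) (by linarith)
  have h1 : ∀ s ∈ Set.Icc 0 t, fderiv ℝ R (x + s • h) h ≤ |fderiv ℝ R x h| + M := by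
    intro s hs
    have hsub : Set.Icc 0 s ⊆ Set.Icc 0 t := Set.Icc_subset_Icc_right hs.2
    have := sub_le_sub_of_hasDerivAt_le (g := fun s => M * s) (g' := fun _ => M) hs.1
      (fun r hr => hasDerivAt_fderiv_line (hcd r (hsub hr)) h)
      (fun r _ => by simpa using (hasDerivAt_id r).const_mul M)
      (fun r hr => h0 r (hsub hr))
    simp only [zero_smul, add_zero, mul_zero, sub_zero] at this
    have hs1 : s ≤ 1 := hs.2.trans ht.2
    nlinarith [le_abs_self (fderiv ℝ R x h)]
  have h2 := sub_le_sub_of_hasDerivAt_le (g := fun s => (|fderiv ℝ R x h| + M) * s)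
    (g' := fun _ => |fderiv ℝ R x h| + M) ht.1 (fun s hs => hasDerivAt_line (hcd s hs))
    (fun s _ => by simpa using (hasDerivAt_id s).const_mul (|fderiv ℝ R x h| + M)) h1
  simp only [zero_smul, add_zero, mul_zero, sub_zero] at h2
  have : 0 ≤ |fderiv ℝ R x h| + M := by positivity
  nlinarith [ht.1, ht.2]

/-- The open Dikin ellipsoid lies in K, so none of its radii is longer than D. -/
theorem norm_le_mul_localNorm (hK : IsConstraintSet K D) (hR : IsSelfConcordantBarrier K R ν)
    {x : E n} (hx : x ∈ interior K) (h : E n) : ‖h‖ ≤ D * localNorm R x h := by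
  by_cases hh : h = 0
  · simp [hh, localNorm, hessForm_zero]
  have p := localNorm_pos hK hR hx hh
  have key : ∀ a : ℝ, 0 < a → a < 1 → a * ‖h‖ ≤ D * localNorm R x h := by
    intro a ha0 ha
    set b := a / localNorm R x h
    have hb : 0 < b := by positivity
    have h1 : localNorm R x (b • h) < 1 := by
      rw [localNorm, hessForm_smul, Real.sqrt_mul (sq_nonneg b), Real.sqrt_sq hb.le]
      change b * localNorm R x h < 1
      rwa [div_mul_cancel₀ _ p.ne']
    have h2 := hK.diam_le _ (interior_subset (add_mem_interior_of_localNorm_lt_one hK hR hx h1)) x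
      (interior_subset hx)
    rw [add_sub_cancel_left, norm_smul, Real.norm_of_nonneg hb.le] at h2
    have h3 : a * ‖h‖ = localNorm R x h * (b * ‖h‖) := by
      simp only [b]; field_simp
    rw [h3, mul_comm D]
    gcongr
  by_contra hlt
  push Not at hlt
  have hD := hK.diam_le x (interior_subset hx) x (interior_subset hx)
  simp only [sub_self, norm_zero] at hD
  have hq : 0 ≤ D * localNorm R x h := mul_nonneg hD p.le
  have hp : 0 < ‖h‖ := norm_pos_iff.2 hh
  -- A scale strictly between 1 and the ratio D‖h‖_x / ‖h‖, which is below 1 by assumption.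
  have := key ((D * localNorm R x h / ‖h‖ + 1) / 2) (by positivity)
    (by have := (div_lt_one hp).2 hlt; linarith)
  have e1 : (D * localNorm R x h / ‖h‖ + 1) / 2 * ‖h‖ = (D * localNorm R x h + ‖h‖) / 2 := by
    field_simp
  linarith

end Barrier

end EBCOM

namespace EBCOM

/-! ### Comparing Hessians, growth of the barrier, and regularized minimizers. -/

section BarrierGlobal

variable {n : ℕ} {K : Set (E n)} {R : E n → ℝ} {ν D : ℝ}

theorem IsConstraintSet.segment_mem_interior (hK : IsConstraintSet K D) {x y : E n}
    (hx : x ∈ interior K) (hy : y ∈ interior K) :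
    ∀ s ∈ Set.Icc (0 : ℝ) 1, x + s • (y - x) ∈ interior K :=
  fun _ hs => hK.convex.interior.add_smul_sub_mem hx hy hs

/-- The logarithm of the Hessian form has derivative at most 10/3 times the local norm of y - x at
the moving point. Up to radius 1/2 that norm is at most doubled, and 20/3 ≤ 8. -/
theorem hessForm_le_exp_mul (hK : IsConstraintSet K D) (hR : IsSelfConcordantBarrier K R ν)
    {x y : E n} (hx : x ∈ interior K) (hy : y ∈ interior K)
    (hr : localNorm R x (y - x) ≤ 1 / 2) (h : E n) :
    hessForm R y h ≤ Real.exp (8 * localNorm R x (y - x)) * hessForm R x h ∧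
      hessForm R x h ≤ Real.exp (8 * localNorm R x (y - x)) * hessForm R y h := by
  by_cases hh : h = 0
  · simp [hh, hessForm_zero]
  set e := y - x
  set r := localNorm R x e
  have hr0 : 0 ≤ r := localNorm_nonneg _ _ _
  have hseg := hK.segment_mem_interior hx hy
  have hd : ∀ s ∈ Set.Icc (0 : ℝ) 1, HasDerivAt (fun s : ℝ => Real.log (hessForm R (x + s • e) h))
      (fderiv ℝ (fderiv ℝ (fderiv ℝ R)) (x + s • e) e h h / hessForm R (x + s • e) h) s :=
    fun s hs => (hasDerivAt_fderiv_fderiv_line (hR.contDiffAt (hseg s hs)) h h).log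
      (hessForm_pos hK hR (hseg s hs) hh).ne'
  have hb : ∀ s ∈ Set.Icc (0 : ℝ) 1,
      ‖fderiv ℝ (fderiv ℝ (fderiv ℝ R)) (x + s • e) e h h / hessForm R (x + s • e) h‖ ≤ 8 * r := by
    intro s hs
    have p := hessForm_pos hK hR (hseg s hs) hh
    have h1 := abs_fderiv_fderiv_fderiv_le (hR.contDiffAt (hseg s hs))
      (fun h hh => hessForm_pos hK hR (hseg s hs) hh) (abs_third_le hK hR (hseg s hs)) e h
    have hsr : s * r ≤ 1 / 2 := (mul_le_of_le_one_left hr0 hs.2).trans hr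
    have h2 := localNorm_line_le hK hR hs.1 (fun q hq => hseg q ⟨hq.1, hq.2.trans hs.2⟩)
      (show s * localNorm R x e < 1 by linarith)
    have h3 : r / (1 - s * r) ≤ 2 * r := by
      rw [div_le_iff₀ (by linarith)]; nlinarith
    have h4 : localNorm R (x + s • e) e ≤ 2 * r := h2.trans h3
    rw [Real.norm_eq_abs, abs_div, abs_of_pos p, div_le_iff₀ p]
    refine h1.trans ?_
    change 10 / 3 * (hessForm R (x + s • e) h * localNorm R (x + s • e) e) ≤ _
    nlinarith [mul_le_mul_of_nonneg_left h4 p.le, mul_nonneg hr0 p.le]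
  have := Convex.norm_image_sub_le_of_norm_hasDerivWithin_le
    (fun s hs => (hd s hs).hasDerivWithinAt) hb (convex_Icc 0 1)
    (Set.left_mem_Icc.2 zero_le_one) (Set.right_mem_Icc.2 zero_le_one)
  have e1 : x + (1 : ℝ) • e = y := by simp [e]
  rw [e1, zero_smul, add_zero, sub_zero, norm_one, mul_one, Real.norm_eq_abs, abs_le] at this
  have p0 := hessForm_pos hK hR hx hh
  have p1 := hessForm_pos hK hR hy hh
  constructor
  · rw [← Real.log_le_log_iff p1 (by positivity), Real.log_mul (Real.exp_ne_zero _) p0.ne',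
      Real.log_exp]
    linarith [this.2]
  · rw [← Real.log_le_log_iff p0 (by positivity), Real.log_mul (Real.exp_ne_zero _) p1.ne',
      Real.log_exp]
    linarith [this.1]

/-- With r the local norm of e = y - x at x, the second derivative along the segment is at least
r²/(1 + sr)², which has primitive -r/(1 + sr). -/
theorem div_one_add_le_fderiv_sub (hK : IsConstraintSet K D) (hR : IsSelfConcordantBarrier K R ν)
    {x y : E n} (hx : x ∈ interior K) (hy : y ∈ interior K) :
    hessForm R x (y - x) / (1 + localNorm R x (y - x)) ≤
      fderiv ℝ R y (y - x) - fderiv ℝ R x (y - x) := by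
  set e := y - x
  rw [← localNorm_sq hK hR hx]
  set r := localNorm R x e
  have hr0 : 0 ≤ r := localNorm_nonneg _ _ _
  have hseg := hK.segment_mem_interior hx hy
  have hpos : ∀ s ∈ Set.Icc (0 : ℝ) 1, 0 < 1 + s * r := fun s hs => by
    have := mul_nonneg hs.1 hr0; linarith
  have := sub_le_sub_of_hasDerivAt_le (f := fun s => -r * (1 + s * r)⁻¹)
    (f' := fun s => -r * (-r / (1 + s * r) ^ 2))
    (g := fun s => fderiv ℝ R (x + s • e) e) (zero_le_one' ℝ)
    (fun s hs => by
      have h1 : HasDerivAt (fun s : ℝ => 1 + s * r) r s := by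
        simpa using ((hasDerivAt_id s).mul_const r).const_add 1
      exact (h1.fun_inv (hpos s hs).ne').const_mul (-r))
    (fun s hs => hasDerivAt_fderiv_line (hR.contDiffAt (hseg s hs)) e)
    (fun s hs => by
      have h1 := le_localNorm_line hK hR hs.1 (fun q hq => hseg q ⟨hq.1, hq.2.trans hs.2⟩)
      have h2 := pow_le_pow_left₀ (div_nonneg hr0 (hpos s hs).le) h1 2
      rw [localNorm_sq hK hR (hseg s hs)] at h2
      refine le_trans (le_of_eq ?_) h2
      rw [div_pow]; ring)
  have e1 : x + (1 : ℝ) • e = y := by simp [e]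
  simp only [e1, zero_smul, add_zero, zero_mul, one_mul, inv_one, mul_one] at this
  refine le_trans (le_of_eq ?_) this
  field_simp
  ring

theorem fderiv_sub_nonneg (hK : IsConstraintSet K D) (hR : IsSelfConcordantBarrier K R ν)
    {x y : E n} (hx : x ∈ interior K) (hy : y ∈ interior K) :
    0 ≤ fderiv ℝ R y (y - x) - fderiv ℝ R x (y - x) := by
  refine le_trans ?_ (div_one_add_le_fderiv_sub hK hR hx hy)
  have := localNorm_nonneg R x (y - x)
  exact div_nonneg (hessForm_nonneg hK hR hx _) (by linarith)

/-- Otherwise √ν = 0 and ∇R vanishes on the interior, contradicting its strict monotonicity between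
two points of a Dikin ellipsoid. -/
theorem barrier_parameter_pos (hn : 1 ≤ n) (hK : IsConstraintSet K D)
    (hR : IsSelfConcordantBarrier K R ν) : 0 < ν := by
  by_contra hν
  obtain ⟨x, hx⟩ := hK.interior_nonempty
  have : Nonempty (Fin n) := ⟨⟨0, hn⟩⟩
  obtain ⟨h, hh⟩ := exists_ne (0 : E n)
  have p := localNorm_pos hK hR hx hh
  set k := (2 * localNorm R x h)⁻¹ • h with hk
  have hk0 : k ≠ 0 := smul_ne_zero (by positivity) hh
  have hk1 : localNorm R x k < 1 := by
    rw [localNorm, hk, hessForm_smul, Real.sqrt_mul (sq_nonneg _), Real.sqrt_sq (by positivity)]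
    change _ * localNorm R x h < 1
    rw [mul_inv, mul_assoc, inv_mul_cancel₀ p.ne']
    norm_num
  have hy := add_mem_interior_of_localNorm_lt_one hK hR hx hk1
  have h0 : ∀ z ∈ interior K, ∀ v, fderiv ℝ R z v = 0 := by
    intro z hz v
    have := hR.abs_fderiv_le hz v
    rw [Real.sqrt_eq_zero_of_nonpos (not_lt.1 hν), zero_mul] at this
    exact abs_nonpos_iff.1 this
  have h1 := div_one_add_le_fderiv_sub hK hR hx hy
  rw [h0 _ hx, h0 _ hy, sub_zero, add_sub_cancel_left] at h1
  have h2 : 0 < hessForm R x k / (1 + localNorm R x k) :=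
    div_pos (hessForm_pos hK hR hx hk0) (by linarith [localNorm_nonneg R x k])
  linarith

/-- Let φ(s) be the derivative of R along the segment. The barrier inequality reads φ² ≤ νφ', so
(1/φ)' ≤ -1/ν where φ > 0. Since 1/φ stays positive up to s = 1, φ(s) ≤ ν/(1 - s), and integration
gives the logarithm. -/
theorem barrier_le_of_line (hn : 1 ≤ n) (hK : IsConstraintSet K D)
    (hR : IsSelfConcordantBarrier K R ν) {x y : E n} (hx : x ∈ interior K) (hy : y ∈ K) {t : ℝ}
    (ht0 : 0 ≤ t) (ht1 : t < 1) : R (x + t • (y - x)) - R x ≤ -ν * Real.log (1 - t) := by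
  have hν := barrier_parameter_pos hn hK hR
  set e := y - x
  have hseg : ∀ s : ℝ, 0 ≤ s → s < 1 → x + s • e ∈ interior K := by
    intro s hs0 hs1
    have := hK.convex.combo_interior_self_mem_interior hx hy (a := 1 - s) (b := s)
      (by linarith) hs0 (by ring)
    convert this using 1
    simp only [e, smul_sub, sub_smul, one_smul]; abel
  have hg := fun s h0 h1 => hasDerivAt_fderiv_line (hR.contDiffAt (hseg s h0 h1)) e
  have hbd : ∀ s : ℝ, 0 ≤ s → s < 1 → fderiv ℝ R (x + s • e) e ≤ ν / (1 - s) := by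
    intro s hs0 hs1
    by_cases hneg : fderiv ℝ R (x + s • e) e ≤ 0
    · exact hneg.trans (div_nonneg hν.le (by linarith))
    push Not at hneg
    have hmono : ∀ b, s ≤ b → b < 1 → fderiv ℝ R (x + s • e) e ≤ fderiv ℝ R (x + b • e) e := by
      intro b hsb hb
      have := sub_le_sub_of_hasDerivAt_le (f := fun _ => 0) (f' := fun _ => 0) hsb
        (fun r _ => hasDerivAt_const r (0 : ℝ))
        (fun r hr => hg r (hs0.trans hr.1) (hr.2.trans_lt hb))
        (fun r hr => hessForm_nonneg hK hR (hseg r (hs0.trans hr.1) (hr.2.trans_lt hb)) e)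
      simp only [sub_zero] at this
      linarith
    have key : ∀ b, s ≤ b → b < 1 → fderiv ℝ R (x + s • e) e * (b - s) ≤ ν := by
      intro b hsb hb
      have hp : ∀ r ∈ Set.Icc s b, 0 < fderiv ℝ R (x + r • e) e := fun r hr =>
        hneg.trans_le (hmono r hr.1 (hr.2.trans_lt hb))
      have := sub_le_sub_of_hasDerivAt_le (g := fun r => -ν⁻¹ * r) (g' := fun _ => -ν⁻¹) hsb
        (fun r hr => (hg r (hs0.trans hr.1) (hr.2.trans_lt hb)).fun_inv (hp r hr).ne')
        (fun r _ => by simpa using (hasDerivAt_id r).const_mul (-ν⁻¹))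
        (fun r hr => by
          have hin := hseg r (hs0.trans hr.1) (hr.2.trans_lt hb)
          have h1 := hR.abs_fderiv_le hin e
          have h2 := hessForm_nonneg hK hR hin e
          rw [abs_of_pos (hp r hr), abs_of_nonneg h2] at h1
          have h3 := pow_le_pow_left₀ (hp r hr).le h1 2
          rw [mul_pow, Real.sq_sqrt hν.le, Real.sq_sqrt h2] at h3
          rw [neg_div, neg_le_neg_iff, le_div_iff₀ (pow_pos (hp r hr) 2), inv_mul_le_iff₀ hν]
          exact h3)
      have q1 := hp s ⟨le_rfl, hsb⟩
      have q2 := inv_pos.2 (hp b ⟨hsb, le_rfl⟩)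
      have h4 : ν⁻¹ * (b - s) ≤ (fderiv ℝ R (x + s • e) e)⁻¹ := by
        linarith
      rw [inv_mul_le_iff₀ hν, ← div_eq_mul_inv, le_div_iff₀ q1] at h4
      linarith
    rw [le_div_iff₀ (by linarith)]
    -- The endpoint y may lie on the boundary, so b = 1 is reached only as a limit.
    have hc : Tendsto (fun b : ℝ => fderiv ℝ R (x + s • e) e * (b - s)) (𝓝[<] 1)
        (𝓝 (fderiv ℝ R (x + s • e) e * (1 - s))) :=
      ((by fun_prop : Continuous fun b : ℝ => fderiv ℝ R (x + s • e) e * (b - s)).tendsto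
        1).mono_left nhdsWithin_le_nhds
    refine le_of_tendsto hc ?_
    filter_upwards [Ioo_mem_nhdsLT hs1] with b hb using key b hb.1.le hb.2
  have := sub_le_sub_of_hasDerivAt_le (g := fun s => -ν * Real.log (1 - s))
    (g' := fun s => ν / (1 - s)) ht0
    (fun s hs => hasDerivAt_line (hR.contDiffAt (hseg s hs.1 (hs.2.trans_lt ht1))))
    (fun s hs => by
      have h1 : HasDerivAt (fun s : ℝ => 1 - s) (-1) s := by
        simpa using (hasDerivAt_id s).const_sub 1
      have hs1 : s < 1 := hs.2.trans_lt ht1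
      exact ((h1.log (by linarith)).const_mul (-ν)).congr_deriv (by ring))
    (fun s hs => hbd s hs.1 (hs.2.trans_lt ht1))
  simpa using this

/-! ### Minimizers of regularized objectives -/

/-- A sublevel set is compact: it is bounded, and no boundary point of K can be a limit of its
points because R blows up there. -/
theorem exists_isMinOn_add_barrier (hK : IsConstraintSet K D)
    (hR : IsSelfConcordantBarrier K R ν) {G : E n → ℝ} (hG : Continuous G) {c : ℝ} (hc : 0 < c) :
    ∃ x ∈ interior K, IsMinOn (fun z => G z + c * R z) (interior K) x := by
  set f := fun z => G z + c * R z
  obtain ⟨x₀, hx₀⟩ := hK.interior_nonempty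
  have hfc : ∀ z ∈ interior K, ContinuousAt f z := fun z hz =>
    hG.continuousAt.add ((hR.contDiffAt hz).continuousAt.const_mul c)
  set S := {z | z ∈ interior K ∧ f z ≤ f x₀}
  have hScl : IsClosed S := by
    refine isClosed_of_closure_subset fun z hz => ?_
    have hzK : z ∈ K := hK.isClosed.closure_subset_iff.2
      (fun w hw => interior_subset hw.1) hz
    by_cases hzi : z ∈ interior K
    · refine ⟨hzi, ?_⟩
      by_contra hlt
      push Not at hlt
      have h1 := (hfc z hzi).eventually (lt_mem_nhds hlt)
      obtain ⟨w, hw1, hw2⟩ := (mem_closure_iff_frequently.1 hz).and_eventually h1 |>.exists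
      exact absurd hw1.2 (not_le.2 hw2)
    · have hfr : z ∈ frontier K := by
        rw [hK.isClosed.frontier_eq]; exact ⟨hzK, hzi⟩
      have h1 := hR.boundary z hfr
      have h2 : Tendsto f (𝓝[interior K] z) atTop :=
        (hG.continuousAt.mono_left nhdsWithin_le_nhds).add_atTop (h1.const_mul_atTop hc)
      have h3 := eventually_nhdsWithin_iff.1 (h2.eventually_gt_atTop (f x₀))
      obtain ⟨w, hw1, hw2⟩ := (mem_closure_iff_frequently.1 hz).and_eventually h3 |>.exists
      exact absurd hw1.2 (not_le.2 (hw2 hw1.1))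
  have hScomp : IsCompact S := Metric.isCompact_of_isClosed_isBounded hScl
    (hK.isBounded.subset fun z hz => interior_subset hz.1)
  obtain ⟨x, hxS, hx⟩ := hScomp.exists_isMinOn ⟨x₀, hx₀, le_rfl⟩
    (fun z hz => (hfc z hz.1).continuousWithinAt)
  refine ⟨x, hxS.1, fun z hz => ?_⟩
  by_cases hzS : f z ≤ f x₀
  · exact hx ⟨hz, hzS⟩
  · exact hxS.2.trans (not_le.1 hzS).le

theorem argminOn_spec {f : E n → ℝ} {S : Set (E n)} (h : ∃ x ∈ S, IsMinOn f S x) :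
    argminOn f S ∈ S ∧ IsMinOn f S (argminOn f S) :=
  Classical.epsilon_spec (p := fun x => x ∈ S ∧ IsMinOn f S x) h

/-- The first-order optimality condition for `⟪θ, z⟫ + m / 2 * ‖z‖ ^ 2 + R z / η`. -/
structure IsStationary (K : Set (E n)) (R : E n → ℝ) (η m : ℝ) (θ z : E n) : Prop where
  mem : z ∈ interior K
  eq_zero : ∀ h, ⟪θ, h⟫ + m * ⟪z, h⟫ + 1 / η * fderiv ℝ R z h = 0

/-- Subtract the two conditions, test with z - z', and drop the barrier terms by monotonicity of ∇R.
For m > 0 this gives uniqueness and a Lipschitz solution map, from which the measurability of the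
iterates follows. -/
theorem IsStationary.mul_norm_sub_le (hK : IsConstraintSet K D)
    (hR : IsSelfConcordantBarrier K R ν) {η m : ℝ} (hη : 0 < η) {θ θ' z z' : E n}
    (h : IsStationary K R η m θ z) (h' : IsStationary K R η m θ' z') :
    m * ‖z - z'‖ ≤ ‖θ - θ'‖ := by
  by_cases hzz : z = z'
  · simp [hzz]
  have hp : 0 < ‖z - z'‖ := norm_pos_iff.2 (sub_ne_zero.2 hzz)
  have h1 := h.eq_zero (z - z')
  have h2 := h'.eq_zero (z - z')
  have h3 := mul_nonneg (one_div_pos.2 hη).le (fderiv_sub_nonneg hK hR h'.mem h.mem)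
  have h4 : m * ‖z - z'‖ ^ 2 = m * ⟪z, z - z'⟫ - m * ⟪z', z - z'⟫ := by
    rw [← real_inner_self_eq_norm_sq]; nth_rw 1 [inner_sub_left]; ring
  have h5 : -⟪θ - θ', z - z'⟫ ≤ ‖θ - θ'‖ * ‖z - z'‖ := by
    rw [← inner_neg_left]
    exact (real_inner_le_norm _ _).trans (by rw [norm_neg])
  rw [inner_sub_left] at h5
  have h6 : m * ‖z - z'‖ * ‖z - z'‖ ≤ ‖θ - θ'‖ * ‖z - z'‖ := by nlinarith
  exact le_of_mul_le_mul_right h6 hp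

theorem exists_isStationary (hK : IsConstraintSet K D) (hR : IsSelfConcordantBarrier K R ν)
    {η : ℝ} (hη : 0 < η) (σ : ℝ) (S : Finset ℕ) (g x : ℕ → E n) :
    let f := fun z => ∑ s ∈ S, (⟪g s, z⟫ + σ / 2 * ‖z - x s‖ ^ 2) + 1 / η * R z
    argminOn f (interior K) ∈ interior K ∧ IsMinOn f (interior K) (argminOn f (interior K)) ∧
      IsStationary K R η (σ * S.card) (∑ s ∈ S, (g s - σ • x s)) (argminOn f (interior K)) := by
  intro f
  have hspec := argminOn_spec (exists_isMinOn_add_barrier hK hR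
    (G := fun z => ∑ s ∈ S, (⟪g s, z⟫ + σ / 2 * ‖z - x s‖ ^ 2)) (by fun_prop)
    (one_div_pos.2 hη))
  change argminOn f (interior K) ∈ interior K ∧ IsMinOn f (interior K) _ at hspec
  refine ⟨hspec.1, hspec.2, hspec.1, fun h => ?_⟩
  set z := argminOn f (interior K)
  have hz : z + (0 : ℝ) • h ∈ interior K := by simpa using hspec.1
  have hR' := hasDerivAt_line (e := h) (hR.contDiffAt hz)
  have hl : HasDerivAt (fun s : ℝ => z + s • h) h 0 := by
    simpa using ((hasDerivAt_id (0 : ℝ)).smul_const h).const_add z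
  have hterm : ∀ s ∈ S, HasDerivAt
      (fun r : ℝ => ⟪g s, z + r • h⟫ + σ / 2 * ‖z + r • h - x s‖ ^ 2)
      (⟪g s, h⟫ + σ * ⟪z - x s, h⟫) 0 := by
    intro s _
    have h1 : HasDerivAt (fun r : ℝ => ⟪g s, z + r • h⟫) ⟪g s, h⟫ 0 := by
      simpa using (hasDerivAt_const (0 : ℝ) (g s)).inner ℝ hl
    have h2 := (hl.sub_const (x s)).norm_sq
    refine (h1.add (h2.const_mul (σ / 2))).congr_deriv ?_
    simp only [zero_smul, add_zero]; ring
  have hf : HasDerivAt (fun r : ℝ => f (z + r • h)) (∑ s ∈ S, (⟪g s, h⟫ + σ * ⟪z - x s, h⟫)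
      + 1 / η * fderiv ℝ R (z + (0 : ℝ) • h) h) 0 :=
    (HasDerivAt.fun_sum hterm).add (hR'.const_mul (1 / η))
  have hloc : IsLocalMin (fun r : ℝ => f (z + r • h)) 0 := by
    have hev : ∀ᶠ r in 𝓝 (0 : ℝ), z + r • h ∈ interior K :=
      (by fun_prop : Continuous fun r : ℝ => z + r • h).continuousAt.eventually
        (isOpen_interior.mem_nhds hz)
    filter_upwards [hev] with r hr
    simpa using hspec.2 hr
  have h0 := hloc.hasDerivAt_eq_zero hf
  rw [zero_smul, add_zero] at h0
  rw [← h0, sum_inner, mul_assoc, Finset.cast_card, Finset.sum_mul, Finset.mul_sum,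
    ← Finset.sum_add_distrib]
  congr 1
  refine Finset.sum_congr rfl fun s _ => ?_
  rw [inner_sub_left, inner_sub_left, real_inner_smul_left]
  ring

end BarrierGlobal

end EBCOM

section MatrixInvSqrt

/-! ### The inverse square root of a positive definite matrix -/

variable {n : ℕ}

theorem Matrix.PosDef.spectrum_pos {M : Matrix (Fin n) (Fin n) ℝ} (hM : M.PosDef) :
    ∀ r ∈ spectrum ℝ M, 0 < r := by
  intro r hr
  rw [hM.1.spectrum_real_eq_range_eigenvalues] at hr
  obtain ⟨i, rfl⟩ := hr
  exact hM.eigenvalues_pos i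

/-- `r ↦ r ^ (-1 / 2)` applied to a matrix by functional calculus. -/
noncomputable def Matrix.invSqrt (M : Matrix (Fin n) (Fin n) ℝ) : Matrix (Fin n) (Fin n) ℝ :=
  cfc (fun r : ℝ => r ^ (-(1 / 2) : ℝ)) M

theorem Matrix.PosDef.invSqrt_mul_mul {M : Matrix (Fin n) (Fin n) ℝ} (hM : M.PosDef) :
    M.invSqrt * (M * M.invSqrt) = 1 := by
  have hsa : IsSelfAdjoint M := hM.1
  have hc : ∀ f : ℝ → ℝ, ContinuousOn f (spectrum ℝ M) := M.finite_real_spectrum.continuousOn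
  have h1 : cfc (fun x : ℝ => x) M = M := cfc_id' ℝ M
  have h2 : M * M.invSqrt = cfc (fun x : ℝ => x * x ^ (-(1 / 2) : ℝ)) M := by
    rw [cfc_mul _ _ M (hc _) (hc _), h1, invSqrt]
  rw [h2, invSqrt, ← cfc_mul _ _ M (hc _) (hc _), ← cfc_const_one ℝ M]
  refine cfc_congr fun r hr => ?_
  have hr0 := hM.spectrum_pos r hr
  rw [mul_left_comm, ← Real.rpow_add hr0]
  norm_num
  rw [Real.rpow_neg_one, mul_inv_cancel₀ hr0.ne']

theorem Matrix.isHermitian_invSqrt (M : Matrix (Fin n) (Fin n) ℝ) : M.invSqrt.IsHermitian :=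
  cfc_predicate (p := IsSelfAdjoint) _ M

theorem Matrix.PosDef.inv_invSqrt {M : Matrix (Fin n) (Fin n) ℝ} (hM : M.PosDef) :
    M.invSqrt⁻¹ = M * M.invSqrt :=
  Matrix.inv_eq_right_inv hM.invSqrt_mul_mul

theorem Matrix.PosDef.inv_invSqrt_mul_invSqrt {M : Matrix (Fin n) (Fin n) ℝ} (hM : M.PosDef) :
    M.invSqrt⁻¹ * M.invSqrt = 1 := by
  rw [hM.inv_invSqrt]
  exact mul_eq_one_comm.1 hM.invSqrt_mul_mul

theorem Matrix.PosDef.inv_invSqrt_mul_self {M : Matrix (Fin n) (Fin n) ℝ} (hM : M.PosDef) :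
    M.invSqrt⁻¹ * M.invSqrt⁻¹ = M := by
  have h1 := hM.inv_invSqrt_mul_invSqrt
  have h2 : M.invSqrt * M.invSqrt⁻¹ = 1 := mul_eq_one_comm.1 h1
  calc M.invSqrt⁻¹ * M.invSqrt⁻¹ = M.invSqrt⁻¹ * (M.invSqrt * (M * M.invSqrt)) * M.invSqrt⁻¹ := by
        rw [hM.invSqrt_mul_mul, mul_one]
    _ = M.invSqrt⁻¹ * M.invSqrt * M * (M.invSqrt * M.invSqrt⁻¹) := by simp only [mul_assoc]
    _ = M := by rw [h1, h2, one_mul, mul_one]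

/-- Weierstrass approximation on the intervals [1/(k+1), k+1], which exhaust (0, ∞). One sequence
then serves all positive definite matrices, without a uniform bound on their spectra. -/
theorem exists_polynomial_tendsto {f : ℝ → ℝ} (hf : ContinuousOn f (Set.Ioi 0)) :
    ∃ p : ℕ → Polynomial ℝ, ∀ r, 0 < r → Tendsto (fun k => (p k).eval r) atTop (𝓝 (f r)) := by
  have h : ∀ k : ℕ, ∃ p : Polynomial ℝ, ∀ x ∈ Set.Icc (1 / ((k : ℝ) + 1)) ((k : ℝ) + 1),
      |p.eval x - f x| < 1 / ((k : ℝ) + 1) := fun k =>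
    exists_polynomial_near_of_continuousOn _ _ f
      (hf.mono fun x hx => lt_of_lt_of_le (by positivity) hx.1) _ (by positivity)
  choose p hp using h
  refine ⟨p, fun r hr => ?_⟩
  rw [tendsto_iff_dist_tendsto_zero]
  refine squeeze_zero' (Eventually.of_forall fun _ => dist_nonneg) ?_
    tendsto_one_div_add_atTop_nhds_zero_nat
  have h1 : ∀ᶠ k : ℕ in atTop, 1 / ((k : ℝ) + 1) < r :=
    tendsto_one_div_add_atTop_nhds_zero_nat.eventually (gt_mem_nhds hr)
  have h2 : ∀ᶠ k : ℕ in atTop, r ≤ k := tendsto_natCast_atTop_atTop.eventually_ge_atTop r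
  filter_upwards [h1, h2] with k hk1 hk2
  exact (hp k r ⟨hk1.le, by linarith⟩).le

theorem Matrix.IsHermitian.tendsto_cfc {M : Matrix (Fin n) (Fin n) ℝ} (hM : M.IsHermitian)
    {f : ℕ → ℝ → ℝ} {g : ℝ → ℝ}
    (h : ∀ r ∈ spectrum ℝ M, Tendsto (fun k => f k r) atTop (𝓝 (g r))) :
    Tendsto (fun k => cfc (f k) M) atTop (𝓝 (cfc g M)) := by
  simp only [hM.cfc_eq, Matrix.IsHermitian.cfc, Unitary.conjStarAlgAut_apply]
  refine Tendsto.mul (Tendsto.mul tendsto_const_nhds ?_) tendsto_const_nhds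
  refine tendsto_pi_nhds.2 fun i => tendsto_pi_nhds.2 fun j => ?_
  by_cases hij : i = j
  · subst hij
    simpa using h _ (hM.eigenvalues_mem_spectrum_real i)
  · simp [Matrix.diagonal_apply_ne _ hij]

theorem Matrix.measurable_mul_apply {Ω : Type*} [MeasurableSpace Ω]
    {M N : Ω → Matrix (Fin n) (Fin n) ℝ} (hM : ∀ i j, Measurable fun ω => M ω i j)
    (hN : ∀ i j, Measurable fun ω => N ω i j) (i j : Fin n) :
    Measurable fun ω => (M ω * N ω) i j := by
  simp only [Matrix.mul_apply]
  exact Finset.measurable_sum _ fun k _ => (hM i k).mul (hN k j)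

theorem Matrix.measurable_aeval_apply {Ω : Type*} [MeasurableSpace Ω]
    {M : Ω → Matrix (Fin n) (Fin n) ℝ} (hM : ∀ i j, Measurable fun ω => M ω i j)
    (p : Polynomial ℝ) (i j : Fin n) : Measurable fun ω => (Polynomial.aeval (M ω) p) i j := by
  have hpow : ∀ (k : ℕ) (i j : Fin n), Measurable fun ω => (M ω ^ k) i j := by
    intro k
    induction k with
    | zero => intro i j; simp
    | succ k ih =>
      intro i j
      simp only [pow_succ]
      exact Matrix.measurable_mul_apply ih hM i j
  simp only [Polynomial.aeval_eq_sum_range, Matrix.sum_apply, Matrix.smul_apply,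
    smul_eq_mul]
  exact Finset.measurable_sum _ fun k _ => (hpow k i j).const_mul _

/-- A pointwise limit of polynomials in M, whose entries are measurable. -/
theorem Matrix.measurable_invSqrt_apply {Ω : Type*} [MeasurableSpace Ω]
    {M : Ω → Matrix (Fin n) (Fin n) ℝ} (hM : ∀ i j, Measurable fun ω => M ω i j)
    (hpos : ∀ ω, (M ω).PosDef) (i j : Fin n) : Measurable fun ω => (M ω).invSqrt i j := by
  obtain ⟨p, hp⟩ := exists_polynomial_tendsto (f := fun r : ℝ => r ^ (-(1 / 2) : ℝ))
    (fun r hr => (Real.continuousAt_rpow_const _ _ (Or.inl (ne_of_gt hr))).continuousWithinAt)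
  refine measurable_of_tendsto_metrizable
    (f := fun k ω => (Polynomial.aeval (M ω) (p k)) i j)
    (fun k => Matrix.measurable_aeval_apply hM (p k) i j) ?_
  rw [tendsto_pi_nhds]
  intro ω
  have h1 := (hpos ω).1.tendsto_cfc (f := fun k => (p k).eval)
    (fun r hr => hp r ((hpos ω).spectrum_pos r hr))
  simp only [cfc_polynomial _ _ (hpos ω).1.isSelfAdjoint] at h1
  exact (tendsto_pi_nhds.1 ((tendsto_pi_nhds.1 h1) i)) j

end MatrixInvSqrt

namespace EBCOM

/-! ### Matrices acting on Euclidean vectors. -/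

section Act

variable {n : ℕ}

theorem act_mul (M N : Matrix (Fin n) (Fin n) ℝ) (v : E n) : act (M * N) v = act M (act N v) := by
  simp [act, Matrix.mulVec_mulVec]

theorem act_one (v : E n) : act 1 v = v := by simp [act]

theorem act_add (M : Matrix (Fin n) (Fin n) ℝ) (v w : E n) :
    act M (v + w) = act M v + act M w := by
  simp [act, Matrix.mulVec_add]

theorem act_smul (M : Matrix (Fin n) (Fin n) ℝ) (c : ℝ) (v : E n) :
    act M (c • v) = c • act M v := by
  simp [act, Matrix.mulVec_smul]

theorem act_apply (M : Matrix (Fin n) (Fin n) ℝ) (v : E n) (i : Fin n) :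
    act M v i = ∑ j, M i j * v j := by
  simp [act, Matrix.mulVec, dotProduct]

theorem inner_act_of_isHermitian {M : Matrix (Fin n) (Fin n) ℝ} (hM : M.IsHermitian)
    (v w : E n) : ⟪act M v, w⟫ = ⟪v, act M w⟫ := by
  simp only [PiLp.inner_apply, act_apply, RCLike.inner_apply, conj_trivial, Finset.mul_sum,
    Finset.sum_mul]
  rw [Finset.sum_comm]
  refine Finset.sum_congr rfl fun i _ => Finset.sum_congr rfl fun j _ => ?_
  have : M j i = M i j := by simpa using congrFun (congrFun hM i) j
  rw [this]; ring

theorem measurable_act {Ω : Type*} {_ : MeasurableSpace Ω} {M : Ω → Matrix (Fin n) (Fin n) ℝ}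
    {v : Ω → E n} (hM : ∀ i j, Measurable fun ω => M ω i j) (hv : Measurable v) :
    Measurable fun ω => act (M ω) (v ω) := by
  refine (WithLp.measurable_toLp 2 _).comp (measurable_pi_lambda _ fun i => ?_)
  simp only [Matrix.mulVec, dotProduct]
  refine Finset.measurable_sum _ fun j _ => (hM i j).mul ?_
  exact (measurable_pi_apply j).comp ((WithLp.measurable_ofLp 2 _).comp hv)

end Act

/-! ### The exploration ellipsoids. -/

section Ellipsoid

variable {n : ℕ} {K : Set (E n)} {R : E n → ℝ} {ν D : ℝ}

theorem sum_single_eq (v : E n) : v = ∑ i, v i • EuclideanSpace.single i (1 : ℝ) := by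
  ext j
  simp [Finset.sum_apply, Pi.single_apply]

theorem inner_act_hessian (R : E n → ℝ) (x v w : E n) :
    ⟪v, act (hessian R x) w⟫ = fderiv ℝ (fderiv ℝ R) x v w := by
  conv_rhs => rw [sum_single_eq v, sum_single_eq w]
  simp only [map_sum, map_smul, sum_apply, smul_apply, smul_eq_mul, PiLp.inner_apply, act_apply,
    RCLike.inner_apply, conj_trivial, hessian, Matrix.of_apply, iteratedFDeriv_two_apply,
    Finset.mul_sum, Finset.sum_mul]
  simp only [Matrix.cons_val_zero, Matrix.cons_val_one]
  rw [Finset.sum_comm]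
  refine Finset.sum_congr rfl fun i _ => Finset.sum_congr rfl fun j _ => ?_
  ring

/-- The matrix `∇²R(x) + m I`. -/
noncomputable def regHessian (R : E n → ℝ) (m : ℝ) (x : E n) : Matrix (Fin n) (Fin n) ℝ :=
  hessian R x + m • 1

theorem inner_act_regHessian (R : E n → ℝ) (m : ℝ) (x v : E n) :
    ⟪v, act (regHessian R m x) v⟫ = hessForm R x v + m * ‖v‖ ^ 2 := by
  have : act (regHessian R m x) v = act (hessian R x) v + m • v := by
    simp [act, regHessian, Matrix.add_mulVec, Matrix.smul_mulVec]
  rw [this, inner_add_right, inner_act_hessian, real_inner_smul_right, real_inner_self_eq_norm_sq,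
    hessForm]

theorem posDef_regHessian (hK : IsConstraintSet K D) (hR : IsSelfConcordantBarrier K R ν)
    {m : ℝ} (hm : 0 ≤ m) {x : E n} (hx : x ∈ interior K) : (regHessian R m x).PosDef := by
  refine Matrix.PosDef.of_dotProduct_mulVec_pos ?_ fun v hv => ?_
  · refine Matrix.IsHermitian.ext fun i j => ?_
    have := (hR.contDiffAt hx).fderiv_fderiv_symm (EuclideanSpace.single i 1)
      (EuclideanSpace.single j (1 : ℝ))
    by_cases hij : i = j
    · simp [hij]
    · simp [regHessian, hessian, iteratedFDeriv_two_apply, hij, Ne.symm hij, this]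
  · have h1 := inner_act_regHessian R m x (WithLp.toLp 2 v)
    have hv' : WithLp.toLp 2 v ≠ (0 : E n) := by simpa using hv
    have h2 := hessForm_pos hK hR hx hv'
    rw [EuclideanSpace.inner_eq_star_dotProduct] at h1
    simp only [act, star_trivial] at h1
    rw [star_trivial, dotProduct_comm, h1]
    positivity

theorem ellipsoid_eq (R : E n → ℝ) (η σ : ℝ) (x : ℕ → E n) (t : ℕ) :
    ellipsoid R η σ x t = (regHessian R (η * σ * t) (x t)).invSqrt := rfl

variable {η σ : ℝ} {x : ℕ → E n} {t : ℕ}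

theorem inner_act_ellipsoid_inv (R : E n → ℝ) (η σ : ℝ) (x : ℕ → E n) (t : ℕ) (v w : E n) :
    ⟪act (ellipsoid R η σ x t)⁻¹ v, w⟫ = ⟪v, act (ellipsoid R η σ x t)⁻¹ w⟫ :=
  inner_act_of_isHermitian (Matrix.isHermitian_invSqrt _).inv v w

theorem act_ellipsoid_inv_act (hK : IsConstraintSet K D) (hR : IsSelfConcordantBarrier K R ν)
    (hησ : 0 ≤ η * σ) (hx : x t ∈ interior K) (v : E n) :
    act (ellipsoid R η σ x t)⁻¹ (act (ellipsoid R η σ x t) v) = v := by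
  rw [← act_mul, ellipsoid_eq,
    (posDef_regHessian hK hR (by positivity) hx).inv_invSqrt_mul_invSqrt, act_one]

theorem norm_act_ellipsoid_inv_sq (hK : IsConstraintSet K D) (hR : IsSelfConcordantBarrier K R ν)
    (hησ : 0 ≤ η * σ) (hx : x t ∈ interior K) (v : E n) :
    ‖act (ellipsoid R η σ x t)⁻¹ v‖ ^ 2 = hessForm R (x t) v + η * σ * t * ‖v‖ ^ 2 := by
  rw [← real_inner_self_eq_norm_sq, inner_act_ellipsoid_inv, ← act_mul, ellipsoid_eq,
    (posDef_regHessian hK hR (by positivity) hx).inv_invSqrt_mul_self, inner_act_regHessian]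

theorem hessForm_act_ellipsoid (hK : IsConstraintSet K D) (hR : IsSelfConcordantBarrier K R ν)
    (hησ : 0 ≤ η * σ) (hx : x t ∈ interior K) (v : E n) :
    hessForm R (x t) (act (ellipsoid R η σ x t) v) +
      η * σ * t * ‖act (ellipsoid R η σ x t) v‖ ^ 2 = ‖v‖ ^ 2 := by
  rw [← norm_act_ellipsoid_inv_sq hK hR hησ hx, act_ellipsoid_inv_act hK hR hησ hx]

/-- The squared local norm of w = A_t v plus ησt‖w‖² equals ‖v‖² ≤ 1. The second summand is strictly
positive unless w = 0, so w lies in the open Dikin ellipsoid. -/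
theorem add_act_ellipsoid_mem (hK : IsConstraintSet K D) (hR : IsSelfConcordantBarrier K R ν)
    (hησ : 0 < η * σ) (ht : 1 ≤ t) (hx : x t ∈ interior K) {v : E n} (hv : ‖v‖ ≤ 1) :
    x t + act (ellipsoid R η σ x t) v ∈ K := by
  refine interior_subset ?_
  set w := act (ellipsoid R η σ x t) v with hw
  by_cases hw0 : w = 0
  · rwa [hw0, add_zero]
  refine add_mem_interior_of_localNorm_lt_one hK hR hx ?_
  have h1 := hessForm_act_ellipsoid hK hR hησ.le hx v
  rw [← hw] at h1
  have h2 : 0 < ‖w‖ := norm_pos_iff.2 hw0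
  have ht' : (1 : ℝ) ≤ t := by exact_mod_cast ht
  have h3 : 0 < η * σ * t * ‖w‖ ^ 2 := by positivity
  have h4 : ‖v‖ ^ 2 ≤ 1 := pow_le_one₀ (norm_nonneg _) hv
  rw [localNorm, Real.sqrt_lt' one_pos]
  linarith

theorem norm_act_ellipsoid_sq_le (hK : IsConstraintSet K D) (hR : IsSelfConcordantBarrier K R ν)
    (hησ : 0 < η * σ) (ht : 1 ≤ t) (hx : x t ∈ interior K) (v : E n) :
    ‖act (ellipsoid R η σ x t) v‖ ^ 2 ≤ ‖v‖ ^ 2 / (η * σ * t) := by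
  have h1 := hessForm_act_ellipsoid hK hR hησ.le hx v
  have h2 := hessForm_nonneg hK hR hx (act (ellipsoid R η σ x t) v)
  have ht' : (1 : ℝ) ≤ t := by exact_mod_cast ht
  rw [le_div_iff₀ (by positivity)]
  linarith

theorem _root_.ContinuousOn.measurable_comp_of_mem {Ω α β : Type*} [MeasurableSpace Ω]
    [TopologicalSpace α] [MeasurableSpace α] [OpensMeasurableSpace α] [TopologicalSpace β]
    [MeasurableSpace β] [BorelSpace β] {s : Set α} {f : α → β} (hf : ContinuousOn f s)
    {z : Ω → α} (hz : Measurable z) (hzs : ∀ ω, z ω ∈ s) : Measurable fun ω => f (z ω) :=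
  (continuousOn_iff_continuous_domRestrict.1 hf).measurable.comp (hz.subtype_mk (h := hzs))

theorem measurable_regHessian_apply (hR : IsSelfConcordantBarrier K R ν) {Ω : Type*}
    [MeasurableSpace Ω] {z : Ω → E n} (hz : Measurable z) (hzK : ∀ ω, z ω ∈ interior K) (m : ℝ)
    (i j : Fin n) : Measurable fun ω => regHessian R m (z ω) i j := by
  set a : E n := EuclideanSpace.single i 1
  set b : E n := EuclideanSpace.single j 1
  have h1 : ∀ y, regHessian R m y i j = fderiv ℝ (fderiv ℝ R) y a b +
      (m • (1 : Matrix (Fin n) (Fin n) ℝ)) i j := fun y => by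
    simp [regHessian, hessian, iteratedFDeriv_two_apply, a, b]
  have h2 : ContinuousOn (fun y => fderiv ℝ (fderiv ℝ R) y a b) (interior K) := fun y hy =>
    ((((hR.contDiffAt hy).differentiableAt_fderiv_fderiv.continuousAt).clm_apply
      continuousAt_const).clm_apply continuousAt_const).continuousWithinAt
  simp only [h1]
  exact (h2.measurable_comp_of_mem hz hzK).add_const _

end Ellipsoid

end EBCOM

namespace EBCOM

/-! ### The iterates as regularized leaders. -/

section Unrolling

variable {n H : ℕ} {K : Set (E n)} {R : E n → ℝ} {ν D η σ : ℝ} {u : ℕ → E n} {F : ℕ → V n H → ℝ}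

theorem history_apply_of_le {s t : ℕ} (h : s ≤ t) :
    history K R η σ u F t s = iterate K R η σ u F s := by
  induction t with
  | zero =>
    obtain rfl : s = 0 := by omega
    rfl
  | succ t ih =>
    rcases Nat.lt_or_ge t s with hs | hs
    · obtain rfl : s = t + 1 := by omega
      rfl
    · rw [history, Function.update_of_ne (by omega), ih hs]

theorem ellipsoid_congr {x x' : ℕ → E n} {t : ℕ} (h : x t = x' t) :
    ellipsoid R η σ x t = ellipsoid R η σ x' t := by
  simp only [ellipsoid, h]

theorem play_congr {x x' : ℕ → E n} {t : ℕ} (h : x t = x' t) :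
    play R η σ u x t = play R η σ u x' t := by
  simp only [play, h, ellipsoid_congr h]

/-- Only iterates up to time t enter. This lets the recursion through `history` be rewritten in
terms of the full sequence `iterate`. -/
theorem gradEst_congr {x x' : ℕ → E n} {t : ℕ} (h : ∀ s ≤ t, x s = x' s) :
    gradEst R η σ u F x t = gradEst R η σ u F x' t := by
  unfold gradEst
  split_ifs with ht
  · rfl
  have h1 : window H (play R η σ u x) t = window H (play R η σ u x') t := by
    unfold window
    congr 1
    funext i
    exact play_congr (h _ (by omega))
  have h2 : ∀ i, ellipsoid R η σ x (t - i) = ellipsoid R η σ x' (t - i) := fun i =>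
    ellipsoid_congr (h _ (Nat.sub_le t i))
  simp only [h1, h2]

theorem iterate_of_le {t : ℕ} (ht : t ≤ H) :
    iterate K R η σ u F t = argminOn R (interior K) := by
  cases t with
  | zero => rfl
  | succ t => simp [iterate, history, ht]

theorem iterate_succ_of_le {t : ℕ} (ht : H ≤ t) :
    iterate K R η σ u F (t + 1) = nextIterate K R η σ u F (iterate K R η σ u F) t := by
  have h1 : iterate K R η σ u F (t + 1) =
      nextIterate K R η σ u F (history K R η σ u F t) t := by
    simp [iterate, history, Nat.not_le.2 (Nat.lt_succ_of_le ht)]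
  rw [h1]
  unfold nextIterate
  congr 1
  funext z
  congr 1
  refine Finset.sum_congr rfl fun s hs => ?_
  rw [Finset.mem_Icc] at hs
  rw [gradEst_congr (x' := iterate K R η σ u F) fun r hr => history_apply_of_le (by omega),
    history_apply_of_le (by omega)]

/-- The objective minimized by the `k`-th regularized leader, `1/η` times the barrier included. -/
noncomputable def leaderObjective (R : E n → ℝ) (η σ : ℝ) (g x : ℕ → E n) (k : ℕ) (z : E n) : ℝ :=
  ∑ r ∈ Finset.Icc 1 k, (⟪g r, z⟫ + σ / 2 * ‖z - x r‖ ^ 2) + 1 / η * R z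

theorem sum_Icc_sub_pred {M : Type*} [AddCommMonoid M] (hH : 1 ≤ H) (f : ℕ → M) (k : ℕ) :
    ∑ s ∈ Finset.Icc H (k + H), f (s - (H - 1)) = ∑ r ∈ Finset.Icc 1 (k + 1), f r := by
  refine Finset.sum_nbij' (fun s => s - (H - 1)) (fun r => r + (H - 1)) ?_ ?_ ?_ ?_ ?_ <;>
    simp only [Finset.mem_Icc] <;> intros <;> (try dsimp only) <;> first | rfl | omega

/-- Re-indexing by s ↦ s - (H - 1) turns the delayed update into ordinary follow-the-leader on the
rounds 1, …, k + 1, with its output used H rounds later. -/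
theorem iterate_add_eq_argminOn (hH : 1 ≤ H) (k : ℕ) :
    iterate K R η σ u F (k + 1 + H) = argminOn (leaderObjective R η σ
      (gradEst R η σ u F (iterate K R η σ u F)) (iterate K R η σ u F) (k + 1)) (interior K) := by
  rw [show k + 1 + H = k + H + 1 by omega, iterate_succ_of_le (by omega)]
  unfold nextIterate leaderObjective
  congr 1
  funext z
  congr 1
  exact sum_Icc_sub_pred hH (fun r => ⟪gradEst R η σ u F (iterate K R η σ u F) r, z⟫ +
    σ / 2 * ‖z - iterate K R η σ u F r‖ ^ 2) k

theorem argminOn_barrier_spec (hK : IsConstraintSet K D) (hR : IsSelfConcordantBarrier K R ν) :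
    argminOn R (interior K) ∈ interior K ∧ IsMinOn R (interior K) (argminOn R (interior K)) :=
  argminOn_spec (by simpa using
    exists_isMinOn_add_barrier hK hR (G := fun _ => 0) continuous_const one_pos)

/-- The `k`-th leader is an interior minimizer of its objective. -/
theorem iterate_add_spec (hK : IsConstraintSet K D) (hR : IsSelfConcordantBarrier K R ν)
    (hη : 0 < η) (hH : 1 ≤ H) (k : ℕ) :
    let x := iterate K R η σ u F
    let g := gradEst R η σ u F x
    x (k + H) ∈ interior K ∧ IsMinOn (leaderObjective R η σ g x k) (interior K) (x (k + H)) ∧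
      IsStationary K R η (σ * k) (∑ r ∈ Finset.Icc 1 k, (g r - σ • x r)) (x (k + H)) := by
  intro x g
  cases k with
  | zero =>
    have hx : x (0 + H) = argminOn R (interior K) := iterate_of_le (by omega)
    have h := argminOn_barrier_spec hK hR
    rw [← hx] at h
    refine ⟨h.1, fun z hz => ?_, h.1, fun v => ?_⟩
    · simp only [leaderObjective]
      simpa using mul_le_mul_of_nonneg_left (h.2 hz) (inv_nonneg.2 hη.le)
    · have hloc : IsLocalMin R (x (0 + H)) := h.2.isLocalMin (isOpen_interior.mem_nhds h.1)
      rw [hloc.fderiv_eq_zero]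
      simp
  | succ k =>
    have hx : x (k + 1 + H) = _ := iterate_add_eq_argminOn hH k
    have h := exists_isStationary hK hR hη σ (Finset.Icc 1 (k + 1)) g x
    rw [hx]
    rw [Nat.card_Icc, Nat.add_sub_cancel] at h
    exact h

/-- Truncated subtraction sends every t ≤ H to the leader of index 0, so all iterates can be treated
as leaders. -/
theorem iterate_eq_sub (t : ℕ) :
    iterate K R η σ u F t = iterate K R η σ u F (t - H + H) := by
  rcases le_total t H with h | h
  · rw [iterate_of_le h, iterate_of_le (by omega)]
  · rw [Nat.sub_add_cancel h]

theorem iterate_mem_interior (hK : IsConstraintSet K D) (hR : IsSelfConcordantBarrier K R ν)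
    (hη : 0 < η) (hH : 1 ≤ H) (t : ℕ) : iterate K R η σ u F t ∈ interior K := by
  rw [iterate_eq_sub]
  exact (iterate_add_spec hK hR hη hH _).1

theorem played_mem (hK : IsConstraintSet K D) (hR : IsSelfConcordantBarrier K R ν) (hη : 0 < η)
    (hσ : 0 < σ) (hH : 1 ≤ H) {t : ℕ} (ht : 1 ≤ t) (hu : ‖u t‖ ≤ 1) :
    played K R η σ u F t ∈ K :=
  add_act_ellipsoid_mem hK hR (mul_pos hη hσ) ht (iterate_mem_interior hK hR hη hH t) hu

end Unrolling

end EBCOM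

/-! ### Quadratic losses. -/

namespace EBCOM

/-- Exact second-order expansion of a quadratic polynomial. -/
theorem quadratic_expansion {X : Type*} [NormedAddCommGroup X] [InnerProductSpace ℝ X]
    [FiniteDimensional ℝ X] [CompleteSpace X] {F : X → ℝ} {W : X →ₗ[ℝ] X} {b : X} {c : ℝ}
    (hFw : ∀ w, F w = ⟪w, W w⟫ + ⟪b, w⟫ + c) : Differentiable ℝ F ∧
      (∀ w v, F (w + v) = F w + ⟪gradient F w, v⟫ + ⟪v, W v⟫) ∧
      ∀ w w' v, ⟪gradient F w - gradient F w', v⟫ = ⟪w - w', W v⟫ + ⟪v, W (w - w')⟫ := by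
  have hFe : F = fun w => ⟪w, LinearMap.toContinuousLinearMap W w⟫ + ⟪b, w⟫ + c := funext hFw
  have hd : Differentiable ℝ F := by
    rw [hFe]
    exact ((differentiable_id.inner ℝ (ContinuousLinearMap.differentiable _)).add
      ((differentiable_const b).inner ℝ differentiable_id)).add_const c
  have hg : ∀ w v, ⟪gradient F w, v⟫ = ⟪w, W v⟫ + ⟪v, W w⟫ + ⟪b, v⟫ := by
    intro w v
    have h1 : ⟪gradient F w, v⟫ = fderiv ℝ F w v := by
      rw [gradient, InnerProductSpace.toDual_symm_apply]
    have h2 : HasDerivAt (fun s : ℝ => F (w + s • v)) (fderiv ℝ F (w + (0 : ℝ) • v) v) 0 :=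
      (hd _).hasDerivAt_line
    have h3 : (fun s : ℝ => F (w + s • v)) =
        fun s => F w + s * (⟪w, W v⟫ + ⟪v, W w⟫ + ⟪b, v⟫) + s ^ 2 * ⟪v, W v⟫ := by
      funext s
      simp only [hFw, map_add, map_smul, inner_add_left, inner_add_right, real_inner_smul_left,
        real_inner_smul_right]
      ring
    rw [h3] at h2
    have h4 : HasDerivAt (fun s : ℝ => F w + s * (⟪w, W v⟫ + ⟪v, W w⟫ + ⟪b, v⟫) + s ^ 2 * ⟪v, W v⟫)
        (⟪w, W v⟫ + ⟪v, W w⟫ + ⟪b, v⟫) 0 := by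
      have a1 := ((hasDerivAt_id (0 : ℝ)).mul_const (⟪w, W v⟫ + ⟪v, W w⟫ + ⟪b, v⟫)).const_add (F w)
      have a2 := ((hasDerivAt_id (0 : ℝ)).pow 2).mul_const ⟪v, W v⟫
      exact (a1.add a2).congr_deriv (by simp)
    have h5 := h2.unique h4
    rw [zero_smul, add_zero] at h5
    rw [h1, h5]
  refine ⟨hd, fun w v => ?_, fun w w' v => ?_⟩
  · rw [hg]
    simp only [hFw, map_add, inner_add_left, inner_add_right]
    ring
  · rw [inner_sub_left, hg, hg, map_sub, inner_sub_left, inner_sub_right]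
    ring


section Loss

variable {n H : ℕ} {K : Set (E n)} {β σ B L D : ℝ} {F : V n H → ℝ}

theorem continuous_diag : Continuous (diag H : E n → V n H) :=
  (PiLp.continuous_toLp 2 fun _ : Fin H => E n).comp (continuous_pi fun _ => continuous_id)

/-- `z ↦ (z, …, z)` as a continuous linear map. -/
noncomputable def diagL (n H : ℕ) : E n →L[ℝ] V n H :=
  { toFun := diag H
    map_add' := fun z z' => by ext; simp [diag]
    map_smul' := fun c z => by ext; simp [diag]
    cont := continuous_diag }

theorem diagL_apply (z : E n) : diagL n H z = diag H z := rfl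

theorem diag_sub (z z' : E n) : diag H (z - z') = diag H z - diag H z' := rfl

theorem diag_apply (z : E n) (i : Fin H) : diag H z i = z := rfl

theorem norm_diag_sq (z : E n) : ‖diag H z‖ ^ 2 = H * ‖z‖ ^ 2 := by
  rw [PiLp.norm_sq_eq_of_L2]
  simp [diag_apply]

/-- The bilinear remainder and differential of a quadratic loss. -/
theorem IsLoss.exists_expansion (hF : IsLoss K β σ B L F) :
    ∃ W : V n H →ₗ[ℝ] V n H, (∀ v, ⟪v, W v⟫ ≤ β * ‖v‖ ^ 2) ∧ Differentiable ℝ F ∧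
      (∀ w v, F (w + v) = F w + ⟪gradient F w, v⟫ + ⟪v, W v⟫) ∧
      ∀ w w' v, ⟪gradient F w - gradient F w', v⟫ = ⟪w - w', W v⟫ + ⟪v, W (w - w')⟫ := by
  obtain ⟨W, b, c, hFw, hW⟩ := hF.quadratic_smooth
  exact ⟨W, hW, quadratic_expansion hFw⟩

theorem IsLoss.differentiable (hF : IsLoss K β σ B L F) : Differentiable ℝ F := by
  obtain ⟨W, -, hd, -⟩ := hF.exists_expansion
  exact hd

theorem IsLoss.apply_add_le (hF : IsLoss K β σ B L F) (w v : V n H) :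
    F (w + v) ≤ F w + ⟪gradient F w, v⟫ + β * ‖v‖ ^ 2 := by
  obtain ⟨W, hW, -, h, -⟩ := hF.exists_expansion
  rw [h]
  linarith [hW v]

/-- Both sides are the symmetric Hessian form of F evaluated at w - w' and a - b. Exchanging the two
increments replaces a smoothness estimate by the bound L on two gradients. -/
theorem IsLoss.inner_gradient_sub_comm (hF : IsLoss K β σ B L F) (w w' a b : V n H) :
    ⟪gradient F w - gradient F w', a - b⟫ = ⟪gradient F a - gradient F b, w - w'⟫ := by
  obtain ⟨W, -, -, -, h⟩ := hF.exists_expansion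
  rw [h, h, add_comm]

theorem hasFDerivAt_comp_diag {F : V n H → ℝ} (hF : Differentiable ℝ F) (z : E n) :
    HasFDerivAt (unary F) ((fderiv ℝ F (diag H z)).comp (diagL n H)) z := by
  have h2 : HasFDerivAt (fun z => diag H z) (diagL n H) z :=
    ContinuousLinearMap.hasFDerivAt (diagL n H)
  have h1 : HasFDerivAt F (fderiv ℝ F (diag H z)) (diag H z) := (hF (diag H z)).hasFDerivAt
  exact HasFDerivAt.comp (g := F) (f := fun z => diag H z) z h1 h2

theorem IsLoss.inner_gradient_unary (hF : IsLoss K β σ B L F) (z v : E n) :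
    ⟪gradient (unary F) z, v⟫ = ⟪gradient F (diag H z), diag H v⟫ := by
  rw [gradient, InnerProductSpace.toDual_symm_apply, gradient, InnerProductSpace.toDual_symm_apply,
    (hasFDerivAt_comp_diag hF.differentiable z).fderiv]
  rfl

theorem IsLoss.unary_sub_le (hF : IsLoss K β σ B L F) {z z' : E n} (hz : z ∈ K) (hz' : z' ∈ K) :
    unary F z' - unary F z ≤
      ⟪gradient F (diag H z'), diag H (z' - z)⟫ - σ / 2 * ‖z - z'‖ ^ 2 := by
  have h := hF.strongly_convex z hz z' hz'
  rw [hF.inner_gradient_unary, ← neg_sub z' z, ← diagL_apply (-(z' - z)), map_neg,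
    diagL_apply, inner_neg_right, norm_neg] at h
  rw [norm_sub_rev]
  linarith

theorem IsLoss.apply_sub_le (hF : IsLoss K β σ B L F) (hK : Convex ℝ K) {w w' : V n H}
    (hw : ∀ i, w i ∈ K) (hw' : ∀ i, w' i ∈ K) : F w - F w' ≤ L * ‖w - w'‖ := by
  have hconv : Convex ℝ {w : V n H | ∀ i, w i ∈ K} := by
    intro a ha b hb p q hp hq hpq i
    exact hK (ha i) (hb i) hp hq hpq
  have := hconv.norm_image_sub_le_of_norm_fderiv_le (f := F) (C := L)
    (fun y _ => hF.differentiable y) (fun y hy => ?_) hw' hw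
  · exact (le_abs_self _).trans this
  · have := hF.gradient_bound y hy
    rwa [gradient, LinearIsometryEquiv.norm_map] at this

/-- Strong convexity at the midpoint costs σ/4 ‖z - z'‖², while the values f(z) and f(z') sum to at
most 2B and f ≥ 0. So the diameter of K is at most √(8B/σ) whatever D is. -/
theorem IsLoss.mul_norm_sq_le (hF : IsLoss K β σ B L F) (hK : Convex ℝ K) {z z' : E n}
    (hz : z ∈ K) (hz' : z' ∈ K) : σ * ‖z - z'‖ ^ 2 ≤ 8 * B := by
  set m := (1 / 2 : ℝ) • z + (1 / 2 : ℝ) • z'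
  have hm : m ∈ K := hK hz hz' (by norm_num) (by norm_num) (by norm_num)
  have h1 := hF.strongly_convex z hz m hm
  have h2 := hF.strongly_convex z' hz' m hm
  have e1 : z - m = (1 / 2 : ℝ) • (z - z') := by
    simp only [m]; module
  have e2 : z' - m = -((1 / 2 : ℝ) • (z - z')) := by
    simp only [m]; module
  have h3 : 0 ≤ unary F m := hF.nonneg _ fun _ => hm
  have h4 : unary F z ≤ B := hF.bounded _ fun _ => hz
  have h5 : unary F z' ≤ B := hF.bounded _ fun _ => hz'
  rw [e1] at h1
  rw [e2, inner_neg_right, norm_neg] at h2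
  have h6 : ‖(1 / 2 : ℝ) • (z - z')‖ ^ 2 = 1 / 4 * ‖z - z'‖ ^ 2 := by
    rw [norm_smul, mul_pow]; norm_num
  rw [h6] at h1 h2
  linarith

/-- Compare the second-order terms of f between two distinct points of K: at least σ/2 by strong
convexity, at most β times the squared norm H‖·‖² of the constant tuple. -/
theorem IsLoss.le_two_mul (hF : IsLoss K β σ B L F) (hn : 1 ≤ n) (hK : IsConstraintSet K D) :
    σ ≤ 2 * H * β := by
  obtain ⟨z, hz⟩ := hK.interior_nonempty
  have : Nonempty (Fin n) := ⟨⟨0, hn⟩⟩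
  obtain ⟨z', hz', hne⟩ : ∃ z' ∈ K, z' ≠ z := by
    obtain ⟨h, hh⟩ := exists_ne (0 : E n)
    have hc : Tendsto (fun s : ℝ => z + s • h) (𝓝[≠] 0) (𝓝 z) := by
      have : Tendsto (fun s : ℝ => z + s • h) (𝓝 0) (𝓝 (z + (0 : ℝ) • h)) :=
        (by fun_prop : Continuous fun s : ℝ => z + s • h).tendsto 0
      rw [zero_smul, add_zero] at this
      exact this.mono_left nhdsWithin_le_nhds
    obtain ⟨s, hs1, hs2⟩ := ((hc.eventually (isOpen_interior.mem_nhds hz)).and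
      self_mem_nhdsWithin).exists
    exact ⟨_, interior_subset hs1, by simpa [hh] using hs2⟩
  obtain ⟨W, hW, -, h, -⟩ := hF.exists_expansion
  have h1 := hF.strongly_convex z' hz' z (interior_subset hz)
  rw [hF.inner_gradient_unary] at h1
  have h2 := h (diag H z) (diag H (z' - z))
  have h3 := hW (diag H (z' - z))
  rw [norm_diag_sq] at h3
  have e1 : diag H z + diag H (z' - z) = diag H z' := by rw [diag_sub]; abel
  rw [e1] at h2
  have hp : 0 < ‖z' - z‖ ^ 2 := pow_pos (norm_pos_iff.2 (sub_ne_zero.2 hne)) 2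
  simp only [unary] at h1
  have h4 : σ / 2 * ‖z' - z‖ ^ 2 ≤ β * H * ‖z' - z‖ ^ 2 := by linarith
  have := le_of_mul_le_mul_right h4 hp
  linarith

/-- The regret of one round in terms of the linearized losses; only the gradient bound, not the
smoothness, controls the delayed arguments. -/
theorem IsLoss.round_regret_le (hF : IsLoss K β σ B L F) (hK : Convex ℝ K) {w : V n H}
    (hw : ∀ i, w i ∈ K) {z x : E n} (hz : z ∈ K) (hx : x ∈ K) (v : V n H) :
    F (w + v) - unary F x ≤ ⟪gradient F w, v⟫ + β * ‖v‖ ^ 2 + 3 * L * ‖w - diag H z‖ +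
      ⟪gradient F w, diag H (z - x)⟫ - σ / 2 * ‖x - z‖ ^ 2 := by
  have h1 := hF.apply_add_le w v
  have h2 := hF.apply_sub_le hK hw (w' := diag H z) (fun _ => hz)
  have h3 := hF.unary_sub_le hx hz
  have h4 : ⟪gradient F (diag H z) - gradient F w, diag H (z - x)⟫ ≤ 2 * L * ‖w - diag H z‖ := by
    rw [diag_sub, hF.inner_gradient_sub_comm]
    refine (real_inner_le_norm _ _).trans ?_
    rw [norm_sub_rev (diag H z) w]
    gcongr
    have a1 := hF.gradient_bound (diag H z) (fun _ => hz)
    have a2 := hF.gradient_bound (diag H x) (fun _ => hx)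
    linarith [norm_sub_le (gradient F (diag H z)) (gradient F (diag H x))]
  rw [inner_sub_left] at h4
  simp only [unary] at h3 ⊢
  linarith

end Loss

end EBCOM

namespace EBCOM

/-! ### Stability of consecutive leaders. -/

section Stability

variable {n H T : ℕ} {K : Set (E n)} {R : E n → ℝ} {ν D η σ β B L : ℝ} {u : ℕ → E n}
  {F : ℕ → V n H → ℝ}

theorem hessForm_le_exp_chain (hK : IsConstraintSet K D) (hR : IsSelfConcordantBarrier K R ν)
    {z : ℕ → E n} (hz : ∀ j, z j ∈ interior K) {s : ℝ} (hs : s ≤ 1 / 2) {a b : ℕ} (hab : a ≤ b)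
    (hstep : ∀ j, a ≤ j → j < b → localNorm R (z j) (z (j + 1) - z j) ≤ s) (h : E n) :
    hessForm R (z b) h ≤ Real.exp (8 * s * (b - a : ℝ)) * hessForm R (z a) h ∧
      hessForm R (z a) h ≤ Real.exp (8 * s * (b - a : ℝ)) * hessForm R (z b) h := by
  induction b, hab using Nat.le_induction with
  | base => simp
  | succ b hab ih =>
    obtain ⟨ih1, ih2⟩ := ih fun j hj1 hj2 => hstep j hj1 (hj2.trans b.lt_succ_self)
    have hb := hstep b hab b.lt_succ_self
    obtain ⟨h1, h2⟩ := hessForm_le_exp_mul hK hR (hz b) (hz (b + 1)) (hb.trans hs) h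
    have he : Real.exp (8 * localNorm R (z b) (z (b + 1) - z b)) ≤ Real.exp (8 * s) :=
      Real.exp_le_exp.2 (by linarith)
    have e1 : Real.exp (8 * s * ((b + 1 : ℕ) - a : ℝ)) =
        Real.exp (8 * s) * Real.exp (8 * s * (b - a : ℝ)) := by
      rw [← Real.exp_add]; congr 1; push_cast; ring
    have p0 := hessForm_nonneg hK hR (hz b) h
    have p1 := hessForm_nonneg hK hR (hz (b + 1)) h
    rw [e1]
    constructor
    · calc hessForm R (z (b + 1)) h ≤ Real.exp (8 * s) * hessForm R (z b) h :=
            h1.trans (mul_le_mul_of_nonneg_right he p0)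
        _ ≤ _ := by rw [mul_assoc]; gcongr
    · calc hessForm R (z a) h ≤ Real.exp (8 * s * (b - a : ℝ)) * hessForm R (z b) h := ih2
        _ ≤ Real.exp (8 * s * (b - a : ℝ)) * (Real.exp (8 * s) * hessForm R (z (b + 1)) h) := by
            gcongr; exact h2.trans (mul_le_mul_of_nonneg_right he p1)
        _ = _ := by ring

/-- One realization of the algorithm in the regime where the step size is small enough for the
iterates to be stable over two windows. -/
structure IsStableRun (K : Set (E n)) (R : E n → ℝ) (ν D η σ β B L : ℝ) (T : ℕ) (u : ℕ → E n)
    (F : ℕ → V n H → ℝ) : Prop where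
  constraintSet : IsConstraintSet K D
  barrier : IsSelfConcordantBarrier K R ν
  one_le_dim : 1 ≤ n
  one_le_memory : 1 ≤ H
  memory_le : H ≤ T
  step_pos : 0 < η
  curvature_pos : 0 < σ
  bound_pos : 0 < B
  norm_noise_le : ∀ t, ‖u t‖ ≤ 1
  loss : ∀ t ∈ Finset.Icc H T, IsLoss K β σ B L (F t)
  small : 16 * H * (20 * η * n * B * H) ≤ 1

/-- The squared norm `∇²R(x_{k+H})[h, h] + η σ (k + 1) ‖h‖²` in which the `k`-th step is measured. -/
noncomputable def stepForm (R : E n → ℝ) (η σ : ℝ) (x : ℕ → E n) (k : ℕ) (h : E n) : ℝ :=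
  hessForm R (x (k + H)) h + η * σ * (k + 1) * ‖h‖ ^ 2

theorem IsStableRun.mem_interior (hr : IsStableRun K R ν D η σ β B L T u F) (t : ℕ) :
    iterate K R η σ u F t ∈ interior K :=
  iterate_mem_interior hr.constraintSet hr.barrier hr.step_pos hr.one_le_memory t

theorem IsStableRun.window_play_mem (hr : IsStableRun K R ν D η σ β B L T u F) {t : ℕ}
    (ht : H ≤ t) (i : Fin H) :
    window H (play R η σ u (iterate K R η σ u F)) t i ∈ K :=
  played_mem hr.constraintSet hr.barrier hr.step_pos hr.curvature_pos hr.one_le_memory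
    (by have := hr.one_le_memory; omega) (hr.norm_noise_le _)

theorem IsStableRun.abs_loss_le (hr : IsStableRun K R ν D η σ β B L T u F) {t : ℕ}
    (ht : t ∈ Finset.Icc H T) :
    |F t (window H (play R η σ u (iterate K R η σ u F)) t)| ≤ B := by
  have hmem := hr.window_play_mem (Finset.mem_Icc.1 ht).1
  rw [abs_of_nonneg ((hr.loss t ht).nonneg _ hmem)]
  exact (hr.loss t ht).bounded _ hmem

theorem IsStableRun.stepForm_nonneg (hr : IsStableRun K R ν D η σ β B L T u F) (k : ℕ) (h : E n) :
    0 ≤ stepForm (H := H) R η σ (iterate K R η σ u F) k h := by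
  have h1 := hessForm_nonneg hr.constraintSet hr.barrier (hr.mem_interior (k + H)) h
  have h2 := hr.step_pos
  have h3 := hr.curvature_pos
  unfold stepForm
  positivity

theorem IsStableRun.stepBound_nonneg (hr : IsStableRun K R ν D η σ β B L T u F) :
    0 ≤ 20 * η * n * B * H := by
  have h2 := hr.step_pos
  have h3 := hr.bound_pos
  positivity

theorem IsStableRun.stepBound_le (hr : IsStableRun K R ν D η σ β B L T u F) :
    20 * η * n * B * H ≤ 1 / 16 := by
  have h1 : (1 : ℝ) ≤ H := by exact_mod_cast hr.one_le_memory
  have h2 := hr.small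
  have h3 := hr.stepBound_nonneg
  nlinarith

theorem IsStableRun.localNorm_le_sqrt_stepForm (hr : IsStableRun K R ν D η σ β B L T u F) (k : ℕ)
    (h : E n) : localNorm R (iterate K R η σ u F (k + H)) h ≤
      √(stepForm (H := H) R η σ (iterate K R η σ u F) k h) := by
  refine Real.sqrt_le_sqrt ?_
  have h2 := hr.step_pos
  have h3 := hr.curvature_pos
  have : 0 ≤ η * σ * (k + 1) * ‖h‖ ^ 2 := by positivity
  unfold stepForm
  linarith

theorem exp_one_le_four : Real.exp 1 ≤ 4 := by
  have := Real.exp_one_lt_d9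
  linarith

/-- Hessians at leaders at most two windows apart agree up to a factor `4`, provided the
intermediate steps are small. -/
theorem IsStableRun.hessForm_le_four_mul (hr : IsStableRun K R ν D η σ β B L T u F) {a b : ℕ}
    (hab : a ≤ b) (hab' : b ≤ a + 2 * H)
    (hstep : ∀ j, a ≤ j → j < b → √(stepForm (H := H) R η σ (iterate K R η σ u F) j
      (iterate K R η σ u F (j + 1 + H) - iterate K R η σ u F (j + H))) ≤ 20 * η * n * B * H)
    (h : E n) :
    hessForm R (iterate K R η σ u F (b + H)) h ≤
        4 * hessForm R (iterate K R η σ u F (a + H)) h ∧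
      hessForm R (iterate K R η σ u F (a + H)) h ≤
        4 * hessForm R (iterate K R η σ u F (b + H)) h := by
  have h1 := hessForm_le_exp_chain hr.constraintSet hr.barrier
    (z := fun k => iterate K R η σ u F (k + H)) (fun j => hr.mem_interior _)
    (hr.stepBound_le.trans (by norm_num)) hab
    (fun j hj1 hj2 => (hr.localNorm_le_sqrt_stepForm j _).trans (hstep j hj1 hj2)) h
  -- The exponent over at most 2H steps is 8 · 2H times the step bound, at most 1 by `small`.
  have h2 : Real.exp (8 * (20 * η * n * B * H) * (b - a : ℝ)) ≤ 4 := by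
    refine (Real.exp_le_exp.2 ?_).trans exp_one_le_four
    refine le_trans ?_ hr.small
    have : (b : ℝ) ≤ a + 2 * H := by exact_mod_cast hab'
    have h3 := hr.stepBound_nonneg
    nlinarith
  have pa := hessForm_nonneg hr.constraintSet hr.barrier (hr.mem_interior (a + H)) h
  have pb := hessForm_nonneg hr.constraintSet hr.barrier (hr.mem_interior (b + H)) h
  exact ⟨h1.1.trans (mul_le_mul_of_nonneg_right h2 pa),
    h1.2.trans (mul_le_mul_of_nonneg_right h2 pb)⟩

/-- Each A⁻¹ of the window is at most twice the current step norm, since its Hessian part agrees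
with the one at x_{k+H} up to a factor 4. The steps before k enter as hypotheses, so that the bound
can be used inside the induction on k. -/
theorem IsStableRun.abs_inner_gradEst_le (hr : IsStableRun K R ν D η σ β B L T u F) {k : ℕ}
    (hk : k < T)
    (hstep : ∀ j < k, √(stepForm (H := H) R η σ (iterate K R η σ u F) j
      (iterate K R η σ u F (j + 1 + H) - iterate K R η σ u F (j + H))) ≤ 20 * η * n * B * H)
    (h : E n) :
    |⟪gradEst R η σ u F (iterate K R η σ u F) (k + 1), h⟫| ≤
      2 * n * B * H * √(stepForm (H := H) R η σ (iterate K R η σ u F) k h) := by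
  set x := iterate K R η σ u F with hx
  set q := √(stepForm (H := H) R η σ x k h)
  have hq : 0 ≤ q := Real.sqrt_nonneg _
  have hB := hr.bound_pos
  have hησ : 0 < η * σ := mul_pos hr.step_pos hr.curvature_pos
  unfold gradEst
  split_ifs with hkH
  · rw [inner_zero_left, abs_zero]; positivity
  rw [real_inner_smul_left, sum_inner, abs_mul, abs_mul, Nat.abs_cast]
  have h1 := hr.abs_loss_le (t := k + 1) (Finset.mem_Icc.2 ⟨by omega, by omega⟩)
  have h2 : ∀ i ∈ Finset.range H,
      |⟪act (ellipsoid R η σ x (k + 1 - i))⁻¹ (u (k + 1 - i)), h⟫| ≤ 2 * q := by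
    intro i hi
    rw [Finset.mem_range] at hi
    rw [inner_act_ellipsoid_inv]
    refine (abs_real_inner_le_norm _ _).trans ?_
    have hu := hr.norm_noise_le (k + 1 - i)
    have hA : ‖act (ellipsoid R η σ x (k + 1 - i))⁻¹ h‖ ≤ 2 * q := by
      refine le_of_sq_le_sq ?_ (by positivity)
      rw [norm_act_ellipsoid_inv_sq hr.constraintSet hr.barrier hησ.le (hr.mem_interior _),
        mul_pow, Real.sq_sqrt (hr.stepForm_nonneg k h)]
      -- The iterate at time k + 1 - i is the leader of index k + 1 - i - H, fewer than 2H places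
      -- behind index k.
      have h3 := (hr.hessForm_le_four_mul (a := k + 1 - i - H) (b := k) (by omega) (by omega)
        (fun j _ hj => hstep j hj) h).2
      rw [← hx] at h3
      rw [iterate_eq_sub (k + 1 - i), ← hx]
      have h4 : ((k + 1 - i : ℕ) : ℝ) ≤ k + 1 := by
        exact_mod_cast (Nat.sub_le (k + 1) i)
      have h5 : η * σ * ((k + 1 - i : ℕ) : ℝ) * ‖h‖ ^ 2 ≤ η * σ * (k + 1) * ‖h‖ ^ 2 := by gcongr
      have h6 : 0 ≤ η * σ * (k + 1) * ‖h‖ ^ 2 := by positivity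
      unfold stepForm
      linarith
    calc _ ≤ 1 * (2 * q) := by gcongr
      _ = 2 * q := one_mul _
  calc _ ≤ n * B * ∑ i ∈ Finset.range H, 2 * q := by
        gcongr
        exact (Finset.abs_sum_le_sum_abs _ _).trans (Finset.sum_le_sum h2)
    _ = 2 * n * B * H * q := by
        rw [Finset.sum_const, Finset.card_range, nsmul_eq_mul]; ring

theorem IsConstraintSet.of_norm_sub_le (hK : IsConstraintSet K D) {D' : ℝ}
    (h : ∀ z ∈ K, ∀ z' ∈ K, ‖z - z'‖ ≤ D') : IsConstraintSet K D' :=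
  ⟨hK.convex, hK.isClosed, hK.isBounded, hK.interior_nonempty, h⟩

theorem IsStableRun.mul_norm_sq_le (hr : IsStableRun K R ν D η σ β B L T u F) {z z' : E n}
    (hz : z ∈ K) (hz' : z' ∈ K) : σ * ‖z - z'‖ ^ 2 ≤ 8 * B :=
  (hr.loss T (Finset.mem_Icc.2 ⟨hr.memory_le, le_rfl⟩)).mul_norm_sq_le hr.constraintSet.convex hz hz'

/-- Use √(8B/σ) as the diameter twice, for ‖z - z'‖ and for comparing ‖h‖ with its local norm; the
two roots cancel σ. -/
theorem IsStableRun.mul_abs_inner_le (hr : IsStableRun K R ν D η σ β B L T u F) {x z z' : E n}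
    (hx : x ∈ interior K) (hz : z ∈ K) (hz' : z' ∈ K) (h : E n) :
    σ * |⟪z - z', h⟫| ≤ 8 * B * localNorm R x h := by
  have hσ := hr.curvature_pos
  have hB := hr.bound_pos
  have hd : ∀ z ∈ K, ∀ z' ∈ K, ‖z - z'‖ ≤ √(8 * B / σ) := by
    intro z hz z' hz'
    refine Real.le_sqrt_of_sq_le ?_
    rw [le_div_iff₀ hσ, mul_comm]
    exact hr.mul_norm_sq_le hz hz'
  have h1 := norm_le_mul_localNorm (hr.constraintSet.of_norm_sub_le hd) hr.barrier hx h
  have h2 := localNorm_nonneg R x h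
  calc σ * |⟪z - z', h⟫| ≤ σ * (‖z - z'‖ * ‖h‖) := by
        gcongr; exact abs_real_inner_le_norm _ _
    _ ≤ σ * (√(8 * B / σ) * (√(8 * B / σ) * localNorm R x h)) := by
        gcongr; exact hd z hz z' hz'
    _ = σ * (√(8 * B / σ) * √(8 * B / σ)) * localNorm R x h := by ring
    _ = 8 * B * localNorm R x h := by
        rw [Real.mul_self_sqrt (by positivity)]; field_simp

/-- Every step of the leader is small in the local norm. -/
theorem IsStableRun.step_le (hr : IsStableRun K R ν D η σ β B L T u F) {k : ℕ} (hk : k < T) :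
    √(stepForm (H := H) R η σ (iterate K R η σ u F) k
      (iterate K R η σ u F (k + 1 + H) - iterate K R η σ u F (k + H))) ≤ 20 * η * n * B * H := by
  induction k using Nat.strong_induction_on with
  | _ k ih =>
  have hstep := fun j (hj : j < k) => ih j hj (hj.trans hk)
  have hg := hr.abs_inner_gradEst_le hk hstep
  set x := iterate K R η σ u F with hx
  set g := gradEst R η σ u F x with hgdef
  set e := x (k + 1 + H) - x (k + H) with he
  set ρ := √(stepForm (H := H) R η σ x k e) with hρ
  have hρ0 : 0 ≤ ρ := Real.sqrt_nonneg _
  have hησ : 0 < η * σ := mul_pos hr.step_pos hr.curvature_pos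
  have hη := hr.step_pos
  have hB := hr.bound_pos
  have hρ2 : ρ ^ 2 = hessForm R (x (k + H)) e + η * σ * (k + 1) * ‖e‖ ^ 2 :=
    Real.sq_sqrt (hr.stepForm_nonneg k e)
  have s0 := (iterate_add_spec (u := u) (F := F) (σ := σ) hr.constraintSet hr.barrier hη
    hr.one_le_memory k).2.2.eq_zero e
  have s1 := (iterate_add_spec (u := u) (F := F) (σ := σ) hr.constraintSet hr.barrier hη
    hr.one_le_memory (k + 1)).2.2.eq_zero e
  rw [← hx, ← hgdef] at s0 s1
  rw [Finset.sum_Icc_succ_top (by omega), inner_add_left, inner_sub_left (g (k + 1)),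
    real_inner_smul_left] at s1
  have h1 := div_one_add_le_fderiv_sub hr.constraintSet hr.barrier (hr.mem_interior (k + H))
    (hr.mem_interior (k + 1 + H))
  rw [← hx, ← he] at h1
  have hr0 := localNorm_nonneg R (x (k + H)) e
  have hrρ : localNorm R (x (k + H)) e ≤ ρ := hr.localNorm_le_sqrt_stepForm k e
  -- Monotonicity of ∇R in the form r²/(1 + r), with the quadratic regularizer added, gives the same
  -- lower bound in the full step norm.
  have h2 : ρ ^ 2 / (1 + ρ) ≤ fderiv ℝ R (x (k + 1 + H)) e - fderiv ℝ R (x (k + H)) e +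
      η * σ * (k + 1) * ‖e‖ ^ 2 := by
    have a1 : hessForm R (x (k + H)) e / (1 + ρ) ≤
        hessForm R (x (k + H)) e / (1 + localNorm R (x (k + H)) e) :=
      div_le_div_of_nonneg_left (hessForm_nonneg hr.constraintSet hr.barrier
        (hr.mem_interior (k + H)) e) (by linarith) (by linarith)
    have a2 : η * σ * (k + 1) * ‖e‖ ^ 2 / (1 + ρ) ≤ η * σ * (k + 1) * ‖e‖ ^ 2 :=
      div_le_self (by positivity) (by linarith)
    rw [hρ2, add_div]
    linarith
  have e2 : ⟪x (k + 1 + H), e⟫ = ⟪x (k + H), e⟫ + ‖e‖ ^ 2 := by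
    rw [← real_inner_self_eq_norm_sq, ← inner_add_left, he]; congr 1; abel
  -- Difference of the stationarity conditions of consecutive leaders. The last term appears because
  -- the new quadratic is centred at x_{k+1}, not at the current leader x_{k+H}.
  have h3 : fderiv ℝ R (x (k + 1 + H)) e - fderiv ℝ R (x (k + H)) e +
      η * σ * (k + 1) * ‖e‖ ^ 2 = -η * ⟪g (k + 1), e⟫ -
        η * (σ * ⟪x (k + H) - x (k + 1), e⟫) := by
    rw [e2] at s1
    rw [inner_sub_left]
    push_cast at s1
    have a1 : η * (1 / η) = 1 := by field_simp
    linear_combination η * s1 - η * s0 -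
      (fderiv ℝ R (x (k + 1 + H)) e - fderiv ℝ R (x (k + H)) e) * a1
  have h4 := hr.mul_abs_inner_le (hr.mem_interior (k + H)) (interior_subset
    (hr.mem_interior (k + H))) (interior_subset (hr.mem_interior (k + 1))) e
  rw [← hx] at h4
  -- The estimator contributes 2ηnBH and the displaced centre 8ηB ≤ 8ηnBH, together half of the
  -- claimed bound.
  have h5 : ρ ^ 2 / (1 + ρ) ≤ (20 * η * n * B * H) / 2 * ρ := by
    refine h2.trans (h3.le.trans ?_)
    have b1 : -η * ⟪g (k + 1), e⟫ ≤ η * (2 * n * B * H * ρ) := by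
      rw [neg_mul, ← mul_neg]
      exact mul_le_mul_of_nonneg_left ((neg_le_abs _).trans (hg e)) hη.le
    have b2 : -(η * (σ * ⟪x (k + H) - x (k + 1), e⟫)) ≤ η * (8 * B * ρ) := by
      rw [← mul_neg, ← mul_neg]
      refine mul_le_mul_of_nonneg_left ?_ hη.le
      refine le_trans (mul_le_mul_of_nonneg_left (neg_le_abs _) hr.curvature_pos.le) (h4.trans ?_)
      gcongr
    have b3 : η * (8 * B * ρ) ≤ η * (8 * (n * B * H) * ρ) := by
      have hn : (1 : ℝ) ≤ n := by exact_mod_cast hr.one_le_dim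
      have hH : (1 : ℝ) ≤ H := by exact_mod_cast hr.one_le_memory
      gcongr
      calc B = 1 * B * 1 := by ring
        _ ≤ n * B * H := by gcongr
    linarith
  rw [div_le_iff₀ (by linarith)] at h5
  by_cases hρz : ρ = 0
  · rw [hρz]; exact hr.stepBound_nonneg
  have hρp : 0 < ρ := lt_of_le_of_ne hρ0 (Ne.symm hρz)
  have h6 : ρ ≤ (20 * η * n * B * H) / 2 * (1 + ρ) := by
    refine le_of_mul_le_mul_right ?_ hρp
    linarith
  -- With s the step bound, ρ ≤ s/2 · (1 + ρ) and s ≤ 1/16 give ρ ≤ s.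
  have := hr.stepBound_le
  nlinarith

end Stability

end EBCOM

namespace EBCOM

/-! ### Regret along one realization. -/

section DeterministicRegret

variable {n H T : ℕ} {K : Set (E n)} {R : E n → ℝ} {ν D η σ β B L : ℝ} {u : ℕ → E n}
  {F : ℕ → V n H → ℝ}

theorem IsConstraintSet.diam_nonneg (hK : IsConstraintSet K D) : 0 ≤ D := by
  obtain ⟨x, hx⟩ := hK.interior_nonempty
  simpa using hK.diam_le x (interior_subset hx) x (interior_subset hx)

theorem IsStableRun.norm_step_le (hr : IsStableRun K R ν D η σ β B L T u F) {k : ℕ} (hk : k < T) :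
    ‖iterate K R η σ u F (k + 1 + H) - iterate K R η σ u F (k + H)‖ ≤
      D * (20 * η * n * B * H) := by
  refine (norm_le_mul_localNorm hr.constraintSet hr.barrier (hr.mem_interior (k + H)) _).trans ?_
  have := hr.constraintSet.diam_nonneg
  gcongr
  exact (hr.localNorm_le_sqrt_stepForm k _).trans (hr.step_le hk)

theorem IsStableRun.norm_sub_le (hr : IsStableRun K R ν D η σ β B L T u F) {a b : ℕ} (hab : a ≤ b)
    (hb : b ≤ T) :
    ‖iterate K R η σ u F (a + H) - iterate K R η σ u F (b + H)‖ ≤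
      (b - a : ℝ) * (D * (20 * η * n * B * H)) := by
  induction b, hab using Nat.le_induction with
  | base => simp
  | succ b hab ih =>
    have h1 := ih (by omega)
    have h2 := hr.norm_step_le (k := b) (by omega)
    rw [norm_sub_rev] at h2
    refine (norm_sub_le_norm_sub_add_norm_sub _ (iterate K R η σ u F (b + H)) _).trans ?_
    push_cast
    linarith

/-- The window of the iterates deviates little from the constant window. -/
theorem IsStableRun.norm_window_sub_diag_le (hr : IsStableRun K R ν D η σ β B L T u F) {t : ℕ}
    (ht : t ≤ T) :
    ‖window H (iterate K R η σ u F) t - diag H (iterate K R η σ u F t)‖ ≤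
      H ^ 2 * (D * (20 * η * n * B * H)) := by
  have hH : (1 : ℝ) ≤ H := by exact_mod_cast hr.one_le_memory
  have hc : 0 ≤ D * (20 * η * n * B * H) :=
    mul_nonneg hr.constraintSet.diam_nonneg hr.stepBound_nonneg
  have hH1 := hr.one_le_memory
  refine le_of_sq_le_sq ?_ (by positivity)
  rw [PiLp.norm_sq_eq_of_L2]
  have h1 : ∀ i : Fin H, ‖(window H (iterate K R η σ u F) t -
      diag H (iterate K R η σ u F t)) i‖ ^ 2 ≤ (H * (D * (20 * η * n * B * H))) ^ 2 := by
    intro i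
    have hi := i.2
    refine pow_le_pow_left₀ (norm_nonneg _) ?_ 2
    change ‖iterate K R η σ u F (t - (H - 1) + i) - iterate K R η σ u F t‖ ≤ _
    rw [iterate_eq_sub (t - (H - 1) + i), iterate_eq_sub t]
    rcases le_total (t - (H - 1) + i - H) (t - H) with hle | hle
    · refine (hr.norm_sub_le hle (by omega)).trans ?_
      gcongr
      have : t - H ≤ H + (t - (H - 1) + i - H) := by omega
      have : ((t - H : ℕ) : ℝ) ≤ H + (t - (H - 1) + i - H : ℕ) := by exact_mod_cast this
      linarith
    · have : t - (H - 1) + i - H = t - H := by omega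
      rw [this, sub_self, norm_zero]
      positivity
  calc _ ≤ ∑ _i : Fin H, (H * (D * (20 * η * n * B * H))) ^ 2 := Finset.sum_le_sum fun i _ => h1 i
    _ = H ^ 3 * (D * (20 * η * n * B * H)) ^ 2 := by simp; ring
    _ ≤ H ^ 4 * (D * (20 * η * n * B * H)) ^ 2 := by
        gcongr
        norm_num
    _ = _ := by ring

/-- The cost of the delay in the linear terms. -/
theorem IsStableRun.abs_inner_gradEst_sub_le (hr : IsStableRun K R ν D η σ β B L T u F) {t : ℕ}
    (ht : t ∈ Finset.Icc H T) :
    |⟪gradEst R η σ u F (iterate K R η σ u F) t,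
      iterate K R η σ u F t - iterate K R η σ u F (t + H)⟫| ≤
        4 * n * B * H ^ 3 * (20 * η * n * B * H) := by
  obtain ⟨htH, htT⟩ := Finset.mem_Icc.1 ht
  have hH1 := hr.one_le_memory
  have hB := hr.bound_pos
  have hησ : 0 < η * σ := mul_pos hr.step_pos hr.curvature_pos
  have hs := hr.stepBound_nonneg
  obtain ⟨k, rfl⟩ : ∃ k, t = k + 1 := ⟨t - 1, by omega⟩
  set x := iterate K R η σ u F with hx
  set s := 20 * η * n * B * H with hsdef
  have hH : (1 : ℝ) ≤ H := by exact_mod_cast hH1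
  have hg := hr.abs_inner_gradEst_le (k := k) (by omega) (fun j hj => hr.step_le (by omega))
  rw [← hx] at hg
  have hstep : ∀ j, k + 1 - H ≤ j → j < k + 1 →
      |⟪gradEst R η σ u F x (k + 1), x (j + H) - x (j + 1 + H)⟫| ≤
        2 * n * B * H * (2 * H * s) := by
    intro j hj1 hj2
    refine (hg _).trans ?_
    gcongr
    have h0 := hr.step_le (k := j) (by omega)
    rw [← hx, ← hsdef] at h0
    have h0' := pow_le_pow_left₀ (Real.sqrt_nonneg _) h0 2
    rw [hx, Real.sq_sqrt (hr.stepForm_nonneg j _), ← hx] at h0'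
    refine Real.sqrt_le_iff.2 ⟨by positivity, ?_⟩
    have h1 := (hr.hessForm_le_four_mul (a := j) (b := k) (by omega) (by omega)
      (fun i _ hi => hr.step_le (by omega)) (x (j + 1 + H) - x (j + H))).1
    rw [← neg_sub (x (j + 1 + H)), stepForm, hessForm_neg, norm_neg]
    rw [← hx] at h1
    rw [stepForm] at h0'
    set e := x (j + 1 + H) - x (j + H)
    have p := hessForm_nonneg hr.constraintSet hr.barrier (hr.mem_interior (j + H)) e
    rw [← hx] at p
    -- Passing from the norm of step j to that of step k multiplies the Hessian part by at most 4
    -- and the quadratic part by at most H, hence the norm by at most 2H.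
    have h2 : ((k : ℝ) + 1) ≤ H * (j + 1) := by
      have h3 : k + 1 ≤ j + H := by omega
      have h3' : ((k : ℝ) + 1) ≤ j + H := by exact_mod_cast h3
      have : (j : ℝ) ≤ H * j := le_mul_of_one_le_left (by positivity) hH
      linarith
    have h4 : η * σ * ((k : ℝ) + 1) * ‖e‖ ^ 2 ≤ H * (η * σ * (j + 1) * ‖e‖ ^ 2) := by
      calc _ ≤ η * σ * (H * (j + 1)) * ‖e‖ ^ 2 := by gcongr
        _ = _ := by ring
    have h5 : 0 ≤ η * σ * ((j : ℝ) + 1) * ‖e‖ ^ 2 := by positivity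
    calc hessForm R (x (k + H)) e + η * σ * (k + 1) * ‖e‖ ^ 2
        ≤ 4 * H * hessForm R (x (j + H)) e + 4 * H * (η * σ * (j + 1) * ‖e‖ ^ 2) := by
          have := mul_le_mul_of_nonneg_right hH p
          have := mul_nonneg (by positivity : (0 : ℝ) ≤ H) h5
          linarith
      _ ≤ 4 * H * s ^ 2 := by
          rw [← mul_add]; gcongr
      _ ≤ 4 * (H * H) * s ^ 2 := by
          gcongr; exact le_mul_of_one_le_left (by positivity) hH
      _ = _ := by ring
  have hsum : ∀ b, k + 1 - H ≤ b → b ≤ k + 1 →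
      |⟪gradEst R η σ u F x (k + 1), x (k + 1 - H + H) - x (b + H)⟫| ≤
        ((b : ℝ) - (k + 1 - H : ℕ)) * (2 * n * B * H * (2 * H * s)) := by
    intro b hb
    induction b, hb using Nat.le_induction with
    | base => simp
    | succ b hb ih =>
      intro hbk
      have h1 := ih (by omega)
      have h2 := hstep b hb (by omega)
      rw [← sub_add_sub_cancel (x (k + 1 - H + H)) (x (b + H)), inner_add_right]
      refine (abs_add_le _ _).trans ?_
      push_cast
      linarith
  have h1 := hsum (k + 1) (by omega) le_rfl
  rw [hx, ← iterate_eq_sub, ← hx] at h1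
  refine h1.trans (le_of_eq ?_)
  rw [Nat.cast_sub htH]
  push_cast
  ring

/-- "Be the leader" for regularized objectives. -/
theorem be_the_leader {X : Type*} {S : Set X} {ψ : X → ℝ} {h : ℕ → X → ℝ} {z : ℕ → X}
    (hz : ∀ k, z k ∈ S)
    (hmin : ∀ k, IsMinOn (fun y => ∑ r ∈ Finset.Icc 1 k, h r y + ψ y) S (z k)) (k : ℕ) {y : X}
    (hy : y ∈ S) :
    ∑ r ∈ Finset.Icc 1 k, h r (z r) + ψ (z 0) ≤ ∑ r ∈ Finset.Icc 1 k, h r y + ψ y := by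
  refine le_trans ?_ (hmin k hy)
  induction k with
  | zero => simp
  | succ k ih =>
    simp only [Finset.sum_Icc_succ_top (Nat.le_add_left 1 k)]
    have := hmin k (hz (k + 1))
    simp only [Set.mem_ofPred_eq] at this
    linarith

theorem sum_Icc_split {f : ℕ → ℝ} (hH : 1 ≤ H) (hHT : H ≤ T) :
    ∑ r ∈ Finset.Icc 1 T, f r = ∑ r ∈ Finset.Ico 1 H, f r + ∑ r ∈ Finset.Icc H T, f r := by
  rw [← Finset.sum_union]
  · congr 1
    ext r
    simp only [Finset.mem_union, Finset.mem_Icc, Finset.mem_Ico]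
    omega
  · rw [Finset.disjoint_left]
    intro r
    simp only [Finset.mem_Icc, Finset.mem_Ico]
    omega

/-- The regret of the estimated linear losses. -/
theorem IsStableRun.sum_inner_gradEst_le (hr : IsStableRun K R ν D η σ β B L T u F) {y : E n}
    (hy : y ∈ interior K) :
    ∑ t ∈ Finset.Icc H T, ⟪gradEst R η σ u F (iterate K R η σ u F) t,
        iterate K R η σ u F t - y⟫ ≤
      ∑ t ∈ Finset.Icc H T, σ / 2 * ‖y - iterate K R η σ u F t‖ ^ 2 + 4 * B * H +
        (R y - R (iterate K R η σ u F H)) / η +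
        T * (4 * n * B * H ^ 3 * (20 * η * n * B * H)) := by
  have hH1 := hr.one_le_memory
  have hB := hr.bound_pos
  have hs := hr.stepBound_nonneg
  set x := iterate K R η σ u F with hx
  set g := gradEst R η σ u F x with hg
  set c := 4 * n * B * H ^ 3 * (20 * η * n * B * H) with hc
  have hc0 : 0 ≤ c := by positivity
  have hspec := fun k => iterate_add_spec (u := u) (F := F) (σ := σ) hr.constraintSet hr.barrier
    hr.step_pos hH1 k
  have hbtl := be_the_leader (S := interior K) (ψ := fun z => 1 / η * R z)
    (h := fun r z => ⟪g r, z⟫ + σ / 2 * ‖z - x r‖ ^ 2) (z := fun k => x (k + H))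
    (fun k => (hspec k).1) (fun k => (hspec k).2.1) T hy
  simp only [zero_add] at hbtl
  have h1 : ∀ t ∈ Finset.Icc 1 T, ⟪g t, x t - y⟫ ≤
      (⟪g t, x (t + H)⟫ + σ / 2 * ‖x (t + H) - x t‖ ^ 2) -
        (⟪g t, y⟫ + σ / 2 * ‖y - x t‖ ^ 2) + σ / 2 * ‖y - x t‖ ^ 2 +
        ⟪g t, x t - x (t + H)⟫ := by
    intro t _
    have := hr.curvature_pos
    have : 0 ≤ σ / 2 * ‖x (t + H) - x t‖ ^ 2 := by positivity
    rw [inner_sub_right, inner_sub_right]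
    linarith
  have h2 := Finset.sum_le_sum h1
  simp only [Finset.sum_add_distrib, Finset.sum_sub_distrib] at h2 hbtl
  have hg0 : ∀ t ∈ Finset.Ico 1 H, g t = 0 := by
    intro t ht
    rw [hg, gradEst, if_pos (Finset.mem_Ico.1 ht).2]
  rw [sum_Icc_split (f := fun t => ⟪g t, x t - y⟫) hH1 hr.memory_le,
    sum_Icc_split (f := fun t => ⟪g t, x t - x (t + H)⟫) hH1 hr.memory_le,
    Finset.sum_eq_zero (s := Finset.Ico 1 H) (f := fun t => ⟪g t, x t - y⟫)
      (fun t ht => by rw [hg0 t ht, inner_zero_left]),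
    Finset.sum_eq_zero (s := Finset.Ico 1 H) (f := fun t => ⟪g t, x t - x (t + H)⟫)
      (fun t ht => by rw [hg0 t ht, inner_zero_left]), zero_add, zero_add] at h2
  have h3 : ∑ t ∈ Finset.Icc H T, ⟪g t, x t - x (t + H)⟫ ≤ T * c := by
    refine (Finset.sum_le_card_nsmul _ _ c fun t ht =>
      (le_abs_self _).trans (hr.abs_inner_gradEst_sub_le ht)).trans ?_
    rw [nsmul_eq_mul, Nat.card_Icc]
    gcongr
    omega
  -- The rounds before H have no linear part, but their quadratic terms remain in the leader's
  -- objective; each costs at most 4B.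
  have h4 : ∑ t ∈ Finset.Icc 1 T, σ / 2 * ‖y - x t‖ ^ 2 ≤
      4 * B * H + ∑ t ∈ Finset.Icc H T, σ / 2 * ‖y - x t‖ ^ 2 := by
    rw [sum_Icc_split hH1 hr.memory_le]
    gcongr
    refine (Finset.sum_le_card_nsmul _ _ (4 * B) fun t _ => ?_).trans ?_
    · have := hr.mul_norm_sq_le (interior_subset hy) (interior_subset (hr.mem_interior t))
      rw [← hx] at this
      linarith
    · rw [nsmul_eq_mul, Nat.card_Ico, mul_comm]
      gcongr
      omega
  have h5 : (R y - R (x H)) / η = 1 / η * R y - 1 / η * R (x H) := by ring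
  rw [h5]
  linarith

/-- The block-diagonal action of the exploration ellipsoids on a window. -/
noncomputable def perturbation (R : E n → ℝ) (η σ : ℝ) (x : ℕ → E n) (t : ℕ) (v : V n H) : V n H :=
  WithLp.toLp 2 fun i : Fin H => act (ellipsoid R η σ x (t - (H - 1) + i)) (v i)

theorem window_play (R : E n → ℝ) (η σ : ℝ) (u x : ℕ → E n) (t : ℕ) :
    window H (play R η σ u x) t = window H x t + perturbation R η σ x t (window H u t) := rfl

theorem IsStableRun.norm_perturbation_sq_le (hr : IsStableRun K R ν D η σ β B L T u F) {t : ℕ}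
    (ht : H ≤ t) :
    ‖perturbation R η σ (iterate K R η σ u F) t (window H u t)‖ ^ 2 ≤
      (∑ i : Fin H, ((t - (H - 1) + i : ℕ) : ℝ)⁻¹) / (η * σ) := by
  have hησ : 0 < η * σ := mul_pos hr.step_pos hr.curvature_pos
  have hH := hr.one_le_memory
  rw [PiLp.norm_sq_eq_of_L2, Finset.sum_div]
  refine Finset.sum_le_sum fun i _ => ?_
  have h1 := norm_act_ellipsoid_sq_le hr.constraintSet hr.barrier hησ
    (t := t - (H - 1) + i) (by omega) (hr.mem_interior _) (u (t - (H - 1) + i))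
  refine h1.trans ?_
  have h2 : ‖u (t - (H - 1) + i)‖ ^ 2 ≤ 1 := pow_le_one₀ (norm_nonneg _) (hr.norm_noise_le _)
  have h3 : (0 : ℝ) < (t - (H - 1) + i : ℕ) := by
    have : 0 < t - (H - 1) + (i : ℕ) := by omega
    exact_mod_cast this
  calc _ ≤ 1 / (η * σ * ((t - (H - 1) + i : ℕ) : ℝ)) := by gcongr
    _ = _ := by field_simp

/-- For each fixed position in the window the times are distinct elements of {1, …, T}, so the sum
over t is at most a harmonic number. -/
theorem sum_window_inv_le (hH : 1 ≤ H) :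
    ∑ t ∈ Finset.Icc H T, ∑ i : Fin H, ((t - (H - 1) + i : ℕ) : ℝ)⁻¹ ≤
      H * (1 + Real.log T) := by
  rw [Finset.sum_comm]
  have h1 : ∀ i : Fin H, ∑ t ∈ Finset.Icc H T, ((t - (H - 1) + i : ℕ) : ℝ)⁻¹ ≤ 1 + Real.log T := by
    intro i
    have hi := i.2
    have h2 := harmonic_le_one_add_log T
    rw [harmonic_eq_sum_Icc] at h2
    push_cast at h2
    refine le_trans ?_ h2
    rw [← Finset.sum_image (f := fun s : ℕ => (s : ℝ)⁻¹) (g := fun t => t - (H - 1) + (i : ℕ))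
      (fun a ha b hb hab => ?_)]
    · refine Finset.sum_le_sum_of_subset_of_nonneg (fun s hs => ?_) fun s _ _ => by positivity
      rw [Finset.mem_image] at hs
      obtain ⟨t, ht, rfl⟩ := hs
      rw [Finset.mem_Icc] at ht ⊢
      omega
    · simp only [Finset.coe_Icc, Set.mem_Icc] at ha hb
      simp only at hab
      omega
  refine (Finset.sum_le_sum fun i _ => h1 i).trans (le_of_eq ?_)
  simp [mul_add]

/-- The regret along one realization, up to terms of mean zero. -/
theorem IsStableRun.regret_le (hr : IsStableRun K R ν D η σ β B L T u F) (hβ : 0 < β) (hL : 0 < L)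
    {y : E n} (hy : y ∈ interior K) :
    ∑ t ∈ Finset.Icc H T, (F t (window H (play R η σ u (iterate K R η σ u F)) t) -
        unary (F t) y) ≤
      ∑ t ∈ Finset.Icc H T,
        (⟪gradient (F t) (window H (iterate K R η σ u F) t),
            perturbation R η σ (iterate K R η σ u F) t (window H u t)⟫ +
          (⟪gradient (F t) (window H (iterate K R η σ u F) t),
              diag H (iterate K R η σ u F t - y)⟫ -
            ⟪gradEst R η σ u F (iterate K R η σ u F) t, iterate K R η σ u F t - y⟫)) +
      (β * (H * (1 + Real.log T)) / (η * σ) +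
        T * (3 * L * (H ^ 2 * (D * (20 * η * n * B * H)))) + 4 * B * H +
        (R y - R (iterate K R η σ u F H)) / η +
        T * (4 * n * B * H ^ 3 * (20 * η * n * B * H))) := by
  have hH1 := hr.one_le_memory
  have hησ : 0 < η * σ := mul_pos hr.step_pos hr.curvature_pos
  have hlin := hr.sum_inner_gradEst_le hy
  set x := iterate K R η σ u F with hx
  have hc : 0 ≤ D * (20 * η * n * B * H) :=
    mul_nonneg hr.constraintSet.diam_nonneg hr.stepBound_nonneg
  have h1 : ∀ t ∈ Finset.Icc H T, F t (window H (play R η σ u x) t) - unary (F t) y ≤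
      (⟪gradient (F t) (window H x t), perturbation R η σ x t (window H u t)⟫ +
        (⟪gradient (F t) (window H x t), diag H (x t - y)⟫ -
          ⟪gradEst R η σ u F x t, x t - y⟫)) +
      β * ((∑ i : Fin H, ((t - (H - 1) + i : ℕ) : ℝ)⁻¹) / (η * σ)) +
      3 * L * (H ^ 2 * (D * (20 * η * n * B * H))) +
      ⟪gradEst R η σ u F x t, x t - y⟫ - σ / 2 * ‖y - x t‖ ^ 2 := by
    intro t ht
    have ht' := Finset.mem_Icc.1 ht
    have h2 := (hr.loss t ht).round_regret_le hr.constraintSet.convex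
      (w := window H x t) (fun i => interior_subset (hr.mem_interior _))
      (interior_subset (hr.mem_interior t)) (interior_subset hy)
      (perturbation R η σ x t (window H u t))
    rw [← window_play, ← hx] at h2
    have h3 := mul_le_mul_of_nonneg_left (hr.norm_perturbation_sq_le ht'.1) hβ.le
    have h4 := mul_le_mul_of_nonneg_left (hr.norm_window_sub_diag_le ht'.2)
      (by positivity : 0 ≤ 3 * L)
    rw [← hx] at h3 h4
    linarith
  have h2 := Finset.sum_le_sum h1
  rw [Finset.sum_sub_distrib (f := fun t => _ + _ + _ + _), Finset.sum_add_distrib,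
    Finset.sum_add_distrib, Finset.sum_add_distrib, ← Finset.mul_sum, ← Finset.sum_div] at h2
  have h3 : β * ((∑ t ∈ Finset.Icc H T, ∑ i : Fin H, ((t - (H - 1) + i : ℕ) : ℝ)⁻¹) / (η * σ)) ≤
      β * (H * (1 + Real.log T)) / (η * σ) := by
    rw [mul_div_assoc]
    gcongr
    exact sum_window_inv_le hH1
  have h4 : ∑ _t ∈ Finset.Icc H T, 3 * L * (H ^ 2 * (D * (20 * η * n * B * H))) ≤
      T * (3 * L * (H ^ 2 * (D * (20 * η * n * B * H)))) := by
    rw [Finset.sum_const, nsmul_eq_mul, Nat.card_Icc]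
    gcongr
    omega
  -- The terms σ/2 ‖y - x_t‖² gained from strong convexity cancel those in the regret of the
  -- estimated losses.
  linarith

end DeterministicRegret

end EBCOM

namespace EBCOM

/-! ### Moments of the exploration noise. -/

section Sphere

open scoped Pointwise

variable {n : ℕ}

/-- The self-map of the unit sphere induced by a linear isometry. -/
noncomputable def sphereMap (e : E n ≃ₗᵢ[ℝ] E n) (v : Metric.sphere (0 : E n) 1) : Metric.sphere (0 : E n) 1 :=
  ⟨e v, by simp⟩

theorem continuous_sphereMap (e : E n ≃ₗᵢ[ℝ] E n) : Continuous (sphereMap e) :=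
  (e.continuous.comp continuous_subtype_val).subtype_mk _

/-- The surface measure of a set is the dimension times the volume of the cone over it, and a linear
isometry maps cones to cones preserving volume. -/
theorem map_sphereMap_toSphere (e : E n ≃ₗᵢ[ℝ] E n) :
    (volume : Measure (E n)).toSphere.map (sphereMap e) = (volume : Measure (E n)).toSphere := by
  ext s hs
  have hm := (continuous_sphereMap e).measurable
  rw [Measure.map_apply hm hs, Measure.toSphere_apply' _ (hm hs), Measure.toSphere_apply' _ hs]
  congr 1
  have h1 : Set.Ioo (0 : ℝ) 1 • ((↑) '' (sphereMap e ⁻¹' s) : Set (E n)) =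
      e ⁻¹' (Set.Ioo (0 : ℝ) 1 • ((↑) '' s : Set (E n))) := by
    ext z
    simp only [Set.mem_smul, Set.mem_image, Set.mem_preimage]
    constructor
    · rintro ⟨r, hr, _, ⟨v, hv, rfl⟩, rfl⟩
      exact ⟨r, hr, _, ⟨_, hv, rfl⟩, by simp [sphereMap]⟩
    · rintro ⟨r, hr, _, ⟨v, hv, rfl⟩, hz⟩
      refine ⟨r, hr, _, ⟨sphereMap e.symm v, ?_, rfl⟩, ?_⟩
      · have : sphereMap e (sphereMap e.symm v) = v := by
          ext1; simp [sphereMap]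
        rwa [this]
      · apply e.injective
        simp [sphereMap, hz]
  rw [h1, e.measurePreserving.measure_preimage_emb e.toHomeomorph.measurableEmbedding]

theorem map_sphereMap_uniformSphere (e : E n ≃ₗᵢ[ℝ] E n) :
    (uniformSphere n).map (sphereMap e) = uniformSphere n := by
  rw [uniformSphere, Measure.map_smul, map_sphereMap_toSphere]

theorem integral_comp_sphereMap (e : E n ≃ₗᵢ[ℝ] E n) {f : Metric.sphere (0 : E n) 1 → ℝ}
    (hf : Continuous f) :
    ∫ v, f (sphereMap e v) ∂(uniformSphere n) = ∫ v, f v ∂(uniformSphere n) := by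
  conv_rhs => rw [← map_sphereMap_uniformSphere e]
  rw [integral_map (continuous_sphereMap e).measurable.aemeasurable
    hf.measurable.aestronglyMeasurable]

theorem isProbabilityMeasure_uniformSphere (hn : 1 ≤ n) : IsProbabilityMeasure (uniformSphere n) := by
  have : Nonempty (Fin n) := ⟨⟨0, hn⟩⟩
  have : Nontrivial (E n) := inferInstance
  refine ⟨?_⟩
  rw [uniformSphere, Measure.smul_apply, smul_eq_mul]
  refine ENNReal.inv_mul_cancel ?_ (measure_ne_top _ _)
  rw [Ne, Measure.measure_univ_eq_zero]
  exact Measure.toSphere_ne_zero _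

theorem continuous_sphere_apply (i : Fin n) :
    Continuous fun v : Metric.sphere (0 : E n) 1 => (v : E n) i :=
  (EuclideanSpace.proj i : E n →L[ℝ] ℝ).continuous.comp continuous_subtype_val

theorem continuous_sphere_apply_mul (i j : Fin n) :
    Continuous fun v : Metric.sphere (0 : E n) 1 => (v : E n) i * (v : E n) j :=
  (continuous_sphere_apply i).mul (continuous_sphere_apply j)

theorem abs_sphere_apply_le (v : Metric.sphere (0 : E n) 1) (i : Fin n) : |(v : E n) i| ≤ 1 := by
  have h := PiLp.norm_apply_le (v : E n) i
  rwa [norm_eq_of_mem_sphere] at h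

/-- The covariance of the uniform distribution on the sphere is `I / n`. -/
theorem integral_mul_uniformSphere (hn : 1 ≤ n) (i j : Fin n) :
    ∫ v, (v : E n) i * (v : E n) j ∂(uniformSphere n) = if i = j then (n : ℝ)⁻¹ else 0 := by
  have hprob := isProbabilityMeasure_uniformSphere hn
  have hc := continuous_sphere_apply_mul (n := n)
  split_ifs with hij
  · subst hij
    -- Swapping coordinates shows that all second moments are equal; they sum to the mean of ‖v‖² =
    -- 1.
    have hsq : ∀ k : Fin n, ∫ v, (v : E n) k * (v : E n) k ∂(uniformSphere n) =
        ∫ v, (v : E n) i * (v : E n) i ∂(uniformSphere n) := by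
      intro k
      rw [← integral_comp_sphereMap (LinearIsometryEquiv.piLpCongrLeft 2 ℝ ℝ (Equiv.swap i k))
        (hc i i)]
      simp [sphereMap, Equiv.piCongrLeft']
    have hsum : ∑ k : Fin n, ∫ v, (v : E n) k * (v : E n) k ∂(uniformSphere n) = 1 := by
      rw [← integral_finsetSum]
      · have : ∀ v : Metric.sphere (0 : E n) 1, ∑ k : Fin n, (v : E n) k * (v : E n) k = 1 := by
          intro v
          have h1 := EuclideanSpace.norm_sq_eq (v : E n)
          rw [norm_eq_of_mem_sphere] at h1
          simpa [sq] using h1.symm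
        simp [this]
      · intro k _
        refine Integrable.of_bound (hc k k).measurable.aestronglyMeasurable 1
          (Eventually.of_forall fun v => ?_)
        rw [norm_mul]
        exact mul_le_one₀ (abs_sphere_apply_le v k) (norm_nonneg _) (abs_sphere_apply_le v k)
    rw [Finset.sum_congr rfl fun k _ => hsq k] at hsum
    simp only [Finset.sum_const, Finset.card_univ, Fintype.card_fin, nsmul_eq_mul] at hsum
    exact eq_inv_of_mul_eq_one_right hsum
  -- Reflecting the single coordinate i changes the sign of the integrand.
  · have h1 := integral_comp_sphereMap (LinearIsometryEquiv.piLpCongrRight 2 fun k : Fin n =>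
      if k = i then LinearIsometryEquiv.neg ℝ else LinearIsometryEquiv.refl ℝ ℝ) (hc i j)
    simp [sphereMap, integral_neg, Ne.symm hij] at h1
    linarith

theorem map_neg_uniformSphere : (uniformSphere n).map (fun v => -v) = uniformSphere n :=
  map_sphereMap_uniformSphere (LinearIsometryEquiv.neg ℝ)

variable {Ω : Type*} [MeasurableSpace Ω] {P : Measure Ω} {T : ℕ}
  {u : ℕ → Ω → Metric.sphere (0 : E n) 1}

/-- The joint law is a product of symmetric laws, hence invariant under changing all signs at once.
This kills first and third moments, also when time indices coincide. -/
theorem IsExplorationNoise.integral_comp_neg (hu : IsExplorationNoise P T u)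
    [IsProbabilityMeasure P] {f : (Finset.Icc 1 T → Metric.sphere (0 : E n) 1) → ℝ}
    (hf : Measurable f) :
    ∫ ω, f (fun t => -u t ω) ∂P = ∫ ω, f (fun t => u t ω) ∂P := by
  have hm : ∀ t : Finset.Icc 1 T, Measurable (u t) := fun t => hu.measurable t t.2
  have hm' : ∀ t : Finset.Icc 1 T, Measurable fun ω => -u t ω := fun t =>
    continuous_neg.measurable.comp (hm t)
  have h1 := (iIndepFun_iff_map_fun_eq_pi_map (fun t => (hm t).aemeasurable)).1 hu.indep
  have h2 := (iIndepFun_iff_map_fun_eq_pi_map (fun t => (hm' t).aemeasurable)).1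
    (hu.indep.comp (fun _ v => -v) fun _ => continuous_neg.measurable)
  have h3 : ∀ t : Finset.Icc 1 T, P.map (fun ω => -u t ω) = P.map (u t) := by
    intro t
    rw [hu.law t t.2]
    conv_rhs => rw [← map_neg_uniformSphere, ← hu.law t t.2]
    rw [Measure.map_map continuous_neg.measurable (hm t)]
    rfl
  simp only [h3] at h2
  rw [← h1] at h2
  have e1 := integral_map (μ := P) (measurable_pi_lambda _ hm').aemeasurable
    (f := f) hf.aestronglyMeasurable
  have e2 := integral_map (μ := P) (measurable_pi_lambda _ hm).aemeasurable
    (f := f) hf.aestronglyMeasurable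
  rw [← e1, ← e2, h2]

theorem IsExplorationNoise.integral_eq_zero_of_odd (hu : IsExplorationNoise P T u)
    [IsProbabilityMeasure P] {f : (Finset.Icc 1 T → Metric.sphere (0 : E n) 1) → ℝ}
    (hf : Measurable f) (hodd : ∀ v, f (fun t => -v t) = -f v) :
    ∫ ω, f (fun t => u t ω) ∂P = 0 := by
  have h := hu.integral_comp_neg hf
  simp only [hodd (fun t => u t _), integral_neg] at h
  linarith

/-- Second moments of the noises. -/
theorem IsExplorationNoise.integral_mul (hn : 1 ≤ n) (hu : IsExplorationNoise P T u)
    [IsProbabilityMeasure P] {s s' : ℕ} (hs : s ∈ Finset.Icc 1 T) (hs' : s' ∈ Finset.Icc 1 T)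
    (i j : Fin n) :
    ∫ ω, (u s ω : E n) i * (u s' ω : E n) j ∂P = if s = s' ∧ i = j then (n : ℝ)⁻¹ else 0 := by
  by_cases hss : s = s'
  · subst hss
    simp only [true_and]
    rw [← integral_mul_uniformSphere hn, ← hu.law s hs, integral_map (hu.measurable s hs).aemeasurable
      (continuous_sphere_apply_mul i j).measurable.aestronglyMeasurable]
  · rw [if_neg (by tauto)]
    have hind : IndepFun (u s) (u s') P :=
      hu.indep.indepFun (i := ⟨s, hs⟩) (j := ⟨s', hs'⟩) (by simpa using hss)
    have h1 := (hind.comp (continuous_sphere_apply i).measurable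
      (continuous_sphere_apply j).measurable).integral_mul_eq_mul_integral
      ((continuous_sphere_apply i).measurable.comp (hu.measurable s hs)).aestronglyMeasurable
      ((continuous_sphere_apply j).measurable.comp (hu.measurable s' hs')).aestronglyMeasurable
    have h2 : ∫ ω, (u s ω : E n) i ∂P = 0 :=
      hu.integral_eq_zero_of_odd (f := fun v => (v ⟨s, hs⟩ : E n) i)
        ((continuous_sphere_apply i).measurable.comp (measurable_pi_apply _)) (fun v => by simp)
    refine h1.trans ?_
    rw [show ∫ ω, ((fun v : Metric.sphere (0 : E n) 1 => (v : E n) i) ∘ u s) ω ∂P = 0 from h2,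
      zero_mul]

end Sphere

end EBCOM

namespace EBCOM

/-! ### Measurability of the iterates and estimators. -/

section Measurability

variable {n H : ℕ} {K : Set (E n)} {R : E n → ℝ} {ν D η σ : ℝ}

section Generic

variable {Ω : Type*} {_ : MeasurableSpace Ω}

/-- A random function carries only the σ-algebra of its evaluations at fixed points; continuity and
separability give joint measurability, as needed at random arguments. -/
theorem measurable_apply_of_continuous {X : Type*} [TopologicalSpace X]
    [TopologicalSpace.MetrizableSpace X] [SecondCountableTopology X] [MeasurableSpace X]
    [OpensMeasurableSpace X] {G : Ω → X → ℝ} (hG : Measurable G) (hc : ∀ ω, Continuous (G ω))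
    {w : Ω → X} (hw : Measurable w) : Measurable fun ω => G ω (w ω) :=
  (measurable_uncurry_of_continuous_of_measurable (u := fun z ω => G ω z) hc
    fun z => (measurable_pi_apply z).comp hG).comp (hw.prodMk measurable_id)

theorem measurable_ellipsoid_apply (hK : IsConstraintSet K D) (hR : IsSelfConcordantBarrier K R ν)
    (hησ : 0 ≤ η * σ) {x : Ω → ℕ → E n} {t : ℕ} (hx : Measurable fun ω => x ω t)
    (hxK : ∀ ω, x ω t ∈ interior K) (i j : Fin n) :
    Measurable fun ω => ellipsoid R η σ (x ω) t i j := by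
  simp only [ellipsoid_eq]
  exact Matrix.measurable_invSqrt_apply
    (fun i j => measurable_regHessian_apply hR hx hxK (η * σ * t) i j)
    (fun ω => posDef_regHessian hK hR (by positivity) (hxK ω)) i j

theorem measurable_ellipsoid_inv_apply (hK : IsConstraintSet K D)
    (hR : IsSelfConcordantBarrier K R ν) (hησ : 0 ≤ η * σ) {x : Ω → ℕ → E n} {t : ℕ}
    (hx : Measurable fun ω => x ω t) (hxK : ∀ ω, x ω t ∈ interior K) (i j : Fin n) :
    Measurable fun ω => (ellipsoid R η σ (x ω) t)⁻¹ i j := by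
  have h : ∀ ω, (ellipsoid R η σ (x ω) t)⁻¹ =
      regHessian R (η * σ * t) (x ω t) * ellipsoid R η σ (x ω) t := fun ω => by
    rw [ellipsoid_eq]
    exact (posDef_regHessian hK hR (by positivity) (hxK ω)).inv_invSqrt
  simp only [h]
  exact Matrix.measurable_mul_apply
    (fun i j => measurable_regHessian_apply hR hx hxK (η * σ * t) i j)
    (measurable_ellipsoid_apply hK hR hησ hx hxK) i j

theorem measurable_play (hK : IsConstraintSet K D) (hR : IsSelfConcordantBarrier K R ν)
    (hησ : 0 ≤ η * σ) {u x : Ω → ℕ → E n} {t : ℕ} (hu : Measurable fun ω => u ω t)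
    (hx : Measurable fun ω => x ω t) (hxK : ∀ ω, x ω t ∈ interior K) :
    Measurable fun ω => play R η σ (u ω) (x ω) t :=
  hx.add (measurable_act (measurable_ellipsoid_apply hK hR hησ hx hxK) hu)

theorem measurable_window {y : Ω → ℕ → E n} {t : ℕ}
    (hy : ∀ i : Fin H, Measurable fun ω => y ω (t - (H - 1) + i)) :
    Measurable fun ω => window H (y ω) t :=
  (WithLp.measurable_toLp 2 _).comp (measurable_pi_lambda _ hy)

theorem measurable_gradEst (hK : IsConstraintSet K D) (hR : IsSelfConcordantBarrier K R ν)
    (hησ : 0 ≤ η * σ) {u x : Ω → ℕ → E n} {F : Ω → ℕ → V n H → ℝ} {t : ℕ}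
    (hF : H ≤ t → Measurable fun ω => F ω t) (hFc : H ≤ t → ∀ ω, Continuous (F ω t))
    (hu : ∀ s, H ≤ t → t - (H - 1) ≤ s → s ≤ t → Measurable fun ω => u ω s)
    (hx : ∀ s ≤ t, Measurable fun ω => x ω s) (hxK : ∀ ω s, x ω s ∈ interior K) :
    Measurable fun ω => gradEst R η σ (u ω) (F ω) (x ω) t := by
  unfold gradEst
  split_ifs with ht
  · exact measurable_const
  push Not at ht
  have hw : Measurable fun ω => F ω t (window H (play R η σ (u ω) (x ω)) t) := by
    refine measurable_apply_of_continuous (hF ht) (hFc ht) (measurable_window fun i => ?_)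
    have hi := i.2
    exact measurable_play hK hR hησ (hu _ ht (by omega) (by omega)) (hx _ (by omega))
      fun ω => hxK ω _
  refine (hw.const_mul (n : ℝ)).smul (Finset.measurable_sum _ fun i hi => ?_)
  · rw [Finset.mem_range] at hi
    exact measurable_act (measurable_ellipsoid_inv_apply hK hR hησ (hx _ (by omega))
      fun ω => hxK ω _) (hu _ ht (by omega) (by omega))

theorem exists_isStationary_of_pos (hK : IsConstraintSet K D) (hR : IsSelfConcordantBarrier K R ν)
    (hη : 0 < η) {m : ℝ} (θ : E n) : ∃ z, IsStationary K R η m θ z := by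
  have h := (exists_isStationary hK hR hη m {0} (fun _ => θ) (fun _ => 0)).2.2
  simp only [Finset.card_singleton, Nat.cast_one, mul_one, Finset.sum_singleton, smul_zero,
    sub_zero] at h
  exact ⟨_, h⟩

/-- Stationary points depend measurably on the linear coefficient. -/
theorem measurable_of_isStationary (hK : IsConstraintSet K D) (hR : IsSelfConcordantBarrier K R ν)
    (hη : 0 < η) {m : ℝ} (hm : 0 < m) {θ z : Ω → E n} (hθ : Measurable θ)
    (hz : ∀ ω, IsStationary K R η m (θ ω) (z ω)) : Measurable z := by
  -- Ψ is the solution map θ ↦ z, Lipschitz with constant 1/m. Uniqueness identifies z with Ψ ∘ θ,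
  -- irrespective of how the minimizer was selected.
  choose Ψ hΨ using fun θ => exists_isStationary_of_pos hK hR hη (m := m) θ
  have hlip : LipschitzWith (Real.toNNReal m⁻¹) Ψ := by
    refine LipschitzWith.of_dist_le_mul fun a b => ?_
    rw [dist_eq_norm, dist_eq_norm, Real.coe_toNNReal _ (inv_nonneg.2 hm.le), le_inv_mul_iff₀ hm]
    exact (hΨ a).mul_norm_sub_le hK hR hη (hΨ b)
  have hzΨ : z = Ψ ∘ θ := by
    funext ω
    have h := (hz ω).mul_norm_sub_le hK hR hη (hΨ (θ ω))
    rw [sub_self, norm_zero] at h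
    have h0 : ‖z ω - Ψ (θ ω)‖ ≤ 0 := by
      by_contra hc
      push Not at hc
      nlinarith [mul_pos hm hc]
    exact sub_eq_zero.1 (norm_le_zero_iff.1 h0)
  rw [hzΨ]
  exact hlip.continuous.measurable.comp hθ

end Generic

variable {Ω : Type*}

/-- The σ-algebra generated by the noises and losses up to time `k`. -/
@[reducible]
def pastSigma (u : ℕ → Ω → Metric.sphere (0 : E n) 1) (F : ℕ → Ω → V n H → ℝ) (k : ℕ) :
    MeasurableSpace Ω :=
  (⨆ s ∈ Set.Icc 1 k, MeasurableSpace.comap (u s) inferInstance) ⊔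
    ⨆ s ∈ Set.Icc H k, MeasurableSpace.comap (F s) inferInstance

variable {u : ℕ → Ω → Metric.sphere (0 : E n) 1} {F : ℕ → Ω → V n H → ℝ}

theorem pastSigma_mono {j k : ℕ} (h : j ≤ k) : pastSigma u F j ≤ pastSigma u F k := by
  refine sup_le_sup ?_ ?_
  · exact biSup_mono fun s hs => ⟨hs.1, hs.2.trans h⟩
  · exact biSup_mono fun s hs => ⟨hs.1, hs.2.trans h⟩

theorem measurable_noise_pastSigma {s k : ℕ} (hs : 1 ≤ s) (hsk : s ≤ k) :
    Measurable[pastSigma u F k] fun ω => (u s ω : E n) := by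
  have h1 : Measurable[pastSigma u F k] (u s) :=
    Measurable.mono (comap_measurable (u s))
      ((le_biSup (fun s => MeasurableSpace.comap (u s) inferInstance)
        (show s ∈ Set.Icc 1 k from ⟨hs, hsk⟩)).trans le_sup_left) le_rfl
  exact measurable_subtype_coe.comp h1

theorem measurable_loss_pastSigma {s k : ℕ} (hs : H ≤ s) (hsk : s ≤ k) :
    Measurable[pastSigma u F k] (F s) :=
  Measurable.mono (comap_measurable (F s))
    ((le_biSup (fun s => MeasurableSpace.comap (F s) inferInstance)
      (show s ∈ Set.Icc H k from ⟨hs, hsk⟩)).trans le_sup_right) le_rfl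

/-- The iterate `x_t` depends only on the noises and losses up to time `t - H`. -/
theorem measurable_iterate (hK : IsConstraintSet K D) (hR : IsSelfConcordantBarrier K R ν)
    (hη : 0 < η) (hσ : 0 < σ) (hH : 1 ≤ H) {T : ℕ}
    (hFc : ∀ t ∈ Finset.Icc H T, ∀ ω, Continuous (F t ω)) {t : ℕ} (ht : t - H ≤ T) :
    Measurable[pastSigma u F (t - H)]
      fun ω => iterate K R η σ (fun s => (u s ω : E n)) (fun s => F s ω) t := by
  have key : ∀ k ≤ T, Measurable[pastSigma u F k]
      fun ω => iterate K R η σ (fun s => (u s ω : E n)) (fun s => F s ω) (k + H) := by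
    intro k
    induction k using Nat.strong_induction_on with
    | _ k ih =>
    intro hk
    cases k with
    | zero =>
      have : ∀ ω, iterate K R η σ (fun s => (u s ω : E n)) (fun s => F s ω) (0 + H) =
          argminOn R (interior K) := fun ω => iterate_of_le (by omega)
      simp only [this]
      exact measurable_const
    | succ k =>
      -- For r ≤ k + 1 the iterate x_r is a leader of index r - H < k + 1, so the induction
      -- hypothesis covers all iterates used by the first k + 1 estimators.
      have hx : ∀ r, r ≤ k + 1 → Measurable[pastSigma u F (k + 1)]
          fun ω => iterate K R η σ (fun s => (u s ω : E n)) (fun s => F s ω) r := by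
        intro r hr
        simp only [iterate_eq_sub r]
        exact (ih (r - H) (by omega) (by omega)).mono (pastSigma_mono (by omega)) le_rfl
      let _ : MeasurableSpace Ω := pastSigma u F (k + 1)
      refine measurable_of_isStationary hK hR hη (m := σ * ((k + 1 : ℕ) : ℝ)) (by positivity)
        ?_ fun ω => (iterate_add_spec hK hR hη hH (k + 1)).2.2
      refine Finset.measurable_sum _ fun r hr => ?_
      obtain ⟨hr1, hr2⟩ := Finset.mem_Icc.1 hr
      refine Measurable.sub ?_ ((hx r hr2).const_smul σ)
      exact measurable_gradEst hK hR (mul_pos hη hσ).le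
        (u := fun ω s => (u s ω : E n)) (F := fun ω s => F s ω)
        (fun h => measurable_loss_pastSigma h hr2)
        (fun h ω => hFc r (Finset.mem_Icc.2 ⟨h, by omega⟩) ω)
        (fun s h1 h2 h3 => measurable_noise_pastSigma (by omega) (by omega))
        (fun s hs => hx s (by omega))
        (fun ω s => iterate_mem_interior hK hR hη hH s)
  simp only [iterate_eq_sub t]
  exact key _ ht

end Measurability

end EBCOM

namespace EBCOM

/-! ### Integrals of noise polynomials with independent coefficients. -/

section Moments

variable {Ω ι : Type*} [Fintype ι] {mΩ : MeasurableSpace Ω} {P : Measure Ω}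
  {𝒢 𝒰 : MeasurableSpace Ω}

theorem integral_mul_of_indep (h𝒢 : 𝒢 ≤ mΩ) (h𝒰 : 𝒰 ≤ mΩ) (hind : Indep 𝒰 𝒢 P) {f V : Ω → ℝ}
    (hf : Measurable[𝒢] f) (hV : Measurable[𝒰] V) :
    ∫ ω, f ω * V ω ∂P = (∫ ω, f ω ∂P) * ∫ ω, V ω ∂P := by
  have h : IndepFun f V P := by
    rw [IndepFun_iff_Indep]
    exact indep_of_indep_of_le_left (indep_of_indep_of_le_right hind.symm
      (measurable_iff_comap_le.1 hV)) (measurable_iff_comap_le.1 hf)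
  exact h.integral_fun_mul_eq_mul_integral (hf.mono h𝒢 le_rfl).aestronglyMeasurable
    (hV.mono h𝒰 le_rfl).aestronglyMeasurable

variable [IsProbabilityMeasure P]

theorem integrable_of_abs_le {f : Ω → ℝ} (hf : Measurable[mΩ] f) {C : ℝ} (hC : ∀ ω, |f ω| ≤ C) :
    Integrable f P :=
  Integrable.of_bound hf.aestronglyMeasurable C (Eventually.of_forall hC)

variable {U : ι → Ω → ℝ} {c : Ω → ℝ} {p r : ι → Ω → ℝ} {Q : ι → ι → Ω → ℝ} {C : ℝ}

theorem integral_linear_eq_zero (h𝒢 : 𝒢 ≤ mΩ) (h𝒰 : 𝒰 ≤ mΩ) (hind : Indep 𝒰 𝒢 P)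
    (hU : ∀ α, Measurable[𝒰] (U α)) (hU1 : ∀ α ω, |U α ω| ≤ 1)
    (hp : ∀ α, Measurable[𝒢] (p α)) (hpC : ∀ α ω, |p α ω| ≤ C)
    (hm1 : ∀ α, ∫ ω, U α ω ∂P = 0) :
    Integrable (fun ω => ∑ α, p α ω * U α ω) P ∧ ∫ ω, ∑ α, p α ω * U α ω ∂P = 0 := by
  have hint : ∀ α, Integrable (fun ω => p α ω * U α ω) P := fun α =>
    integrable_of_abs_le (C := C * 1) (((hp α).mono h𝒢 le_rfl).mul ((hU α).mono h𝒰 le_rfl))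
      fun ω => by
        rw [abs_mul]
        exact mul_le_mul (hpC α ω) (hU1 α ω) (abs_nonneg _) ((abs_nonneg _).trans (hpC α ω))
  refine ⟨integrable_finsetSum _ fun α _ => hint α, ?_⟩
  rw [integral_finsetSum _ fun α _ => hint α]
  refine Finset.sum_eq_zero fun α _ => ?_
  rw [integral_mul_of_indep h𝒢 h𝒰 hind (hp α) (hU α), hm1, mul_zero]

/-- Only the linear part of a quadratic polynomial in the noise correlates with a linear form in the
noise. -/
theorem integral_quadratic_mul_linear (h𝒢 : 𝒢 ≤ mΩ) (h𝒰 : 𝒰 ≤ mΩ) (hind : Indep 𝒰 𝒢 P)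
    (hU : ∀ α, Measurable[𝒰] (U α)) (hU1 : ∀ α ω, |U α ω| ≤ 1)
    (hc : Measurable[𝒢] c) (hp : ∀ α, Measurable[𝒢] (p α)) (hr : ∀ α, Measurable[𝒢] (r α))
    (hQ : ∀ α γ, Measurable[𝒢] (Q α γ)) (hcC : ∀ ω, |c ω| ≤ C) (hpC : ∀ α ω, |p α ω| ≤ C)
    (hQC : ∀ α γ ω, |Q α γ ω| ≤ C) (hrC : ∀ α ω, |r α ω| ≤ C) {v : ℝ}
    (hm1 : ∀ α, ∫ ω, U α ω ∂P = 0)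
    (hm2 : ∀ α γ, α ≠ γ → ∫ ω, U α ω * U γ ω ∂P = 0) (hm2' : ∀ α, ∫ ω, U α ω * U α ω ∂P = v)
    (hm3 : ∀ α γ δ, ∫ ω, U α ω * U γ ω * U δ ω ∂P = 0) :
    Integrable (fun ω => (c ω + ∑ α, p α ω * U α ω + ∑ α, ∑ γ, Q α γ ω * (U α ω * U γ ω)) *
        ∑ δ, r δ ω * U δ ω) P ∧
      Integrable (fun ω => ∑ α, p α ω * r α ω) P ∧
      ∫ ω, (c ω + ∑ α, p α ω * U α ω + ∑ α, ∑ γ, Q α γ ω * (U α ω * U γ ω)) *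
        ∑ δ, r δ ω * U δ ω ∂P = v * ∫ ω, ∑ α, p α ω * r α ω ∂P := by
  have mul_le : ∀ {a b A B : ℝ}, |a| ≤ A → |b| ≤ B → |a * b| ≤ A * B := fun ha hb => by
    rw [abs_mul]
    exact mul_le_mul ha hb (abs_nonneg _) ((abs_nonneg _).trans ha)
  have mG : ∀ {f : Ω → ℝ}, Measurable[𝒢] f → Measurable[mΩ] f := fun hf => hf.mono h𝒢 le_rfl
  have mU : ∀ α, Measurable[mΩ] (U α) := fun α => (hU α).mono h𝒰 le_rfl
  have i1 : ∀ δ, Integrable (fun ω => c ω * r δ ω * U δ ω) P := fun δ =>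
    integrable_of_abs_le (((mG hc).mul (mG (hr δ))).mul (mU δ))
      fun ω => mul_le (mul_le (hcC ω) (hrC δ ω)) (hU1 δ ω)
  have i2 : ∀ δ α, Integrable (fun ω => p α ω * r δ ω * (U α ω * U δ ω)) P := fun δ α =>
    integrable_of_abs_le (((mG (hp α)).mul (mG (hr δ))).mul ((mU α).mul (mU δ)))
      fun ω => mul_le (mul_le (hpC α ω) (hrC δ ω)) (mul_le (hU1 α ω) (hU1 δ ω))
  have i3 : ∀ δ α γ, Integrable (fun ω => Q α γ ω * r δ ω * (U α ω * U γ ω * U δ ω)) P :=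
    fun δ α γ => integrable_of_abs_le
      (((mG (hQ α γ)).mul (mG (hr δ))).mul (((mU α).mul (mU γ)).mul (mU δ)))
      fun ω => mul_le (mul_le (hQC α γ ω) (hrC δ ω))
        (mul_le (mul_le (hU1 α ω) (hU1 γ ω)) (hU1 δ ω))
  have i4 : ∀ α, Integrable (fun ω => p α ω * r α ω) P := fun α =>
    integrable_of_abs_le ((mG (hp α)).mul (mG (hr α))) fun ω => mul_le (hpC α ω) (hrC α ω)
  have hexp : (fun ω => (c ω + ∑ α, p α ω * U α ω + ∑ α, ∑ γ, Q α γ ω * (U α ω * U γ ω)) *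
      ∑ δ, r δ ω * U δ ω) = fun ω => ∑ δ, (c ω * r δ ω * U δ ω +
        ∑ α, p α ω * r δ ω * (U α ω * U δ ω) +
        ∑ α, ∑ γ, Q α γ ω * r δ ω * (U α ω * U γ ω * U δ ω)) := by
    funext ω
    rw [Finset.mul_sum]
    refine Finset.sum_congr rfl fun δ _ => ?_
    rw [add_mul, add_mul, Finset.sum_mul, Finset.sum_mul]
    congr 1
    · congr 1
      · ring
      · exact Finset.sum_congr rfl fun α _ => by ring
    · refine Finset.sum_congr rfl fun α _ => ?_
      rw [Finset.sum_mul]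
      exact Finset.sum_congr rfl fun γ _ => by ring
  have j2 : ∀ δ, Integrable (fun ω => ∑ α, p α ω * r δ ω * (U α ω * U δ ω)) P := fun δ =>
    integrable_finsetSum _ fun α _ => i2 δ α
  have j3' : ∀ δ α, Integrable (fun ω => ∑ γ, Q α γ ω * r δ ω * (U α ω * U γ ω * U δ ω)) P :=
    fun δ α => integrable_finsetSum _ fun γ _ => i3 δ α γ
  have j3 : ∀ δ, Integrable (fun ω => ∑ α, ∑ γ, Q α γ ω * r δ ω * (U α ω * U γ ω * U δ ω)) P :=
    fun δ => integrable_finsetSum _ fun α _ => j3' δ α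
  have j5 : ∀ δ, Integrable (fun ω => c ω * r δ ω * U δ ω +
      ∑ α, p α ω * r δ ω * (U α ω * U δ ω)) P := fun δ => (i1 δ).add (j2 δ)
  have j4 : ∀ δ, Integrable (fun ω => c ω * r δ ω * U δ ω +
      ∑ α, p α ω * r δ ω * (U α ω * U δ ω) +
      ∑ α, ∑ γ, Q α γ ω * r δ ω * (U α ω * U γ ω * U δ ω)) P := fun δ => (j5 δ).add (j3 δ)
  refine ⟨?_, integrable_finsetSum _ fun α _ => i4 α, ?_⟩
  · rw [hexp]
    exact integrable_finsetSum _ fun δ _ => j4 δ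
  · rw [hexp, integral_finsetSum _ fun δ _ => j4 δ,
      integral_finsetSum _ fun α _ => i4 α, Finset.mul_sum]
    refine Finset.sum_congr rfl fun δ _ => ?_
    -- The constant part dies by first moments and the quadratic part by third moments; in the
    -- linear part only the diagonal survives, with variance v.
    have e1 : ∫ ω, c ω * r δ ω * U δ ω ∂P = 0 := by
      rw [integral_mul_of_indep (f := fun ω => c ω * r δ ω) h𝒢 h𝒰 hind (hc.mul (hr δ)) (hU δ), hm1,
        mul_zero]
    have e2 : ∀ α, ∫ ω, p α ω * r δ ω * (U α ω * U δ ω) ∂P =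
        (∫ ω, p α ω * r δ ω ∂P) * ∫ ω, U α ω * U δ ω ∂P := fun α =>
      integral_mul_of_indep h𝒢 h𝒰 hind ((hp α).mul (hr δ)) ((hU α).mul (hU δ))
    have e3 : ∀ α γ, ∫ ω, Q α γ ω * r δ ω * (U α ω * U γ ω * U δ ω) ∂P = 0 := fun α γ => by
      rw [integral_mul_of_indep (f := fun ω => Q α γ ω * r δ ω)
        (V := fun ω => U α ω * U γ ω * U δ ω) h𝒢 h𝒰 hind ((hQ α γ).mul (hr δ)) (((hU α).mul (hU γ)).mul (hU δ)), hm3, mul_zero]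
    rw [integral_add (j5 δ) (j3 δ), integral_add (i1 δ) (j2 δ), e1,
      integral_finsetSum _ fun α _ => i2 δ α, integral_finsetSum _ fun α _ => j3' δ α,
      Finset.sum_eq_single δ (fun α _ hα => by rw [e2, hm2 α δ hα, mul_zero]) (by simp),
      e2, hm2', Finset.sum_eq_zero fun α _ => by
        rw [integral_finsetSum _ fun γ _ => i3 δ α γ, Finset.sum_eq_zero fun γ _ => e3 α γ]]
    ring

end Moments

/-! ### Coefficients of a quadratic loss read off from its values. -/

section QuadraticCoefficients

variable {n H : ℕ} {K : Set (E n)} {β σ B L : ℝ} {F : V n H → ℝ} {ι : Type*} [Fintype ι]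

/-- The even part of `v ↦ F (w + v) - F w`. -/
noncomputable def evenPart (F : V n H → ℝ) (w v : V n H) : ℝ := (F (w + v) + F (w - v)) / 2 - F w

/-- The linear coefficient of `F` at `w` in the direction `v`. -/
noncomputable def linCoeff (F : V n H → ℝ) (w v : V n H) : ℝ := (F (w + v) - F (w - v)) / 2

/-- The quadratic coefficient of `F` at `w` in the directions `v` and `v'`. -/
noncomputable def quadCoeff (F : V n H → ℝ) (w v v' : V n H) : ℝ :=
  2 * evenPart F w ((1 / 2 : ℝ) • (v + v')) - evenPart F w v / 2 - evenPart F w v' / 2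

theorem IsLoss.linCoeff_eq (hF : IsLoss K β σ B L F) (w v : V n H) :
    linCoeff F w v = ⟪gradient F w, v⟫ := by
  obtain ⟨W, -, -, h, -⟩ := hF.exists_expansion
  rw [linCoeff, sub_eq_add_neg w v, h, h, map_neg, inner_neg_neg, inner_neg_right]
  ring

/-- The coefficients are differences of values of F rather than expressions in W and b. They are
thus measurable in the random function F, and bounded in terms of B when the points evaluated lie in
K^H. The midpoint in `quadCoeff` keeps its argument within the unit balls. -/
theorem IsLoss.apply_add_sum (hF : IsLoss K β σ B L F) (w : V n H) (ε : ι → V n H) (a : ι → ℝ) :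
    F (w + ∑ α, a α • ε α) = F w + ∑ α, linCoeff F w (ε α) * a α +
      ∑ α, ∑ γ, quadCoeff F w (ε α) (ε γ) * (a α * a γ) := by
  simp only [hF.linCoeff_eq]
  obtain ⟨W, -, -, h, -⟩ := hF.exists_expansion
  have he : ∀ v, evenPart F w v = ⟪v, W v⟫ := fun v => by
    rw [evenPart, sub_eq_add_neg w v, h, h, map_neg, inner_neg_neg, inner_neg_right]
    ring
  have hq : ∀ v v', quadCoeff F w v v' = (⟪v, W v'⟫ + ⟪v', W v⟫) / 2 := fun v v' => by
    simp only [quadCoeff, he, map_smul, map_add, inner_add_left, inner_add_right,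
      real_inner_smul_left, real_inner_smul_right]
    ring
  rw [h, inner_sum]
  congr 1
  · congr 1
    exact Finset.sum_congr rfl fun α _ => by rw [real_inner_smul_right]; ring
  · simp only [hq, map_sum, map_smul, sum_inner, inner_sum, real_inner_smul_left,
      real_inner_smul_right]
    have e1 : ∑ α, ∑ γ, a γ * (a α * ⟪ε γ, W (ε α)⟫) = ∑ α, ∑ γ, a α * (a γ * ⟪ε α, W (ε γ)⟫) :=
      Finset.sum_comm
    have e2 : ∑ α, ∑ γ, (⟪ε α, W (ε γ)⟫ + ⟪ε γ, W (ε α)⟫) / 2 * (a α * a γ) =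
        (∑ α, ∑ γ, a α * (a γ * ⟪ε α, W (ε γ)⟫)) / 2 +
          (∑ α, ∑ γ, a γ * (a α * ⟪ε γ, W (ε α)⟫)) / 2 := by
      rw [Finset.sum_div, Finset.sum_div, ← Finset.sum_add_distrib]
      refine Finset.sum_congr rfl fun α _ => ?_
      rw [Finset.sum_div, Finset.sum_div, ← Finset.sum_add_distrib]
      exact Finset.sum_congr rfl fun γ _ => by ring
    rw [e2, e1, add_halves, Finset.sum_comm]
    exact Finset.sum_congr rfl fun α _ => Finset.sum_congr rfl fun γ _ => by ring

theorem abs_linCoeff_le {w v : V n H} (h1 : 0 ≤ F (w + v) ∧ F (w + v) ≤ B)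
    (h2 : 0 ≤ F (w - v) ∧ F (w - v) ≤ B) : |linCoeff F w v| ≤ B := by
  rw [linCoeff, abs_le]
  constructor <;> linarith

theorem abs_evenPart_le {w v : V n H} (h0 : 0 ≤ F w ∧ F w ≤ B) (h1 : 0 ≤ F (w + v) ∧ F (w + v) ≤ B)
    (h2 : 0 ≤ F (w - v) ∧ F (w - v) ≤ B) : |evenPart F w v| ≤ B := by
  rw [evenPart, abs_le]
  constructor <;> linarith

theorem abs_quadCoeff_le {w v v' : V n H} (h1 : |evenPart F w ((1 / 2 : ℝ) • (v + v'))| ≤ B)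
    (h2 : |evenPart F w v| ≤ B) (h3 : |evenPart F w v'| ≤ B) : |quadCoeff F w v v'| ≤ 3 * B := by
  rw [abs_le] at *
  rw [quadCoeff]
  constructor <;> linarith

end QuadraticCoefficients

end EBCOM

namespace EBCOM

/-! ### The perturbed window in coordinates. -/

section Perturbation

variable {n H T : ℕ} {K : Set (E n)} {R : E n → ℝ} {ν D η σ β B L : ℝ} {x u : ℕ → E n} {t : ℕ}
  {F : ℕ → V n H → ℝ}

theorem perturbation_add (v v' : V n H) : perturbation R η σ x t (v + v') =
    perturbation R η σ x t v + perturbation R η σ x t v' := by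
  ext1 i
  exact act_add _ _ _

theorem perturbation_smul (c : ℝ) (v : V n H) : perturbation R η σ x t (c • v) =
    c • perturbation R η σ x t v := by
  ext1 i
  exact act_smul _ _ _

theorem perturbation_sum {ι : Type*} (s : Finset ι) (c : ι → ℝ) (v : ι → V n H) :
    perturbation R η σ x t (∑ α ∈ s, c α • v α) = ∑ α ∈ s, c α • perturbation R η σ x t (v α) := by
  have h := map_sum (IsLinearMap.mk' (perturbation (H := H) R η σ x t)
    ⟨perturbation_add, perturbation_smul⟩) (fun α => c α • v α) s
  simpa only [IsLinearMap.mk'_apply, perturbation_smul] using h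

/-- The standard basis of `(ℝⁿ)^H`. -/
noncomputable def stdVector (α : Fin H × Fin n) : V n H :=
  WithLp.toLp 2 (Pi.single α.1 (EuclideanSpace.single α.2 (1 : ℝ)))

theorem norm_stdVector_apply_le (α : Fin H × Fin n) (k : Fin H) : ‖stdVector α k‖ ≤ 1 := by
  by_cases h : k = α.1
  · subst h
    simp [stdVector]
  · simp [stdVector, h]

theorem sum_stdVector (v : V n H) : ∑ α : Fin H × Fin n, v α.1 α.2 • stdVector α = v := by
  ext1 k
  rw [Fintype.sum_prod_type, WithLp.ofLp_sum, Finset.sum_apply,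
    Finset.sum_eq_single k (fun i _ hi => ?_) (by simp), WithLp.ofLp_sum, Finset.sum_apply]
  · conv_rhs => rw [sum_single_eq (v k)]
    exact Finset.sum_congr rfl fun j _ => by simp [stdVector]
  · rw [WithLp.ofLp_sum, Finset.sum_apply]
    exact Finset.sum_eq_zero fun j _ => by simp [stdVector, hi.symm]

theorem perturbation_eq_sum (v : V n H) : perturbation R η σ x t v =
    ∑ α : Fin H × Fin n, v α.1 α.2 • perturbation R η σ x t (stdVector α) := by
  conv_lhs => rw [← sum_stdVector v]
  exact perturbation_sum _ _ _

theorem add_perturbation_mem (hK : IsConstraintSet K D) (hR : IsSelfConcordantBarrier K R ν)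
    (hησ : 0 < η * σ) (hx : ∀ s, x s ∈ interior K) (hH : 1 ≤ H) (ht : H ≤ t) {v : V n H}
    (hv : ∀ k, ‖v k‖ ≤ 1) (k : Fin H) : (window H x t + perturbation R η σ x t v) k ∈ K :=
  add_act_ellipsoid_mem hK hR hησ (by omega) (hx _) (hv k)

theorem act_act_ellipsoid_inv (hK : IsConstraintSet K D) (hR : IsSelfConcordantBarrier K R ν)
    (hησ : 0 ≤ η * σ) (hx : x t ∈ interior K) (v : E n) :
    act (ellipsoid R η σ x t) (act (ellipsoid R η σ x t)⁻¹ v) = v := by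
  have h := (posDef_regHessian hK hR (m := η * σ * t) (by positivity) hx).inv_invSqrt_mul_invSqrt
  rw [← act_mul, ellipsoid_eq, mul_eq_one_comm.1 h, act_one]

/-- This is why the A⁻¹ in the estimator undoes the scaling of the exploration: pairing the linear
coefficients along A with those of A⁻¹e returns the derivative of F in the direction (e, …, e). -/
theorem perturbation_inv (hK : IsConstraintSet K D) (hR : IsSelfConcordantBarrier K R ν)
    (hησ : 0 ≤ η * σ) (hx : ∀ s, x s ∈ interior K) (e : E n) :
    perturbation R η σ x t (WithLp.toLp 2 fun i : Fin H =>
      act (ellipsoid R η σ x (t - (H - 1) + i))⁻¹ e) = diag H e := by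
  ext1 i
  exact act_act_ellipsoid_inv hK hR hησ (hx _) e

theorem inner_gradEst (ht : H ≤ t) (e : E n) : ⟪gradEst R η σ u F x t, e⟫ =
    n * (F t (window H (play R η σ u x) t) * ∑ α : Fin H × Fin n,
      act (ellipsoid R η σ x (t - (H - 1) + α.1))⁻¹ e α.2 * window H u t α.1 α.2) := by
  have h1 : ∑ i ∈ Finset.range H, ⟪act (ellipsoid R η σ x (t - i))⁻¹ (u (t - i)), e⟫ =
      ∑ α : Fin H × Fin n,
        act (ellipsoid R η σ x (t - (H - 1) + α.1))⁻¹ e α.2 * window H u t α.1 α.2 := by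
    rw [← Finset.sum_range_reflect, Finset.sum_range, Fintype.sum_prod_type]
    refine Finset.sum_congr rfl fun i _ => ?_
    have hi : t - (H - 1 - i) = t - (H - 1) + i := by have := i.2; omega
    rw [hi, inner_act_ellipsoid_inv, PiLp.inner_apply]
    exact Finset.sum_congr rfl fun j _ => by simp [window]
  rw [gradEst, if_neg (Nat.not_lt.2 ht), real_inner_smul_left, sum_inner, h1, mul_assoc]

theorem hessForm_le_norm_mul (R : E n → ℝ) (x h : E n) :
    hessForm R x h ≤ ‖iteratedFDeriv ℝ 2 R x‖ * ‖h‖ ^ 2 := by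
  rw [← iteratedFDeriv_two_diag]
  refine (le_abs_self _).trans (((iteratedFDeriv ℝ 2 R x).le_opNorm ![h, h]).trans (le_of_eq ?_))
  simp [Fin.prod_univ_two, sq]

/-- A crude bound independent of the realization, by comparing Hessians along the chain of leaders
back to the minimizer of R. It serves only to make the estimators integrable. -/
theorem IsStableRun.norm_act_inv_sq_le (hr : IsStableRun K R ν D η σ β B L T u F) {s : ℕ}
    (hs : s ≤ T) (e : E n) :
    ‖act (ellipsoid R η σ (iterate K R η σ u F) s)⁻¹ e‖ ^ 2 ≤
      (Real.exp T * ‖iteratedFDeriv ℝ 2 R (argminOn R (interior K))‖ + η * σ * T) * ‖e‖ ^ 2 := by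
  have h1 := hr.step_pos
  have h2 := hr.curvature_pos
  rw [norm_act_ellipsoid_inv_sq hr.constraintSet hr.barrier (mul_pos h1 h2).le (hr.mem_interior s),
    add_mul]
  refine add_le_add ?_ (by gcongr)
  have h3 := (hessForm_le_exp_chain hr.constraintSet hr.barrier
    (z := fun j => iterate K R η σ u F (j + H)) (fun j => hr.mem_interior _)
    (s := 20 * η * n * B * H) (by linarith [hr.stepBound_le]) (Nat.zero_le (s - H))
    (fun j _ hj => (hr.localNorm_le_sqrt_stepForm j _).trans (hr.step_le (by omega))) e).1
  rw [← iterate_eq_sub, iterate_of_le (by omega : 0 + H ≤ H)] at h3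
  refine h3.trans ?_
  rw [mul_assoc (Real.exp T)]
  refine mul_le_mul (Real.exp_le_exp.2 ?_) (hessForm_le_norm_mul _ _ _)
    (hessForm_nonneg hr.constraintSet hr.barrier ?_ e) (Real.exp_pos _).le
  · have h4 : ((s - H : ℕ) : ℝ) ≤ T := by exact_mod_cast (by omega : s - H ≤ T)
    have h5 := hr.stepBound_le
    have h6 := hr.stepBound_nonneg
    have h7 : (0 : ℝ) ≤ (s - H : ℕ) := Nat.cast_nonneg _
    rw [Nat.cast_zero, sub_zero]
    nlinarith
  · rw [← iterate_of_le (K := K) (R := R) (η := η) (σ := σ) (u := u) (F := F) (le_refl H)]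
    exact hr.mem_interior H

end Perturbation

end EBCOM

namespace EBCOM

/-! ### Measurability of the polynomial coefficients. -/

section MeasurableCoefficients

variable {n H : ℕ} {K : Set (E n)} {R : E n → ℝ} {ν D η σ : ℝ} {Ω : Type*} {_ : MeasurableSpace Ω}
  {G : Ω → V n H → ℝ} {w v v' : Ω → V n H}

theorem measurable_linCoeff (hG : Measurable G) (hc : ∀ ω, Continuous (G ω)) (hw : Measurable w)
    (hv : Measurable v) : Measurable fun ω => linCoeff (G ω) (w ω) (v ω) :=
  ((measurable_apply_of_continuous hG hc (hw.add hv)).sub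
    (measurable_apply_of_continuous hG hc (hw.sub hv))).div_const 2

theorem measurable_evenPart (hG : Measurable G) (hc : ∀ ω, Continuous (G ω)) (hw : Measurable w)
    (hv : Measurable v) : Measurable fun ω => evenPart (G ω) (w ω) (v ω) :=
  (((measurable_apply_of_continuous hG hc (hw.add hv)).add
    (measurable_apply_of_continuous hG hc (hw.sub hv))).div_const 2).sub
    (measurable_apply_of_continuous hG hc hw)

theorem measurable_quadCoeff (hG : Measurable G) (hc : ∀ ω, Continuous (G ω)) (hw : Measurable w)
    (hv : Measurable v) (hv' : Measurable v') :
    Measurable fun ω => quadCoeff (G ω) (w ω) (v ω) (v' ω) :=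
  (((measurable_evenPart hG hc hw ((hv.add hv').const_smul (1 / 2 : ℝ))).const_mul 2).sub
    ((measurable_evenPart hG hc hw hv).div_const 2)).sub
    ((measurable_evenPart hG hc hw hv').div_const 2)

theorem measurable_perturbation (hK : IsConstraintSet K D) (hR : IsSelfConcordantBarrier K R ν)
    (hησ : 0 ≤ η * σ) {x : Ω → ℕ → E n} {t : ℕ}
    (hx : ∀ i : Fin H, Measurable fun ω => x ω (t - (H - 1) + i))
    (hxK : ∀ ω s, x ω s ∈ interior K) (v : V n H) :
    Measurable fun ω => perturbation R η σ (x ω) t v :=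
  (WithLp.measurable_toLp 2 _).comp (measurable_pi_lambda _ fun i =>
    measurable_act (measurable_ellipsoid_apply hK hR hησ (hx i) fun ω => hxK ω _)
      measurable_const)

end MeasurableCoefficients

theorem IsLoss.continuous {β B L : ℝ} {F : V n H → ℝ} (hF : IsLoss K β σ B L F) : Continuous F := by
  have : ContinuousSMul ℝ (V n H) := IsBoundedSMul.continuousSMul
  exact hF.differentiable.continuous

/-! ### Unbiasedness of the gradient estimator. -/

section MeanZero

variable {n H T : ℕ} {K : Set (E n)} {R : E n → ℝ} {ν D η σ β B L : ℝ} {Ω : Type*}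
  {𝒢 𝒰 : MeasurableSpace Ω} [mΩ : MeasurableSpace Ω] {P : Measure Ω} [IsProbabilityMeasure P]
  {u : ℕ → Ω → Metric.sphere (0 : E n) 1} {F : ℕ → Ω → V n H → ℝ}

theorem IsExplorationNoise.integral_apply (hu : IsExplorationNoise P T u) {s : ℕ}
    (hs : s ∈ Finset.Icc 1 T) (i : Fin n) : ∫ ω, (u s ω : E n) i ∂P = 0 :=
  hu.integral_eq_zero_of_odd (f := fun v => (v ⟨s, hs⟩ : E n) i)
    ((continuous_sphere_apply i).measurable.comp (measurable_pi_apply _)) fun v => by simp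

theorem IsExplorationNoise.integral_mul_mul (hu : IsExplorationNoise P T u) {s s' s'' : ℕ}
    (hs : s ∈ Finset.Icc 1 T) (hs' : s' ∈ Finset.Icc 1 T) (hs'' : s'' ∈ Finset.Icc 1 T)
    (i j k : Fin n) :
    ∫ ω, (u s ω : E n) i * (u s' ω : E n) j * (u s'' ω : E n) k ∂P = 0 := by
  have hm : ∀ (s : Finset.Icc 1 T) (i : Fin n),
      Measurable fun v : Finset.Icc 1 T → Metric.sphere (0 : E n) 1 => (v s : E n) i :=
    fun s i => (continuous_sphere_apply i).measurable.comp (measurable_pi_apply _)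
  exact hu.integral_eq_zero_of_odd
    (f := fun v => (v ⟨s, hs⟩ : E n) i * (v ⟨s', hs'⟩ : E n) j * (v ⟨s'', hs''⟩ : E n) k)
    (((hm _ i).mul (hm _ j)).mul (hm _ k)) fun v => by simp

set_option maxHeartbeats 1000000 in
/-- The noise perturbs the loss in mean only through its quadratic part, and the gradient estimator
has the conditional mean `∑ i, ∇ᵢ F_t`. -/
theorem integral_gradEst_of_indep (hu : IsExplorationNoise P T u)
    (hr : ∀ ω, IsStableRun K R ν D η σ β B L T (fun s => (u s ω : E n)) (fun s => F s ω)) {t : ℕ}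
    (ht : t ∈ Finset.Icc H T) {y : E n} (hy : y ∈ K)
    (h𝒢le : 𝒢 ≤ mΩ) (h𝒰le : 𝒰 ≤ mΩ) (hind : Indep 𝒰 𝒢 P) (hFm : Measurable[𝒢] (F t))
    (hxm : ∀ s ≤ t, Measurable[𝒢]
      fun ω => iterate K R η σ (fun s => (u s ω : E n)) (fun s => F s ω) s)
    (hum : ∀ s, t - (H - 1) ≤ s → s ≤ t → Measurable[𝒰] (u s)) :
    let x := fun ω => iterate K R η σ (fun s => (u s ω : E n)) (fun s => F s ω)
    let Y := fun ω => ⟪gradient (F t ω) (window H (x ω) t),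
      perturbation R η σ (x ω) t (window H (fun s => (u s ω : E n)) t)⟫
    let Z := fun ω => ⟪gradient (F t ω) (window H (x ω) t), diag H (x ω t - y)⟫ -
      ⟪gradEst R η σ (fun s => (u s ω : E n)) (fun s => F s ω) (x ω) t, x ω t - y⟫
    (Integrable Y P ∧ ∫ ω, Y ω ∂P = 0) ∧ (Integrable Z P ∧ ∫ ω, Z ω ∂P = 0) := by
  intro x Y Z
  obtain ⟨htH, htT⟩ := Finset.mem_Icc.1 ht
  obtain ⟨ω₀⟩ := nonempty_of_isProbabilityMeasure P
  have hK := (hr ω₀).constraintSet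
  have hR := (hr ω₀).barrier
  have hH := (hr ω₀).one_le_memory
  have hn := (hr ω₀).one_le_dim
  have hη := (hr ω₀).step_pos
  have hσ := (hr ω₀).curvature_pos
  have hησ : 0 < η * σ := mul_pos hη hσ
  have hxK : ∀ ω s, x ω s ∈ interior K := fun ω s => (hr ω).mem_interior s
  have hloss : ∀ ω, IsLoss K β σ B L (F t ω) := fun ω => (hr ω).loss t ht
  have hFc : ∀ t ∈ Finset.Icc H T, ∀ ω, Continuous (F t ω) := fun t ht ω =>
    ((hr ω).loss t ht).continuous
  set s : Fin H → ℕ := fun i => t - (H - 1) + i with hs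
  have hs1 : ∀ i, s i ∈ Finset.Icc 1 T := fun i => by
    have h1 := i.2
    have h2 : s i = t - (H - 1) + i := rfl
    rw [Finset.mem_Icc]
    omega
  have hst : ∀ i, s i ≤ t := fun i => by
    have h1 := i.2
    have h2 : s i = t - (H - 1) + i := rfl
    omega
  set U : Fin H × Fin n → Ω → ℝ := fun α ω => (u (s α.1) ω : E n) α.2 with hU
  set w : Ω → V n H := fun ω => window H (x ω) t with hw
  set ε : Fin H × Fin n → Ω → V n H := fun α ω => perturbation R η σ (x ω) t (stdVector α) with hε
  have hwm : Measurable[𝒢] w := measurable_window fun i => hxm _ (hst i)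
  have hεm : ∀ α, Measurable[𝒢] (ε α) := fun α =>
    measurable_perturbation hK hR hησ.le (fun i => hxm _ (hst i)) hxK _
  have hUm : ∀ α, Measurable[𝒰] (U α) := fun α =>
    (continuous_sphere_apply α.2).measurable.comp (hum _ (Nat.le_add_right _ _) (hst _))
  have hU1 : ∀ α ω, |U α ω| ≤ 1 := fun α ω => abs_sphere_apply_le _ _
  have hm1 : ∀ α, ∫ ω, U α ω ∂P = 0 := fun α => hu.integral_apply (hs1 _) _
  have hm3 : ∀ α γ δ, ∫ ω, U α ω * U γ ω * U δ ω ∂P = 0 := fun α γ δ =>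
    hu.integral_mul_mul (hs1 _) (hs1 _) (hs1 _) _ _ _
  have hm2 : ∀ α γ, α ≠ γ → ∫ ω, U α ω * U γ ω ∂P = 0 := fun α γ hαγ => by
    refine (hu.integral_mul hn (hs1 _) (hs1 _) _ _).trans (if_neg fun h => hαγ ?_)
    exact Prod.ext (Fin.ext (Nat.add_left_cancel h.1)) h.2
  have hm2' : ∀ α, ∫ ω, U α ω * U α ω ∂P = (n : ℝ)⁻¹ := fun α =>
    (hu.integral_mul hn (hs1 _) (hs1 _) _ _).trans (if_pos ⟨rfl, rfl⟩)
  have hmem : ∀ ω (v : V n H), (∀ k, ‖v k‖ ≤ 1) →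
      0 ≤ F t ω (w ω + perturbation R η σ (x ω) t v) ∧
        F t ω (w ω + perturbation R η σ (x ω) t v) ≤ B := fun ω v hv => by
    have := add_perturbation_mem (t := t) hK hR hησ (hxK ω) hH htH hv
    exact ⟨(hloss ω).nonneg _ this, (hloss ω).bounded _ this⟩
  have hmem0 : ∀ ω, 0 ≤ F t ω (w ω) ∧ F t ω (w ω) ≤ B := fun ω => by
    have : ∀ k, w ω k ∈ K := fun k => interior_subset (hxK ω _)
    exact ⟨(hloss ω).nonneg _ this, (hloss ω).bounded _ this⟩
  have hmemneg : ∀ ω (v : V n H), (∀ k, ‖v k‖ ≤ 1) →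
      0 ≤ F t ω (w ω - perturbation R η σ (x ω) t v) ∧
        F t ω (w ω - perturbation R η σ (x ω) t v) ≤ B := fun ω v hv => by
    have := hmem ω ((-1 : ℝ) • v) fun k => by simpa using hv k
    rwa [perturbation_smul, neg_one_smul, ← sub_eq_add_neg] at this
  have hB : 0 < B := (hr ω₀).bound_pos
  set p : Fin H × Fin n → Ω → ℝ := fun α ω => linCoeff (F t ω) (w ω) (ε α ω) with hp
  set Q : Fin H × Fin n → Fin H × Fin n → Ω → ℝ :=
    fun α γ ω => quadCoeff (F t ω) (w ω) (ε α ω) (ε γ ω) with hQ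
  set r : Fin H × Fin n → Ω → ℝ := fun α ω =>
    act (ellipsoid R η σ (x ω) (s α.1))⁻¹ (x ω t - y) α.2 with hrr
  have hpB : ∀ α ω, |p α ω| ≤ B := fun α ω =>
    abs_linCoeff_le (hmem ω _ (norm_stdVector_apply_le α)) (hmemneg ω _ (norm_stdVector_apply_le α))
  have heven : ∀ ω (v : V n H), (∀ k, ‖v k‖ ≤ 1) →
      |evenPart (F t ω) (w ω) (perturbation R η σ (x ω) t v)| ≤ B := fun ω v hv =>
    abs_evenPart_le (hmem0 ω) (hmem ω v hv) (hmemneg ω v hv)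
  have hQB : ∀ α γ ω, |Q α γ ω| ≤ 3 * B := fun α γ ω => by
    refine abs_quadCoeff_le ?_ (heven ω _ (norm_stdVector_apply_le α))
      (heven ω _ (norm_stdVector_apply_le γ))
    rw [← perturbation_add, ← perturbation_smul]
    refine heven ω _ fun k => ?_
    have h1 := norm_add_le (stdVector α k) (stdVector γ k)
    have h2 := norm_stdVector_apply_le α k
    have h3 := norm_stdVector_apply_le γ k
    rw [PiLp.smul_apply, PiLp.add_apply, norm_smul, Real.norm_of_nonneg (by norm_num)]
    linarith
  -- The constant may depend on T and on R, since it is used only for integrability.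
  obtain ⟨M, hM⟩ : ∃ M : ℝ, ∀ α ω, |r α ω| ≤ M := by
    refine ⟨√((Real.exp T * ‖iteratedFDeriv ℝ 2 R (argminOn R (interior K))‖ + η * σ * T) * D ^ 2),
      fun α ω => ?_⟩
    refine (PiLp.norm_apply_le (act (ellipsoid R η σ (x ω) (s α.1))⁻¹ (x ω t - y)) α.2).trans ?_
    refine Real.le_sqrt_of_sq_le (((hr ω).norm_act_inv_sq_le ((hst _).trans htT) _).trans ?_)
    have := hK.diam_le _ (interior_subset (hxK ω t)) _ hy
    gcongr
  -- The estimator as n times a quadratic polynomial in U times a linear form in U; the coefficients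
  -- c, p, Q and r involve only F_t and the iterates, so they are independent of U.
  have hsum : ∀ ω, ⟪gradEst R η σ (fun s => (u s ω : E n)) (fun s => F s ω) (x ω) t, x ω t - y⟫ =
      n * ((F t ω (w ω) + ∑ α, p α ω * U α ω + ∑ α, ∑ γ, Q α γ ω * (U α ω * U γ ω)) *
        ∑ δ, r δ ω * U δ ω) := fun ω => by
    rw [inner_gradEst htH, window_play, perturbation_eq_sum, (hloss ω).apply_add_sum]
    rfl
  have hY : ∀ ω, Y ω = ∑ α, p α ω * U α ω := fun ω => by
    simp only [Y, hp, (hloss ω).linCoeff_eq]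
    rw [perturbation_eq_sum, inner_sum]
    exact Finset.sum_congr rfl fun α _ => by rw [real_inner_smul_right, mul_comm]; rfl
  have hD : ∀ ω, ⟪gradient (F t ω) (w ω), diag H (x ω t - y)⟫ = ∑ α, p α ω * r α ω := fun ω => by
    simp only [hp, (hloss ω).linCoeff_eq]
    rw [← perturbation_inv (t := t) hK hR hησ.le (hxK ω), perturbation_eq_sum, inner_sum]
    exact Finset.sum_congr rfl fun α _ => by rw [real_inner_smul_right, mul_comm]
  have hpm : ∀ α, Measurable[𝒢] (p α) := fun α =>
    measurable_linCoeff hFm (hFc t ht) hwm (hεm α)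
  have hQm : ∀ α γ, Measurable[𝒢] (Q α γ) := fun α γ =>
    measurable_quadCoeff hFm (hFc t ht) hwm (hεm α) (hεm γ)
  have hrm : ∀ α, Measurable[𝒢] (r α) := fun α =>
    (EuclideanSpace.proj α.2 : E n →L[ℝ] ℝ).continuous.measurable.comp
      (measurable_act (measurable_ellipsoid_inv_apply hK hR hησ.le (hxm _ (hst _))
        fun ω => hxK ω _) (Measurable.sub_const (hxm t le_rfl) y))
  have hcm : Measurable[𝒢] fun ω => F t ω (w ω) :=
    measurable_apply_of_continuous hFm (hFc t ht) hwm
  set C := max (3 * B) M with hC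
  have hC1 : 3 * B ≤ C := le_max_left _ _
  have hlin := integral_linear_eq_zero h𝒢le h𝒰le hind hUm hU1 hpm hpB hm1
  have hquad := integral_quadratic_mul_linear h𝒢le h𝒰le hind hUm hU1 hcm hpm hrm hQm (C := C)
    (fun ω => by rw [abs_of_nonneg (hmem0 ω).1]; linarith [(hmem0 ω).2])
    (fun α ω => (hpB α ω).trans (by linarith)) (fun α γ ω => (hQB α γ ω).trans hC1)
    (fun α ω => (hM α ω).trans (le_max_right _ _)) hm1 hm2 hm2' hm3
  have hn0 : (n : ℝ) ≠ 0 := by exact_mod_cast (by omega : n ≠ 0)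
  refine ⟨?_, ?_⟩
  · rw [show Y = _ from funext hY]
    exact hlin
  · have hZ : Z = fun ω => ∑ α, p α ω * r α ω -
        n * ((F t ω (w ω) + ∑ α, p α ω * U α ω + ∑ α, ∑ γ, Q α γ ω * (U α ω * U γ ω)) *
          ∑ δ, r δ ω * U δ ω) := funext fun ω => by rw [← hD, ← hsum]
    rw [hZ]
    refine ⟨hquad.2.1.sub (hquad.1.const_mul _), ?_⟩
    -- The factor n of the estimator cancels the covariance 1/n.
    rw [integral_sub hquad.2.1 (hquad.1.const_mul _), integral_const_mul, hquad.2.2,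
      mul_inv_cancel_left₀ hn0, sub_self]

/-- For s ≤ t the iterate x_s is determined by the past up to t - H. That past is exactly what the
adversary condition makes independent, jointly with F_t, of the noises of the window. -/
theorem integral_gradEst (hu : IsExplorationNoise P T u) (hF : IsAdversary P T u F)
    (hr : ∀ ω, IsStableRun K R ν D η σ β B L T (fun s => (u s ω : E n)) (fun s => F s ω)) {t : ℕ}
    (ht : t ∈ Finset.Icc H T) {y : E n} (hy : y ∈ K) :
    let x := fun ω => iterate K R η σ (fun s => (u s ω : E n)) (fun s => F s ω)
    let Y := fun ω => ⟪gradient (F t ω) (window H (x ω) t),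
      perturbation R η σ (x ω) t (window H (fun s => (u s ω : E n)) t)⟫
    let Z := fun ω => ⟪gradient (F t ω) (window H (x ω) t), diag H (x ω t - y)⟫ -
      ⟪gradEst R η σ (fun s => (u s ω : E n)) (fun s => F s ω) (x ω) t, x ω t - y⟫
    (Integrable Y P ∧ ∫ ω, Y ω ∂P = 0) ∧ (Integrable Z P ∧ ∫ ω, Z ω ∂P = 0) := by
  obtain ⟨htH, htT⟩ := Finset.mem_Icc.1 ht
  obtain ⟨ω₀⟩ := nonempty_of_isProbabilityMeasure P
  have hH := (hr ω₀).one_le_memory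
  have hle : ∀ s, 1 ≤ s → s ≤ T → MeasurableSpace.comap (u s) inferInstance ≤ mΩ :=
    fun s h1 h2 => (hu.measurable s (Finset.mem_Icc.2 ⟨h1, h2⟩)).comap_le
  have hle' : ∀ s, H ≤ s → s ≤ T → MeasurableSpace.comap (F s) inferInstance ≤ mΩ :=
    fun s h1 h2 => (hF.measurable s (Finset.mem_Icc.2 ⟨h1, h2⟩)).comap_le
  refine integral_gradEst_of_indep hu hr ht hy ?_ ?_ (hF.indep t ht) ?_ (fun s hs => ?_)
    (fun s h1 h2 => ?_)
  · exact sup_le (sup_le (hle' t htH htT) (iSup₂_le fun s hs =>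
      hle s hs.1 (hs.2.trans (by omega)))) (iSup₂_le fun s hs => hle' s hs.1 (hs.2.trans (by omega)))
  · exact iSup₂_le fun s hs => hle s (le_trans (by omega) hs.1) (hs.2.trans htT)
  · exact Measurable.mono (comap_measurable (F t)) (le_sup_left.trans le_sup_left) le_rfl
  · refine (measurable_iterate (hr ω₀).constraintSet (hr ω₀).barrier (hr ω₀).step_pos
      (hr ω₀).curvature_pos hH (fun t ht ω => ((hr ω).loss t ht).continuous) (by omega)).mono
        ((pastSigma_mono (k := t - H) (by omega)).trans ?_) le_rfl
    rw [pastSigma, sup_assoc]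
    exact le_sup_right
  · exact Measurable.mono (comap_measurable _)
      (le_biSup (fun s => MeasurableSpace.comap (u s) inferInstance)
        (show s ∈ Set.Icc (t - (H - 1)) t from ⟨h1, h2⟩)) le_rfl

end MeanZero

end EBCOM

namespace EBCOM

/-! ### From realizations to expected regret. -/

section ExpectedRegret

variable {n H T : ℕ} {K : Set (E n)} {R : E n → ℝ} {ν D η σ β B L : ℝ} {Ω : Type*}
  {u : ℕ → Ω → Metric.sphere (0 : E n) 1} {F : ℕ → Ω → V n H → ℝ}

theorem playedRV_mem (hK : IsConstraintSet K D) (hR : IsSelfConcordantBarrier K R ν) (hη : 0 < η)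
    (hσ : 0 < σ) (hH : 1 ≤ H) {t : ℕ} (ht : 1 ≤ t) (ω : Ω) : playedRV K R η σ u F t ω ∈ K :=
  played_mem hK hR hη hσ hH ht (by simp)

theorem suffered_mem_Icc (hK : IsConstraintSet K D) (hR : IsSelfConcordantBarrier K R ν)
    (hη : 0 < η) (hσ : 0 < σ) (hH : 1 ≤ H) {t : ℕ} (htH : H ≤ t) {ω : Ω}
    (hF : IsLoss K β σ B L (F t ω)) : suffered K R η σ u F t ω ∈ Set.Icc 0 B := by
  have h : ∀ i, window H (fun s => playedRV K R η σ u F s ω) t i ∈ K := fun i =>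
    playedRV_mem hK hR hη hσ hH (by omega) ω
  exact ⟨hF.nonneg _ h, hF.bounded _ h⟩

variable [MeasurableSpace Ω] {P : Measure Ω}

theorem expectedRegret_le_of_forall (hK : K.Nonempty) {M : ℝ}
    (h : ∀ y ∈ K, ∑ t ∈ Finset.Icc H T, ∫ ω, suffered K R η σ u F t ω ∂P -
      ∑ t ∈ Finset.Icc H T, ∫ ω, unary (F t ω) y ∂P ≤ M) :
    expectedRegret P T K R η σ u F ≤ M := by
  have := hK.to_subtype
  rw [expectedRegret, sub_le_comm]
  exact le_ciInf fun y => sub_le_comm.1 (h y y.2)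

variable [IsProbabilityMeasure P]

theorem integrable_suffered (hK : IsConstraintSet K D) (hR : IsSelfConcordantBarrier K R ν)
    (hη : 0 < η) (hσ : 0 < σ) (hH : 1 ≤ H) (hu : IsExplorationNoise P T u)
    (hA : IsAdversary P T u F) (hF : ∀ t ∈ Finset.Icc H T, ∀ ω, IsLoss K β σ B L (F t ω)) {t : ℕ}
    (ht : t ∈ Finset.Icc H T) : Integrable (suffered K R η σ u F t) P := by
  obtain ⟨htH, htT⟩ := Finset.mem_Icc.1 ht
  have hpast : pastSigma u F T ≤ ‹MeasurableSpace Ω› :=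
    sup_le (iSup₂_le fun s hs => (hu.measurable s (Finset.mem_Icc.2 hs)).comap_le)
      (iSup₂_le fun s hs => (hA.measurable s (Finset.mem_Icc.2 hs)).comap_le)
  have hx : ∀ s ≤ t, Measurable
      fun ω => iterate K R η σ (fun s => (u s ω : E n)) (fun s => F s ω) s := fun s hs =>
    (measurable_iterate hK hR hη hσ hH (fun t ht ω => (hF t ht ω).continuous) (by omega)).mono
      ((pastSigma_mono (by omega)).trans hpast) le_rfl
  refine integrable_of_abs_le (C := B) (measurable_apply_of_continuous (hA.measurable t ht)
    (fun ω => (hF t ht ω).continuous) (measurable_window fun i => ?_)) fun ω => ?_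
  · have hi := i.2
    exact measurable_play hK hR (mul_pos hη hσ).le
      (u := fun ω s => (u s ω : E n)) (measurable_subtype_coe.comp
        (hu.measurable _ (Finset.mem_Icc.2 (by omega)))) (hx _ (by omega))
      fun ω => iterate_mem_interior hK hR hη hH _
  · have h := suffered_mem_Icc (u := u) hK hR hη hσ hH htH (hF t ht ω)
    rw [abs_of_nonneg h.1]
    exact h.2

theorem integrable_unary (hA : IsAdversary P T u F) {t : ℕ} (ht : t ∈ Finset.Icc H T)
    (hF : ∀ ω, IsLoss K β σ B L (F t ω)) {y : E n} (hy : y ∈ K) :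
    Integrable (fun ω => unary (F t ω) y) P := by
  refine integrable_of_abs_le (C := B)
    ((measurable_pi_apply (diag H y)).comp (hA.measurable t ht)) fun ω => ?_
  have h0 : 0 ≤ unary (F t ω) y := (hF ω).nonneg _ fun _ => hy
  rw [abs_of_nonneg h0]
  exact (hF ω).bounded _ fun _ => hy

/-- The expected regret against a point of the interior. -/
theorem sum_integral_suffered_sub_le (hu : IsExplorationNoise P T u) (hA : IsAdversary P T u F)
    (hr : ∀ ω, IsStableRun K R ν D η σ β B L T (fun s => (u s ω : E n)) (fun s => F s ω))
    (hβ : 0 < β) (hL : 0 < L) {y : E n} (hy : y ∈ interior K) :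
    ∑ t ∈ Finset.Icc H T, ∫ ω, suffered K R η σ u F t ω ∂P -
      ∑ t ∈ Finset.Icc H T, ∫ ω, unary (F t ω) y ∂P ≤
        β * (H * (1 + Real.log T)) / (η * σ) + T * (3 * L * (H ^ 2 * (D * (20 * η * n * B * H)))) +
          4 * B * H + (R y - R (argminOn R (interior K))) / η +
          T * (4 * n * B * H ^ 3 * (20 * η * n * B * H)) := by
  obtain ⟨ω₀⟩ := nonempty_of_isProbabilityMeasure P
  have hF : ∀ t ∈ Finset.Icc H T, ∀ ω, IsLoss K β σ B L (F t ω) := fun t ht ω => (hr ω).loss t ht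
  have hs := fun t (ht : t ∈ Finset.Icc H T) => integrable_suffered (hr ω₀).constraintSet
    (hr ω₀).barrier (hr ω₀).step_pos (hr ω₀).curvature_pos (hr ω₀).one_le_memory hu hA hF ht
  have hf := fun t (ht : t ∈ Finset.Icc H T) => integrable_unary hA ht (hF t ht)
    (interior_subset hy)
  have hg := fun t (ht : t ∈ Finset.Icc H T) =>
    integral_gradEst hu hA hr ht (interior_subset hy)
  have hdet := fun ω => (hr ω).regret_le hβ hL hy
  simp only [iterate_of_le (le_refl H)] at hdet
  set c := β * (H * (1 + Real.log T)) / (η * σ) +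
    T * (3 * L * (H ^ 2 * (D * (20 * η * n * B * H)))) + 4 * B * H +
    (R y - R (argminOn R (interior K))) / η + T * (4 * n * B * H ^ 3 * (20 * η * n * B * H))
  have hsf : ∀ t ∈ Finset.Icc H T,
      Integrable (fun ω => suffered K R η σ u F t ω - unary (F t ω) y) P :=
    fun t ht => (hs t ht).sub (hf t ht)
  rw [← Finset.sum_sub_distrib,
    Finset.sum_congr rfl fun t ht => (integral_sub (hs t ht) (hf t ht)).symm,
    ← integral_finsetSum _ hsf]
  have hYZ := fun t (ht : t ∈ Finset.Icc H T) => (hg t ht).1.1.add (hg t ht).2.1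
  refine (integral_mono (integrable_finsetSum _ hsf)
    ((integrable_finsetSum _ hYZ).add (integrable_const c)) hdet).trans (le_of_eq ?_)
  refine (integral_add (integrable_finsetSum _ hYZ) (integrable_const c)).trans ?_
  rw [integral_finsetSum _ hYZ, Finset.sum_eq_zero fun t ht => ?_]
  · simp
  · refine (integral_add (hg t ht).1.1 (hg t ht).2.1).trans ?_
    rw [(hg t ht).1.2, (hg t ht).2.2, add_zero]

theorem IsLoss.unary_sub_unary_le {F : V n H → ℝ} (hF : IsLoss K β σ B L F) (hK : Convex ℝ K)
    (hL : 0 ≤ L) {y z : E n} (hy : y ∈ K) (hz : z ∈ K) : unary F y - unary F z ≤ L * (H * ‖y - z‖) := by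
  refine (hF.apply_sub_le hK (fun _ => hy) fun _ => hz).trans
    (mul_le_mul_of_nonneg_left ?_ hL)
  rw [← diag_sub]
  refine le_of_sq_le_sq ?_ (by positivity)
  rw [norm_diag_sq, mul_pow]
  refine mul_le_mul_of_nonneg_right ?_ (sq_nonneg _)
  exact_mod_cast Nat.le_self_pow two_ne_zero H

/-- The comparator may lie on the boundary, where the barrier gives no finite bound; it is replaced
by a nearby interior point. -/
theorem expectedRegret_le (hu : IsExplorationNoise P T u) (hA : IsAdversary P T u F)
    (hr : ∀ ω, IsStableRun K R ν D η σ β B L T (fun s => (u s ω : E n)) (fun s => F s ω))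
    (hβ : 0 < β) (hL : 0 < L) (hT : 2 ≤ T) :
    expectedRegret P T K R η σ u F ≤
      β * (H * (1 + Real.log T)) / (η * σ) + T * (3 * L * (H ^ 2 * (D * (20 * η * n * B * H)))) +
          4 * B * H + ν * Real.log T / η +
          T * (4 * n * B * H ^ 3 * (20 * η * n * B * H)) + L * D * H := by
  obtain ⟨ω₀⟩ := nonempty_of_isProbabilityMeasure P
  have hK := (hr ω₀).constraintSet
  have hR := (hr ω₀).barrier
  have hF : ∀ t ∈ Finset.Icc H T, ∀ ω, IsLoss K β σ B L (F t ω) := fun t ht ω => (hr ω).loss t ht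
  have hη := (hr ω₀).step_pos
  have hD := hK.diam_nonneg
  refine expectedRegret_le_of_forall (hK.interior_nonempty.mono interior_subset) fun z hz => ?_
  have hx₀ := (argminOn_barrier_spec hK hR).1
  set x₀ := argminOn R (interior K)
  have hT0 : (2 : ℝ) ≤ T := by exact_mod_cast hT
  have h0 : 0 ≤ 1 - (T : ℝ)⁻¹ := sub_nonneg.2 (inv_le_one_of_one_le₀ (by linarith))
  have h1 : 1 - (T : ℝ)⁻¹ < 1 := by
    have : 0 < (T : ℝ)⁻¹ := by positivity
    linarith
  -- Moving by the fraction 1/T towards the minimizer of R makes the barrier difference at most ν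
  -- log T, while the losses change by at most LHD/T per round, LDH in total.
  set y := x₀ + (1 - (T : ℝ)⁻¹) • (z - x₀) with hy
  have hyK : y ∈ interior K := by
    have := hK.convex.add_smul_sub_mem_interior hz hx₀ (t := (T : ℝ)⁻¹)
      ⟨by positivity, inv_le_one_of_one_le₀ (by linarith)⟩
    convert this using 1
    rw [hy]
    module
  have hRy := barrier_le_of_line (hr ω₀).one_le_dim hK hR hx₀ hz h0 h1
  rw [sub_sub_cancel, Real.log_inv, neg_mul_neg] at hRy
  have hyz : ‖y - z‖ ≤ D / T := by
    have : y - z = (T : ℝ)⁻¹ • (x₀ - z) := by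
      rw [hy]
      module
    rw [this, norm_smul, Real.norm_of_nonneg (by positivity), inv_mul_eq_div]
    have := hK.diam_le _ (interior_subset hx₀) _ hz
    gcongr
  have h2 := sum_integral_suffered_sub_le hu hA hr hβ hL hyK
  have h3 : ∑ t ∈ Finset.Icc H T, ∫ ω, unary (F t ω) y ∂P -
      ∑ t ∈ Finset.Icc H T, ∫ ω, unary (F t ω) z ∂P ≤ L * D * H := by
    rw [← Finset.sum_sub_distrib]
    have h4 : ∀ t ∈ Finset.Icc H T, ∫ ω, unary (F t ω) y ∂P - ∫ ω, unary (F t ω) z ∂P ≤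
        L * (H * (D / T)) := fun t ht => by
      have iy := integrable_unary hA ht (hF t ht) (interior_subset hyK)
      have iz := integrable_unary hA ht (hF t ht) hz
      rw [← integral_sub iy iz]
      refine (integral_mono (iy.sub iz) (integrable_const (L * (H * (D / T)))) fun ω => ?_).trans
        (by simp)
      refine ((hF t ht ω).unary_sub_unary_le hK.convex hL.le (interior_subset hyK) hz).trans ?_
      gcongr
    refine (Finset.sum_le_card_nsmul _ _ _ h4).trans ?_
    have h5 : ((Finset.Icc H T).card : ℝ) ≤ T := by
      have := (hr ω₀).one_le_memory
      rw [Nat.card_Icc]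
      exact_mod_cast (by omega : T + 1 - H ≤ T)
    rw [nsmul_eq_mul]
    calc _ ≤ (T : ℝ) * (L * (H * (D / T))) := by gcongr
      _ = L * D * H := by field_simp
  have h6 : (R y - R x₀) / η ≤ ν * Real.log T / η := by gcongr
  linarith

/-- All losses lie in [0, B]; no stability of the leaders is needed. -/
theorem expectedRegret_le_mul (hK : IsConstraintSet K D) (hR : IsSelfConcordantBarrier K R ν)
    (hη : 0 < η) (hσ : 0 < σ) (hB : 0 < B) (hH : 1 ≤ H) (hu : IsExplorationNoise P T u)
    (hA : IsAdversary P T u F) (hF : ∀ t ∈ Finset.Icc H T, ∀ ω, IsLoss K β σ B L (F t ω)) :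
    expectedRegret P T K R η σ u F ≤ T * B := by
  refine expectedRegret_le_of_forall (hK.interior_nonempty.mono interior_subset) fun z hz => ?_
  have h1 : 0 ≤ ∑ t ∈ Finset.Icc H T, ∫ ω, unary (F t ω) z ∂P :=
    Finset.sum_nonneg fun t ht => integral_nonneg fun ω => (hF t ht ω).nonneg _ fun _ => hz
  have h2 : ∀ t ∈ Finset.Icc H T, ∫ ω, suffered K R η σ u F t ω ∂P ≤ B := fun t ht => by
    refine (integral_mono (integrable_suffered hK hR hη hσ hH hu hA hF ht) (integrable_const B)
      fun ω => (suffered_mem_Icc hK hR hη hσ hH (Finset.mem_Icc.1 ht).1 (hF t ht ω)).2).trans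
        (by simp)
  have h3 := Finset.sum_le_card_nsmul _ _ _ h2
  have h5 : ((Finset.Icc H T).card : ℝ) ≤ T := by
    rw [Nat.card_Icc]
    exact_mod_cast (by omega : T + 1 - H ≤ T)
  rw [nsmul_eq_mul] at h3
  nlinarith

end ExpectedRegret

end EBCOM

/-! ### Choice of the step size and the final rate. -/

namespace EBCOM

/-- The tuning of the step size. -/
theorem regret_rate {n T H s B D L ν β σ η l lg c₁ c₂ X S : ℝ} (hn : 1 ≤ n) (hH : 1 ≤ H)
    (hs : 1 ≤ s) (hT : T = s * s) (hB : 0 < B) (hD : 0 ≤ D) (hL : 0 < L) (hν : 0 < ν) (hβ : 0 < β)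
    (hσ : 0 < σ) (hc₁ : 0 < c₁) (hc₂ : 0 < c₂) (hη : 0 < η) (hl1 : 1 ≤ l) (hlH : l ≤ H)
    (hlg : 0 ≤ lg) (hβσ : σ ≤ 2 * H * β) (h1 : c₁ ≤ η * (n * B * H * l * s))
    (h2 : η * (n * B * H * l * s) ≤ c₂) (hX : X = β * n / σ * s) (hS : S = 1 + B + D + L + ν) :
    β * (H * (1 + lg)) / (η * σ) + T * (3 * L * (H ^ 2 * (D * (20 * η * n * B * H)))) +
      4 * B * H + ν * lg / η + T * (4 * n * B * H ^ 3 * (20 * η * n * B * H)) + L * D * H ≤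
        (3 / c₁ + 280 * c₂ + 10) * S ^ 2 * (H ^ 4 * (1 + lg)) * X := by
  have hX0 : 0 < X := by rw [hX]; positivity
  -- Terms without the factor β/σ are absorbed by β/σ ≥ 1/(2H), at the price of a factor 2H. Here s
  -- is √T, l is 1 + log H, lg is log T and X is the target rate.
  have hns : n * s ≤ 2 * H * X := by
    have : n * s = σ / σ * (n * s) := by field_simp
    rw [this, hX]
    calc σ / σ * (n * s) ≤ (2 * H * β) / σ * (n * s) := by gcongr
      _ = _ := by ring
  have hs' : s ≤ 2 * H * X := le_trans (by nlinarith) hns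
  -- The logarithmic factor in the step size is used only through 1 ≤ l ≤ H: the upper estimate
  -- here, the lower one in `h2'`.
  have hη' : 1 / η ≤ n * B * H * H * s / c₁ := by
    rw [div_le_div_iff₀ hη hc₁, one_mul]
    refine h1.trans ?_
    rw [mul_comm]
    gcongr
  have h2' : η * n * B * H * s ≤ c₂ := by
    refine le_trans ?_ h2
    have : 0 ≤ η * n * B * H * s := by positivity
    nlinarith
  have hBS : B ≤ S := by linarith
  have hLS : L ≤ S := by linarith
  have hDS : D ≤ S := by linarith
  have hνS : ν ≤ S := by linarith
  have hS1 : 1 ≤ S := by linarith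
  have hS2 : S ≤ S ^ 2 := by nlinarith
  have hH2 : ∀ k ≤ 4, H ^ k ≤ H ^ 4 := fun k hk => pow_le_pow_right₀ hH hk
  have hl' : 1 ≤ 1 + lg := by linarith
  have e1 : β * (H * (1 + lg)) / (η * σ) ≤ 1 / c₁ * S ^ 2 * (H ^ 4 * (1 + lg)) * X := by
    calc β * (H * (1 + lg)) / (η * σ) = β * (H * (1 + lg)) / σ * (1 / η) := by field_simp
      _ ≤ β * (H * (1 + lg)) / σ * (n * B * H * H * s / c₁) := by gcongr
      _ = 1 / c₁ * B * (H ^ 3 * (1 + lg)) * X := by rw [hX]; field_simp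
      _ ≤ _ := by
        gcongr
        · exact hBS.trans hS2
        · norm_num
  have hk : ∀ {a k m : ℝ}, 0 ≤ a → k ≤ S ^ 2 → m ≤ H ^ 4 * (1 + lg) → 0 ≤ m →
      a * k * m * X ≤ a * S ^ 2 * (H ^ 4 * (1 + lg)) * X := fun ha hk hm hm0 => by gcongr
  have hm : ∀ j ≤ 4, H ^ j ≤ H ^ 4 * (1 + lg) := fun j hj =>
    (hH2 j hj).trans (le_mul_of_one_le_right (by positivity) hl')
  have hLD : L * D ≤ S ^ 2 := by
    rw [sq]
    gcongr
  have e2 : T * (3 * L * (H ^ 2 * (D * (20 * η * n * B * H)))) ≤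
      120 * c₂ * S ^ 2 * (H ^ 4 * (1 + lg)) * X := by
    calc T * (3 * L * (H ^ 2 * (D * (20 * η * n * B * H))))
        = 60 * (η * n * B * H * s) * (L * D) * H ^ 2 * s := by rw [hT]; ring
      _ ≤ 60 * c₂ * (L * D) * H ^ 2 * (2 * H * X) := by gcongr
      _ = 120 * c₂ * (L * D) * H ^ 3 * X := by ring
      _ ≤ _ := hk (by positivity) hLD (hm 3 (by norm_num)) (by positivity)
  have e3 : 4 * B * H ≤ 8 * S ^ 2 * (H ^ 4 * (1 + lg)) * X := by
    calc 4 * B * H ≤ 4 * B * H * (2 * H * X) :=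
          le_mul_of_one_le_right (by positivity) (hs.trans hs')
      _ = 8 * B * H ^ 2 * X := by ring
      _ ≤ _ := hk (by positivity) (hBS.trans hS2) (hm 2 (by norm_num)) (by positivity)
  have e4 : ν * lg / η ≤ 2 / c₁ * S ^ 2 * (H ^ 4 * (1 + lg)) * X := by
    calc ν * lg / η = ν * lg * (1 / η) := by ring
      _ ≤ ν * lg * (n * B * H * H * s / c₁) := by gcongr
      _ = ν * lg * B * H ^ 2 / c₁ * (n * s) := by ring
      _ ≤ ν * lg * B * H ^ 2 / c₁ * (2 * H * X) := by gcongr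
      _ = 2 / c₁ * (ν * B) * (H ^ 3 * lg) * X := by ring
      _ ≤ _ := by
        refine hk (by positivity) (by rw [sq]; gcongr) ?_ (by positivity)
        exact mul_le_mul (hH2 3 (by norm_num)) (by linarith) hlg (by positivity)
  have e5 : T * (4 * n * B * H ^ 3 * (20 * η * n * B * H)) ≤
      160 * c₂ * S ^ 2 * (H ^ 4 * (1 + lg)) * X := by
    calc T * (4 * n * B * H ^ 3 * (20 * η * n * B * H))
        = 80 * (η * n * B * H * s) * B * H ^ 3 * (n * s) := by rw [hT]; ring
      _ ≤ 80 * c₂ * B * H ^ 3 * (2 * H * X) := by gcongr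
      _ = 160 * c₂ * B * H ^ 4 * X := by ring
      _ ≤ _ := hk (by positivity) (hBS.trans hS2) (hm 4 le_rfl) (by positivity)
  have e6 : L * D * H ≤ 2 * S ^ 2 * (H ^ 4 * (1 + lg)) * X := by
    calc L * D * H ≤ L * D * H * (2 * H * X) :=
          le_mul_of_one_le_right (by positivity) (hs.trans hs')
      _ = 2 * (L * D) * H ^ 2 * X := by ring
      _ ≤ _ := hk (by positivity) hLD (hm 2 (by norm_num)) (by positivity)
  calc _ ≤ (1 / c₁ + 120 * c₂ + 8 + 2 / c₁ + 160 * c₂ + 2) * S ^ 2 * (H ^ 4 * (1 + lg)) * X := by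
        linarith
    _ = _ := by ring

/-- For short horizons the trivial bound on the regret suffices. -/
theorem trivial_regret_rate {n T H s B β σ lg c₂ X S : ℝ} (hn : 1 ≤ n) (hH : 1 ≤ H)
    (hs : 1 ≤ s) (hT : T = s * s) (hB : 0 < B) (hβ : 0 < β) (hσ : 0 < σ) (hc₂ : 0 < c₂)
    (hlg : 0 ≤ lg) (hβσ : σ ≤ 2 * H * β) (hsH : s ≤ 320 * c₂ * H) (hX : X = β * n / σ * s)
    (hBS : B ≤ S) (hS : 1 ≤ S) :
    T * B ≤ 640 * c₂ * S ^ 2 * (H ^ 4 * (1 + lg)) * X := by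
  have hX0 : 0 < X := by rw [hX]; positivity
  have hns : n * s ≤ 2 * H * X := by
    have : n * s = σ / σ * (n * s) := by field_simp
    rw [this, hX]
    calc σ / σ * (n * s) ≤ (2 * H * β) / σ * (n * s) := by gcongr
      _ = _ := by ring
  have hs' : s ≤ 2 * H * X := le_trans (by nlinarith) hns
  calc T * B = s * s * B := by rw [hT]
    _ ≤ 320 * c₂ * H * (2 * H * X) * B := by gcongr
    _ = 640 * c₂ * B * (H ^ 2 * 1) * X := by ring
    _ ≤ _ := by
      gcongr
      · nlinarith
      · norm_num
      · linarith

end EBCOM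

theorem theorem1 (a : ℝ) (p : ℕ) (c₁ c₂ : ℝ) (hc₁ : 0 < c₁) (hc₂ : 0 < c₂) :
    ∃ (C : ℝ) (q : ℕ), 0 < C ∧
      ∀ (n T H : ℕ), 1 ≤ n → 2 ≤ T → 1 ≤ H → (H : ℝ) ≤ a * Real.log T ^ p →
      ∀ (K : Set (EBCOM.E n)) (R : EBCOM.E n → ℝ) (ν β σ B D L η : ℝ),
      0 < β → 0 < σ → 0 < B → 0 < L →
      EBCOM.IsConstraintSet K D →
      EBCOM.IsSelfConcordantBarrier K R ν →
      c₁ / (n * B * H * (1 + Real.log H) * √T) ≤ η →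
      η ≤ c₂ / (n * B * H * (1 + Real.log H) * √T) →
      ∀ (Ω : Type*) [MeasurableSpace Ω] (P : Measure Ω) [IsProbabilityMeasure P]
        (u : ℕ → Ω → Metric.sphere (0 : EBCOM.E n) 1)
        (F : ℕ → Ω → EBCOM.V n H → ℝ),
      EBCOM.IsExplorationNoise P T u →
      EBCOM.IsAdversary P T u F →
      (∀ t ∈ Finset.Icc H T, ∀ ω, EBCOM.IsLoss K β σ B L (F t ω)) →
      (∀ t ∈ Finset.Icc 1 T, ∀ ω, EBCOM.playedRV K R η σ u F t ω ∈ K) ∧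
      (∀ t ∈ Finset.Icc H T, Integrable (EBCOM.suffered K R η σ u F t) P) ∧
      EBCOM.expectedRegret P T K R η σ u F ≤
        C * (1 + B + D + L + ν) ^ q * Real.log T ^ q * (β * n / σ * √T) := by
  -- 920 = 280 + 640, so that one constant covers both the stable and the trivial regime.
  set C₀ := 3 / c₁ + 920 * c₂ + 10 with hC₀
  have hC₀pos : 0 < C₀ := by positivity
  -- H⁴ ≤ |a|⁴ (log T)^(4p), and log T ≥ 1/2 gives 1 + log T ≤ 6 (log T)², hence the exponent 4p +
  -- 2.
  refine ⟨6 * (|a| ^ 4 + 1) * C₀, 4 * p + 2, by positivity, ?_⟩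
  intro n T H hn hT hH hHa K R ν β σ B D L η hβ hσ hB hL hK hR hη₁ hη₂ Ω _ P _ u F hu hA hF
  have hn' : (1 : ℝ) ≤ n := by exact_mod_cast hn
  have hH' : (1 : ℝ) ≤ H := by exact_mod_cast hH
  have hT' : (2 : ℝ) ≤ T := by exact_mod_cast hT
  have hs : 1 ≤ √(T : ℝ) := Real.one_le_sqrt.2 (by linarith)
  have hTs : (T : ℝ) = √(T : ℝ) * √(T : ℝ) := (Real.mul_self_sqrt (by linarith)).symm
  have hlH0 : 0 ≤ Real.log H := Real.log_nonneg hH'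
  have hlH : 1 + Real.log H ≤ H := by
    have := Real.log_le_sub_one_of_pos (show (0 : ℝ) < H by linarith)
    linarith
  have hlg : 1 / 2 ≤ Real.log T := by
    have h1 := Real.log_le_log (by norm_num) hT'
    have h2 := Real.log_two_gt_d9
    linarith
  have hden : 0 < (n : ℝ) * B * H * (1 + Real.log H) * √T := by positivity
  have hη : 0 < η := lt_of_lt_of_le (by positivity) hη₁
  rw [div_le_iff₀ hden] at hη₁
  rw [le_div_iff₀ hden] at hη₂
  refine ⟨fun t ht ω => EBCOM.playedRV_mem hK hR hη hσ hH (Finset.mem_Icc.1 ht).1 ω,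
    fun t ht => EBCOM.integrable_suffered hK hR hη hσ hH hu hA hF ht, ?_⟩
  have hD := hK.diam_nonneg
  have hν := EBCOM.barrier_parameter_pos hn hK hR
  set S := 1 + B + D + L + ν with hS
  set X := β * n / σ * √T with hX
  clear_value X S
  have hS1 : 1 ≤ S := by linarith
  have hX0 : 0 ≤ X := by rw [hX]; positivity
  have hlgp : 0 ≤ Real.log T := by linarith
  have hmono : ∀ k ≤ C₀, k * S ^ 2 * ((H : ℝ) ^ 4 * (1 + Real.log T)) * X ≤
      C₀ * S ^ 2 * ((H : ℝ) ^ 4 * (1 + Real.log T)) * X := fun k hk =>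
    mul_le_mul_of_nonneg_right (mul_le_mul_of_nonneg_right (mul_le_mul_of_nonneg_right hk
      (by positivity)) (by positivity)) hX0
  have hc₁' : 0 < 3 / c₁ := by positivity
  suffices h : EBCOM.expectedRegret P T K R η σ u F ≤
      C₀ * S ^ 2 * ((H : ℝ) ^ 4 * (1 + Real.log T)) * X by
    refine h.trans (mul_le_mul_of_nonneg_right ?_ hX0)
    have h1 : (H : ℝ) ^ 4 * (1 + Real.log T) ≤ 6 * (|a| ^ 4 + 1) * Real.log T ^ (4 * p + 2) := by
      have h2 : (H : ℝ) ≤ |a| * Real.log T ^ p :=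
        hHa.trans (mul_le_mul_of_nonneg_right (le_abs_self a) (by positivity))
      calc (H : ℝ) ^ 4 * (1 + Real.log T)
          ≤ (|a| * Real.log T ^ p) ^ 4 * (6 * (Real.log T * Real.log T)) := by
            gcongr
            nlinarith
        _ = 6 * |a| ^ 4 * Real.log T ^ (4 * p + 2) := by ring
        _ ≤ _ := by
          gcongr
          linarith
    calc C₀ * S ^ 2 * ((H : ℝ) ^ 4 * (1 + Real.log T))
        ≤ C₀ * S ^ (4 * p + 2) * (6 * (|a| ^ 4 + 1) * Real.log T ^ (4 * p + 2)) := by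
          gcongr
          omega
      _ = _ := by ring
  rcases Nat.lt_or_ge T H with hTH | hTH
  · have h0 : EBCOM.expectedRegret P T K R η σ u F = 0 := by
      simp [EBCOM.expectedRegret, Finset.Icc_eq_empty (Nat.not_le.2 hTH)]
    rw [h0]
    positivity
  obtain ⟨ω₀⟩ := nonempty_of_isProbabilityMeasure P
  have hβσ : σ ≤ 2 * H * β := (hF T (Finset.mem_Icc.2 ⟨hTH, le_rfl⟩) ω₀).le_two_mul hn hK
  -- The stability condition reads 320ηnBH² ≤ 1. Since ηnBH√T ≤ c₂, it holds once √T ≥ 320c₂H;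
  -- otherwise TB is small enough.
  rcases le_total √(T : ℝ) (320 * c₂ * H) with hsH | hsH
  · refine (EBCOM.expectedRegret_le_mul hK hR hη hσ hB hH hu hA hF).trans ?_
    refine (EBCOM.trivial_regret_rate hn' hH' hs hTs hB hβ hσ hc₂ hlgp hβσ hsH hX (by linarith)
      hS1).trans (hmono _ (by linarith))
  · have hsmall : 16 * (H : ℝ) * (20 * η * n * B * H) ≤ 1 := by
      have h1 : η * n * B * H * √(T : ℝ) ≤ c₂ := by
        refine le_trans ?_ hη₂
        have : 0 ≤ η * n * B * H * √(T : ℝ) := by positivity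
        nlinarith
      have h2 : η * n * B * H * (320 * c₂ * H) ≤ c₂ * 1 :=
        (mul_le_mul_of_nonneg_left hsH (by positivity)).trans (h1.trans (mul_one c₂).ge)
      refine le_of_mul_le_mul_left (le_trans (le_of_eq ?_) h2) hc₂
      ring
    have hr : ∀ ω, EBCOM.IsStableRun K R ν D η σ β B L T (fun s => (u s ω : EBCOM.E n))
        (fun s => F s ω) := fun ω =>
      ⟨hK, hR, hn, hH, hTH, hη, hσ, hB, fun t => by simp, fun t ht => hF t ht ω, hsmall⟩
    refine (EBCOM.expectedRegret_le hu hA hr hβ hL hT).trans ?_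
    refine (EBCOM.regret_rate hn' hH' hs hTs hB hD hL hν hβ hσ hc₁ hc₂ hη (by linarith) hlH hlgp hβσ
      hη₁ hη₂ hX hS).trans (hmono _ (by linarith))
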